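/- **Conventions.** Manifolds are Hausdorff, finite-dimensional and of constant dimension. For a vector field $V$, $\varphi^V_t$ denotes its (local) flow for time $t$, defined at $x$ whenever the integral curve of $V$ starting at $x$ exists up to time $t$. A $d$-dimensional *holomorphic foliation* of a complex manifold $M$ of dimension $n$ is a decomposition of $M$ into disjoint path-connected subsets (leaves) such that every point of $M$ has a holomorphic chart $(z_1,\dots,z_n):U\to\mathbb C^n$ around it for which the connected components of $U\cap L$, for every leaf $L$ meeting $U$, are slices $\{z_{d+1}=c_{d+1},\dots,z_n=c_n\}$ of $U$. A *smooth foliation* of a smooth manifold is defined in the same way with smooth charts. A *pseudo-holomorphic foliation* of an almost complex manifold $(M,J)$ is a smooth foliation of $M$ whose leaves have tangent spaces closed under $J$. For vector fields $V,W$ on $X$ and $x_0\in X$ put $$L^{V,W}_{x_0}=\{\varphi^V_{t_1}\circ\varphi^W_{s_1}\circ\cdots\circ\varphi^V_{t_n}\circ\varphi^W_{s_n}(x_0)\;:\; n\in\mathbb N,\ t_j,s_j\in\mathbb R,\ \text{the composition being defined at } x_0\}.$$ **(1) Holomorphic case.** Let $X$ be a complex manifold with complex structure $J$, $\Omega$ a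 closed holomorphic $2$-form on $X$ that is non-degenerate on $T^{(1,0)}X$, and $\mathcal H:X\to\mathbb C$ a holomorphic function. Let $X_{\mathcal H}=\tfrac12(X^R_{\mathcal H}-iJ(X^R_{\mathcal H}))$ be the holomorphic vector field with $\Omega(X_{\mathcal H},\cdot)=-d\mathcal H$, and let $E\in\mathbb C$ be a regular value, i.e. $d\mathcal H\neq0$ at every point of $\mathcal H^{-1}(E)$. Then $\mathcal H^{-1}(E)$ is an embedded complex submanifold of $X$ of complex dimension $\dim_{\mathbb C}X-1$ (possibly empty). The sets $L_{x_0}=L_{x_0}^{X^R_{\mathcal H},\,J(X^R_{\mathcal H})}$, $x_0\in\mathcal H^{-1}(E)$, are contained in $\mathcal H^{-1}(E)$ and are the leaves of a holomorphic foliation of $\mathcal H^{-1}(E)$ of complex leaf dimension $1$. Every holomorphic trajectory of energy $E$, i.e. every holomorphic map $\gamma:U\to X$ on a non-empty connected open set $U\subset\mathbb C$ with $\gamma'(z)=X_{\mathcal H}(\gamma(z))$ and $\mathcal H(\gamma(z))=E$ for all $z\in U$, has its image contained in a single leaf. **(2) Pseudo-holomorphic case.** Let $X$ be a smooth manifold,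 $\Omega_R$ a symplectic form on $X$, $J$ an almost complex structure on $X$ (not necessarily integrable) with $\Omega_R(J\cdot,J\cdot)=-\Omega_R$, and $\mathcal H_R:X\to\mathbb R$ a smooth function with Hamiltonian vector field $X_{\mathcal H_R}$, $\Omega_R(X_{\mathcal H_R},\cdot)=-d\mathcal H_R$. Assume that the $1$-form $\Omega_R(J(X_{\mathcal H_R}),\cdot)$ is exact, let $\mathcal H_I$ be a smooth primitive of it, and put $\mathcal H=\mathcal H_R+i\mathcal H_I$ and $X_{\mathcal H}=\tfrac12(X_{\mathcal H_R}-iJ(X_{\mathcal H_R}))$. Let $E\in\mathbb C$ be a regular value, i.e. $d\mathcal H\ne0$ at every point of $\mathcal H^{-1}(E)$. Then $\mathcal H^{-1}(E)$ is an embedded submanifold of $X$ of real dimension $\dim_{\mathbb R}X-2$ (possibly empty) whose tangent spaces are closed under $J$, and $J$ restricts to an almost complex structure on it. The sets $L_{x_0}=L_{x_0}^{X_{\mathcal H_R},\,J(X_{\mathcal H_R})}$, $x_0\in\mathcal H^{-1}(E)$, are contained in $\mathcal H^{-1}(E)$ and are the leaves of a pseudo-holomorphic foliation of $\mathcal H^{-1}(E)$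 of real leaf dimension $2$. Every pseudo-holomorphic trajectory of energy $E$, i.e. every smooth map $\gamma:U\to X$ on a non-empty connected open set $U\subset\mathbb C$ with $d\gamma\circ i=J\circ d\gamma$, $\tfrac12(\partial_t\gamma-i\,\partial_s\gamma)=X_{\mathcal H}\circ\gamma$ (where $z=t+is$) and $\mathcal H\circ\gamma=E$ on $U$, has its image contained in a single leaf. -/

import Mathlib

open Set Topology Manifold TensorProduct
open scoped ContDiff

namespace HamFol

/-! ### Differential two-forms on a manifold

The same definitions serve smooth forms on real manifolds (`𝕜 = ℝ`, `r = ∞`) and holomorphic forms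
on complex manifolds (`𝕜 = ℂ`, `r = ω`). In the complex case the fibre
`TangentSpace 𝓘(ℂ, E) x` is the tangent space `T_x X` with the complex structure `J = i`, which is
the holomorphic tangent space `T^{(1,0)}_x X` through `v ↦ (v - i J v) / 2`. -/

section Forms

variable {𝕜 : Type*} [NontriviallyNormedField 𝕜]
  {E : Type*} [NormedAddCommGroup E] [NormedSpace 𝕜 E]
  {X : Type*} [TopologicalSpace X] [ChartedSpace E X]

variable (𝕜 E X) in
/-- A field of alternating `𝕜`-bilinear forms on the tangent spaces of `X`. -/
abbrev TwoForm : Type _ := ∀ x : X, (TangentSpace 𝓘(𝕜, E) x) [⋀^Fin 2]→L[𝕜] 𝕜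

variable (𝕜 E X) in
/-- A (rough) vector field on `X`. -/
abbrev VField : Type _ := ∀ x : X, TangentSpace 𝓘(𝕜, E) x

/-- The expression `(φ⁻¹)^* Ω` of a two-form in a chart `φ`. -/
noncomputable def TwoForm.inChart (Ω : TwoForm 𝕜 E X) (φ : OpenPartialHomeomorph X E) (y : E) :
    E [⋀^Fin 2]→L[𝕜] 𝕜 :=
  (Ω (φ.symm y)).compContinuousLinearMap (mfderiv 𝓘(𝕜, E) 𝓘(𝕜, E) φ.symm y)

/-- A two-form of class `C^r`: its coefficients are of class `C^r` in every chart. -/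
def TwoForm.IsRegular (r : ℕ∞ω) (Ω : TwoForm 𝕜 E X) : Prop :=
  ∀ φ ∈ atlas E X, ContDiffOn 𝕜 r (Ω.inChart φ) φ.target

/-- `dΩ = 0`, computed in charts. -/
def TwoForm.IsClosed (Ω : TwoForm 𝕜 E X) : Prop :=
  ∀ φ ∈ atlas E X, ∀ y ∈ φ.target, extDeriv (Ω.inChart φ) y = 0

/-- Pointwise non-degeneracy. -/
def TwoForm.IsNondegenerate (Ω : TwoForm 𝕜 E X) : Prop :=
  ∀ x (v : TangentSpace 𝓘(𝕜, E) x), v ≠ 0 → ∃ w, Ω x ![v, w] ≠ 0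

open Classical in
/-- The Hamiltonian vector field `X_h` of `h : X → 𝕜` with respect to `Ω`: the vector field with
`Ω(X_h, ·) = -dh` (see `hamVF_spec`, `eq_hamVF`). -/
noncomputable def hamVF (Ω : TwoForm 𝕜 E X) (h : X → 𝕜) : VField 𝕜 E X := fun x =>
  if hv : ∃ v : TangentSpace 𝓘(𝕜, E) x, ∀ w, Ω x ![v, w] = -(mfderiv 𝓘(𝕜, E) 𝓘(𝕜, 𝕜) h x w : 𝕜)
  then hv.choose else 0

theorem update_pair_zero {V : Type*} (a b c : V) : Function.update ![a, b] 0 c = ![c, b] := by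
  ext i
  fin_cases i <;> rfl

theorem update_pair_one {V : Type*} (a b c : V) : Function.update ![a, b] 1 c = ![a, c] := by
  ext i
  fin_cases i <;> rfl

/-- The linear map `v ↦ Ω(v, ·)` at a point. -/
noncomputable def TwoForm.contract (Ω : TwoForm 𝕜 E X) (x : X) :
    TangentSpace 𝓘(𝕜, E) x →ₗ[𝕜] Module.Dual 𝕜 (TangentSpace 𝓘(𝕜, E) x) :=
  LinearMap.mk₂ 𝕜 (fun v w => Ω x ![v, w])
    (fun v v' w => by
      have h := (Ω x).map_update_add ![0, w] 0 v v'
      rwa [update_pair_zero, update_pair_zero, update_pair_zero] at h)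
    (fun c v w => by
      have h := (Ω x).map_update_smul ![0, w] 0 c v
      rwa [update_pair_zero, update_pair_zero] at h)
    (fun v w w' => by
      have h := (Ω x).map_update_add ![v, 0] 1 w w'
      rwa [update_pair_one, update_pair_one, update_pair_one] at h)
    (fun c v w => by
      have h := (Ω x).map_update_smul ![v, 0] 1 c w
      rwa [update_pair_one, update_pair_one] at h)

theorem TwoForm.IsNondegenerate.contract_injective {Ω : TwoForm 𝕜 E X} (hΩ : Ω.IsNondegenerate)
    (x : X) : Function.Injective (Ω.contract x) := by
  rw [← LinearMap.ker_eq_bot, LinearMap.ker_eq_bot']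
  intro v hv
  by_contra hne
  obtain ⟨w, hw⟩ := hΩ x v hne
  exact hw (congrArg (fun f => f w) hv)

theorem hamVF_spec [FiniteDimensional 𝕜 E] {Ω : TwoForm 𝕜 E X} (hΩ : Ω.IsNondegenerate)
    (h : X → 𝕜) (x : X) (w : TangentSpace 𝓘(𝕜, E) x) :
    Ω x ![hamVF Ω h x, w] = -(mfderiv 𝓘(𝕜, E) 𝓘(𝕜, 𝕜) h x w : 𝕜) := by
  have : FiniteDimensional 𝕜 (TangentSpace 𝓘(𝕜, E) x) := inferInstanceAs (FiniteDimensional 𝕜 E)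
  have hv : ∃ v : TangentSpace 𝓘(𝕜, E) x, ∀ w,
      Ω x ![v, w] = -(mfderiv 𝓘(𝕜, E) 𝓘(𝕜, 𝕜) h x w : 𝕜) := by
    have hs : Function.Surjective (Ω.contract x) :=
      (LinearMap.injective_iff_surjective_of_finrank_eq_finrank
        Subspace.dual_finrank_eq.symm).1 (hΩ.contract_injective x)
    let f : TangentSpace 𝓘(𝕜, E) x →L[𝕜] 𝕜 := mfderiv 𝓘(𝕜, E) 𝓘(𝕜, 𝕜) h x
    obtain ⟨v, hv⟩ := hs (-f.toLinearMap)
    exact ⟨v, fun w => congrArg (fun g => g w) hv⟩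
  unfold hamVF
  rw [dif_pos hv]
  exact hv.choose_spec w

theorem eq_hamVF [FiniteDimensional 𝕜 E] {Ω : TwoForm 𝕜 E X} (hΩ : Ω.IsNondegenerate)
    (h : X → 𝕜) (x : X) (v : TangentSpace 𝓘(𝕜, E) x)
    (hv : ∀ w, Ω x ![v, w] = -(mfderiv 𝓘(𝕜, E) 𝓘(𝕜, 𝕜) h x w : 𝕜)) : v = hamVF Ω h x := by
  apply hΩ.contract_injective x
  ext w
  exact (hv w).trans (hamVF_spec hΩ h x w).symm

end Forms

/-! ### Regular values -/

/-- `e` is a regular value of `H : X → ℂ`: the differential of `H` vanishes at no point of the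
energy hypersurface `H⁻¹(e)`. The differential is over `𝕜 = ℂ` for holomorphic `H` on a complex
manifold, over `𝕜 = ℝ` for smooth `H` on a real manifold. -/
def IsRegularValue (𝕜 : Type*) [NontriviallyNormedField 𝕜] [NormedSpace 𝕜 ℂ]
    (E : Type*) [NormedAddCommGroup E] [NormedSpace 𝕜 E]
    {X : Type*} [TopologicalSpace X] [ChartedSpace E X] (H : X → ℂ) (e : ℂ) : Prop :=
  ∀ x, H x = e → mfderiv 𝓘(𝕜, E) 𝓘(𝕜, ℂ) H x ≠ 0

/-! ### Flows and leaves -/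

section Flows

variable {E : Type*} [NormedAddCommGroup E] [NormedSpace ℝ E]
  {X : Type*} [TopologicalSpace X] [ChartedSpace E X]

/-- `FlowsTo V t x y` means `φ^V_t(x) = y` for the (local) flow of `V`: the integral curve of `V`
starting at `x` is defined at time `t` and has the value `y` there. -/
def FlowsTo (V : VField ℝ E X) (t : ℝ) (x y : X) : Prop :=
  ∃ (a b : ℝ) (γ : ℝ → X), 0 ∈ Ioo a b ∧ t ∈ Ioo a b ∧ γ 0 = x ∧ γ t = y ∧
    IsMIntegralCurveOn γ V (Ioo a b)

/-- The set of all points `φ^V_{t₁} ∘ φ^W_{s₁} ∘ ⋯ ∘ φ^V_{tₙ} ∘ φ^W_{sₙ} (x₀)` for all `n` and all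
real times for which the composition is defined at `x₀`. -/
def leaf (V W : VField ℝ E X) (x₀ : X) : Set X :=
  {y | Relation.ReflTransGen
    (fun p q => ∃ (s t : ℝ) (z : X), FlowsTo W s p z ∧ FlowsTo V t z q) x₀ y}

/-- The decomposition of a subset `S` of `X` into the (traces on `S` of the) sets `leaf V W x₀`,
`x₀ ∈ S`. -/
def leaves (V W : VField ℝ E X) (S : Set X) : Set (Set S) :=
  range fun x₀ : S => ((↑) : S → X) ⁻¹' leaf V W x₀

end Flows

/-! ### Foliations -/

section Foliations

variable {𝕜 : Type*} [RCLike 𝕜] {n : ℕ} {M : Type*} [TopologicalSpace M]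

/-- `φ = (z₁, …, zₙ)` is adapted to `L`: for every `ℓ ∈ L`, each connected component of `U ∩ ℓ`,
`U` the domain of `φ`, is a slice `z_{d+1} = c_{d+1}, …, zₙ = cₙ` of `U`. -/
def IsFoliationChart (d : ℕ) (L : Set (Set M))
    (φ : OpenPartialHomeomorph M (EuclideanSpace 𝕜 (Fin n))) : Prop :=
  ∀ ℓ ∈ L, ∀ p ∈ φ.source ∩ ℓ, connectedComponentIn (φ.source ∩ ℓ) p =
    {y | y ∈ φ.source ∧ ∀ i : Fin n, d ≤ (i : ℕ) → φ y i = φ p i}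

variable [ChartedSpace (EuclideanSpace 𝕜 (Fin n)) M]

variable (𝕜 n) in
/-- `L` is a `d`-dimensional foliation of the `C^r` manifold `M` of dimension `n` over `𝕜`: a
decomposition into disjoint path-connected leaves, with an adapted `C^r` chart at every point.
For `𝕜 = ℂ`, `r = ω` this is a holomorphic foliation of a complex manifold, for `𝕜 = ℝ`, `r = ∞`
a smooth foliation. -/
structure IsFoliation (r : ℕ∞ω) (d : ℕ) (L : Set (Set M)) : Prop where
  isPartition : Setoid.IsPartition L
  isPathConnected : ∀ ℓ ∈ L, IsPathConnected ℓ
  exists_chart : ∀ p : M, d ≤ n ∧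
    ∃ φ ∈ IsManifold.maximalAtlas 𝓘(𝕜, EuclideanSpace 𝕜 (Fin n)) r M,
      p ∈ φ.source ∧ IsFoliationChart d L φ

end Foliations

/-! ### Almost complex structures and pseudo-holomorphic foliations -/

section AlmostComplex

variable {E : Type*} [NormedAddCommGroup E] [NormedSpace ℝ E]
  {X : Type*} [TopologicalSpace X] [ChartedSpace E X]

variable (E X) in
/-- A field of endomorphisms of the tangent spaces. -/
abbrev EndField : Type _ := ∀ x : X, TangentSpace 𝓘(ℝ, E) x →L[ℝ] TangentSpace 𝓘(ℝ, E) x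

/-- `J` is an almost complex structure: a smooth field of endomorphisms with `J² = -1`. -/
structure IsAlmostComplex [IsManifold 𝓘(ℝ, E) ∞ X] (J : EndField E X) : Prop where
  smooth : ContMDiff 𝓘(ℝ, E) (𝓘(ℝ, E).prod 𝓘(ℝ, E →L[ℝ] E)) ∞
    (fun x => Bundle.TotalSpace.mk' (E →L[ℝ] E)
      (E := fun x : X => TangentSpace 𝓘(ℝ, E) x →L[ℝ] TangentSpace 𝓘(ℝ, E) x) x (J x))
  sq_eq : ∀ x v, J x (J x v) = -v

/-- The tangent space at `p` of a leaf `ℓ`: the velocities at `p` of smooth curves in `ℓ`. -/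
def leafTangent (ℓ : Set X) (p : X) : Set (TangentSpace 𝓘(ℝ, E) p) :=
  {v | ∃ γ : ℝ → X, ContMDiffAt 𝓘(ℝ, ℝ) 𝓘(ℝ, E) ∞ γ 0 ∧ γ 0 = p ∧ (∀ᶠ t in 𝓝 0, γ t ∈ ℓ) ∧
    HasMFDerivAt 𝓘(ℝ, ℝ) 𝓘(ℝ, E) γ 0 ((1 : ℝ →L[ℝ] ℝ).smulRight (v : E))}

/-- `L` is a pseudo-holomorphic foliation, with leaves of real dimension `d`, of the almost complex
manifold `(M, J)` of real dimension `n`: a smooth foliation such that the tangent spaces of the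
leaves are closed under `J`. -/
structure IsPseudoHolFoliation {n : ℕ} {M : Type*} [TopologicalSpace M]
    [ChartedSpace (EuclideanSpace ℝ (Fin n)) M] [IsManifold 𝓘(ℝ, EuclideanSpace ℝ (Fin n)) ∞ M]
    (J : EndField (EuclideanSpace ℝ (Fin n)) M) (d : ℕ) (L : Set (Set M)) : Prop where
  isAlmostComplex : IsAlmostComplex J
  isFoliation : IsFoliation ℝ n ∞ d L
  tangent_closed : ∀ ℓ ∈ L, ∀ p ∈ ℓ, ∀ v ∈ leafTangent ℓ p, J p v ∈ leafTangent ℓ p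

end AlmostComplex

/-! ### Holomorphic Hamiltonian systems -/

section Holomorphic

variable {E : Type*} [NormedAddCommGroup E] [NormedSpace ℂ E]
  {X : Type*} [TopologicalSpace X] [ChartedSpace E X]

/-- `(X, Ω, H)` is a holomorphic Hamiltonian system: `Ω` is a closed holomorphic two-form,
non-degenerate on the holomorphic tangent bundle, and `H` is a holomorphic function. -/
structure IsHHS (Ω : TwoForm ℂ E X) (H : X → ℂ) : Prop where
  holomorphic_form : Ω.IsRegular ω
  closed : Ω.IsClosed
  nondegenerate : Ω.IsNondegenerate
  holomorphic : ContMDiff 𝓘(ℂ, E) 𝓘(ℂ, ℂ) ω H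

/-- The real vector field `V^R` of a vector field `V = (V^R - i J(V^R)) / 2` of type `(1,0)`. As
`T^{(1,0)} X` is represented by `(TX, J)`, this only forgets the complex structure. -/
noncomputable def realField (V : VField ℂ E X) : VField ℝ E X := fun x => (V x : E)

/-- The real vector field `J(V^R)`, where `J` is multiplication by `i` on the tangent spaces. -/
noncomputable def realFieldJ (V : VField ℂ E X) : VField ℝ E X := fun x =>
  (Complex.I • V x : TangentSpace 𝓘(ℂ, E) x)

/-- `γ : U → X` is a holomorphic trajectory: `U ⊆ ℂ` is open and connected, `γ` is holomorphic on
`U`, and `γ'(z) = X_H(γ(z))` there. Values of `γ` outside `U` play no role. -/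
structure IsHolTrajectory (Ω : TwoForm ℂ E X) (H : X → ℂ) (U : Set ℂ) (γ : ℂ → X) : Prop where
  isOpen : IsOpen U
  isConnected : IsConnected U
  holomorphic : MDifferentiableOn 𝓘(ℂ, ℂ) 𝓘(ℂ, E) γ U
  deriv_eq : ∀ z ∈ U, mfderiv 𝓘(ℂ, ℂ) 𝓘(ℂ, E) γ z (1 : ℂ) = hamVF Ω H (γ z)

end Holomorphic

/-! ### Pseudo-holomorphic Hamiltonian systems -/

section PseudoHolomorphic

variable {E : Type*} [NormedAddCommGroup E] [NormedSpace ℝ E]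
  {X : Type*} [TopologicalSpace X] [ChartedSpace E X]

/-- The vector field `J(V)`. -/
noncomputable def applyJ (J : EndField E X) (V : VField ℝ E X) : VField ℝ E X := fun x => J x (V x)

/-- `(X, J; Ω_R, H_R)` is a pseudo-holomorphic Hamiltonian system and `H_I` is a primitive of the
one-form `Ω_R(J(X_{H_R}), ·)`: `Ω_R` is a symplectic form, `J` is an almost complex structure with
`Ω_R(J·, J·) = -Ω_R`, and `dH_I = Ω_R(J(X_{H_R}), ·)` (so that this one-form is exact), where
`Ω_R(X_{H_R}, ·) = -dH_R`. -/
structure IsPHHS [IsManifold 𝓘(ℝ, E) ∞ X] (J : EndField E X) (ΩR : TwoForm ℝ E X)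
    (HR HI : X → ℝ) : Prop where
  almostComplex : IsAlmostComplex J
  smooth_form : ΩR.IsRegular ∞
  closed : ΩR.IsClosed
  nondegenerate : ΩR.IsNondegenerate
  anticompatible : ∀ x (v w : TangentSpace 𝓘(ℝ, E) x), ΩR x ![J x v, J x w] = -ΩR x ![v, w]
  smooth_re : ContMDiff 𝓘(ℝ, E) 𝓘(ℝ, ℝ) ∞ HR
  smooth_im : ContMDiff 𝓘(ℝ, E) 𝓘(ℝ, ℝ) ∞ HI
  primitive : ∀ x (w : TangentSpace 𝓘(ℝ, E) x),
    (mfderiv 𝓘(ℝ, E) 𝓘(ℝ, ℝ) HI x w : ℝ) = ΩR x ![J x (hamVF ΩR HR x), w]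

/-- The complex Hamiltonian `H = H_R + i H_I`. -/
def complexHam (HR HI : X → ℝ) : X → ℂ := fun x => ⟨HR x, HI x⟩

/-- `(v - i w) / 2` in the complexified tangent space. -/
noncomputable def halfSub {x : X} (v w : TangentSpace 𝓘(ℝ, E) x) :
    ℂ ⊗[ℝ] TangentSpace 𝓘(ℝ, E) x :=
  (1 / 2 : ℂ) • ((1 : ℂ) ⊗ₜ[ℝ] v - Complex.I ⊗ₜ[ℝ] w)

/-- The Hamiltonian vector field `X_H = (X_{H_R} - i J(X_{H_R})) / 2`, a section of
`T^{(1,0)} X`. -/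
noncomputable def pseudoHamVF (J : EndField E X) (ΩR : TwoForm ℝ E X) (HR : X → ℝ) (x : X) :
    ℂ ⊗[ℝ] TangentSpace 𝓘(ℝ, E) x :=
  halfSub (hamVF ΩR HR x) (J x (hamVF ΩR HR x))

/-- `γ : U → X` is a pseudo-holomorphic trajectory: `U ⊆ ℂ` is open and connected, `γ` is smooth on
`U` with `dγ ∘ i = J ∘ dγ`, and `(∂γ/∂t - i ∂γ/∂s) / 2 = X_H ∘ γ` on `U`, with `z = t + i s`. -/
structure IsPseudoHolTrajectory (J : EndField E X) (ΩR : TwoForm ℝ E X) (HR : X → ℝ)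
    (U : Set ℂ) (γ : ℂ → X) : Prop where
  isOpen : IsOpen U
  isConnected : IsConnected U
  smooth : ContMDiffOn 𝓘(ℝ, ℂ) 𝓘(ℝ, E) ∞ γ U
  pseudoHolomorphic : ∀ z ∈ U, ∀ ζ : ℂ,
    mfderiv 𝓘(ℝ, ℂ) 𝓘(ℝ, E) γ z (Complex.I * ζ) = J (γ z) (mfderiv 𝓘(ℝ, ℂ) 𝓘(ℝ, E) γ z ζ)
  deriv_eq : ∀ z ∈ U,
    halfSub (mfderiv 𝓘(ℝ, ℂ) 𝓘(ℝ, E) γ z (1 : ℂ)) (mfderiv 𝓘(ℝ, ℂ) 𝓘(ℝ, E) γ z Complex.I) =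
      pseudoHamVF J ΩR HR (γ z)

end PseudoHolomorphic

end HamFol

open HamFol

/-! Both cases reduce to one situation: a family `A x : ℂ → T_x X` of pairwise commuting vector
fields and a function `h : X → ℂ` that is constant along them, with `A x` injective and `dh`
surjective on the level set (`IsIntegrable`). In the holomorphic case `A x p = p X_H`, and
commutation is automatic because the family is spanned over `ℂ` by one field. In the
pseudo-holomorphic case `A x p = (re p) X_{H_R} + (im p) J X_{H_R}`. Here `J X_{H_R} = -X_{H_I}`,
anticompatibility gives `Ω_R(X_{H_R}, J X_{H_R}) = 0`, and Hamiltonian fields of functions in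
involution commute because `Ω_R` is closed.

A commuting family has a joint local flow `Ψ(p, x)`, the time-one flow of `A p`, with `∂Ψ/∂p =
A(Ψ)`. It is obtained from the inverse function theorem in the Banach space of curves `C([0,1], E)`,
an argument that treats smooth and analytic regularity alike (`exists_flow`). Flowing from a
transversal on which `h` is a coordinate gives charts into `ℂ × Z × ℂ` in which `A p` is the
constant field `(p, 0, 0)` and `h` is the last coordinate (`exists_normalForm`,
`IsIntegrable.exists_isAdapted`). Fixing the last coordinate gives submanifold charts of the level
set; fixing the last two gives the slices of the foliation.

Following flow lines stays in the level set, is reversible and traces paths, so the sets `leaf`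
partition the level set and are path-connected. It remains to see that a component of a leaf inside
a chart is a single slice. A slice is connected and lies in one leaf. Conversely, a leaf meets a
chart in only countably many slices (`countable_leaf_image`). No countability of `X` is needed: one
flow applied to a slice is parametrized by a subset of `ℝ × ℂ`, which is Lindelöf, and commutation
of the flows makes the slice of the endpoint locally constant. A connected set with countably many
transverse coordinates has just one. The same argument computes the tangent spaces of leaves.

The tangent spaces of the level set are the kernels of `dH`. These are `J`-invariant since `dH ∘ J =
i dH`, so `J` restricts; the leaf tangents, being the values of `A`, are `J`-invariant too. A
trajectory maps short horizontal and vertical segments to integral curves, so the condition of lying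
in a given leaf is locally constant on its connected domain. -/

namespace HamFol

/-! ### Inverse function theorem on a neighbourhood -/

section InverseFunction

variable {𝕜 : Type*} [RCLike 𝕜] {E : Type*} [NormedAddCommGroup E] [NormedSpace 𝕜 E]
  [CompleteSpace E] {F : Type*} [NormedAddCommGroup F] [NormedSpace 𝕜 F]

/-- The inverse function theorem, with regularity of the inverse on a whole neighbourhood. -/
theorem exists_openPartialHomeomorph_contDiffOn {n : ℕ∞ω} (hn : 1 ≤ n) {f : E → F} {U : Set E}
    (hU : IsOpen U) (hf : ContDiffOn 𝕜 n f U) {a : E} (ha : a ∈ U) (f' : E ≃L[𝕜] F)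
    (hf' : HasFDerivAt f (f' : E →L[𝕜] F) a) :
    ∃ e : OpenPartialHomeomorph E F, a ∈ e.source ∧ e.source ⊆ U ∧ (e : E → F) = f ∧
      ContDiffOn 𝕜 n e.symm e.target := by
  have hn0 : n ≠ 0 := fun h => by simp [h] at hn
  have hfa : ContDiffAt 𝕜 n f a := hf.contDiffAt (hU.mem_nhds ha)
  set e₀ := hfa.toOpenPartialHomeomorph f hf' hn0
  set R : Set (E →L[𝕜] F) := range ((↑) : (E ≃L[𝕜] F) → E →L[𝕜] F)
  -- Shrinking the source to the open set where the derivative is invertible makes the inverse `C^n`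
  -- at every point of the target, not only at the image of `a`.
  have hV : IsOpen (U ∩ fderiv 𝕜 f ⁻¹' R) :=
    (hf.continuousOn_fderiv_of_isOpen hU hn).isOpen_inter_preimage hU ContinuousLinearEquiv.isOpen
  refine ⟨e₀.restrOpen _ hV, ⟨hfa.mem_toOpenPartialHomeomorph_source hf' hn0, ha, f', hf'.fderiv.symm⟩,
    fun x hx => hx.2.1, rfl, fun y hy => ContDiffAt.contDiffWithinAt ?_⟩
  have hx := (e₀.restrOpen _ hV).map_target hy
  obtain ⟨-, hxU, g, hg⟩ := hx
  refine (e₀.restrOpen _ hV).contDiffAt_symm (f₀' := g) hy ?_ (hf.contDiffAt (hU.mem_nhds hxU))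
  rw [hg]
  exact ((hf.contDiffAt (hU.mem_nhds hxU)).differentiableAt hn0).hasFDerivAt

end InverseFunction

/-! ### Regularity of the composition operator on spaces of curves -/

section CompositionOperator

universe u

variable {𝕜 : Type*} [RCLike 𝕜] {K : Type*} [TopologicalSpace K] [CompactSpace K]

section

variable {E : Type*} [NormedAddCommGroup E] {F : Type*} [NormedAddCommGroup F]

variable (K) in
/-- The continuous maps from `K` to `E` with values in `U`. -/
def mapsInto (U : Set E) : Set C(K, E) := {γ | MapsTo γ univ U}

theorem isOpen_mapsInto {U : Set E} (hU : IsOpen U) : IsOpen (mapsInto K U) :=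
  ContinuousMap.isOpen_setOfPred_mapsTo isCompact_univ hU

open Classical in
/-- The composition operator `γ ↦ f ∘ γ` for a function `f` that is continuous on `U`, extended by
zero to curves that leave `U`. -/
noncomputable def compOp (f : E → F) (U : Set E) (γ : C(K, E)) : C(K, F) :=
  if h : Continuous (f ∘ γ) ∧ γ ∈ mapsInto K U then ⟨f ∘ γ, h.1⟩ else 0

omit [CompactSpace K] in
theorem compOp_apply {f : E → F} {U : Set E} (hf : ContinuousOn f U) {γ : C(K, E)}
    (hγ : γ ∈ mapsInto K U) (k : K) : compOp f U γ k = f (γ k) := by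
  have : Continuous (f ∘ γ) := hf.comp_continuous γ.continuous fun k => hγ (mem_univ k)
  simp [compOp, this, hγ]

end

variable {E : Type*} [NormedAddCommGroup E] [NormedSpace 𝕜 E]

variable (𝕜 K) in
/-- Pointwise application of a continuous family of linear maps to a continuous map. -/
noncomputable def applyL (E F : Type*) [NormedAddCommGroup E] [NormedSpace 𝕜 E]
    [NormedAddCommGroup F] [NormedSpace 𝕜 F] :
    C(K, E →L[𝕜] F) →L[𝕜] C(K, E) →L[𝕜] C(K, F) :=
  LinearMap.mkContinuous₂
    (LinearMap.mk₂ 𝕜 (fun (g : C(K, E →L[𝕜] F)) (γ : C(K, E)) =>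
        (⟨fun k => g k (γ k), by fun_prop⟩ : C(K, F)))
      (fun _ _ _ => by ext; simp) (fun _ _ _ => by ext; simp)
      (fun _ _ _ => by ext; simp) (fun _ _ _ => by ext; simp)) 1
    (fun g γ => by
      rw [one_mul]
      refine (ContinuousMap.norm_le _ (by positivity)).2 fun k => ?_
      exact ((g k).le_opNorm _).trans
        (by gcongr; exacts [g.norm_coe_le_norm k, γ.norm_coe_le_norm k]))

@[simp]
theorem applyL_apply {F : Type*} [NormedAddCommGroup F] [NormedSpace 𝕜 F]
    (g : C(K, E →L[𝕜] F)) (γ : C(K, E)) (k : K) : applyL 𝕜 K E F g γ k = g k (γ k) := rfl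

/-- The range of `γ` is compact, so it has a uniform thickening inside `U`, and `f` is uniformly
continuous at its points. This provides a `δ` independent of `k`, which sup-norm estimates require.
-/
theorem exists_thickening_dist_lt {E F : Type*} [NormedAddCommGroup E] [NormedAddCommGroup F]
    {f : E → F} {U : Set E} (hU : IsOpen U) (hf : ContinuousOn f U) {γ : C(K, E)}
    (hγ : γ ∈ mapsInto K U) {ε : ℝ} (hε : 0 < ε) :
    ∃ δ > 0, ∀ k, ∀ y ∈ Metric.ball (γ k) δ, y ∈ U ∧ dist (f y) (f (γ k)) < ε := by
  have hsub : range γ ⊆ U := by rintro _ ⟨k, rfl⟩; exact hγ (mem_univ k)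
  have hcomp : IsCompact (range γ) := isCompact_range γ.continuous
  obtain ⟨δ₁, hδ₁, h₁⟩ := hcomp.exists_thickening_subset_open hU hsub
  obtain ⟨δ₂, hδ₂, h₂⟩ := Metric.mem_uniformity_dist.1 (hcomp.uniformContinuousAt_of_continuousAt f
    (fun x hx => hf.continuousAt (hU.mem_nhds (hsub hx))) (Metric.dist_mem_uniformity hε))
  refine ⟨min δ₁ δ₂, lt_min hδ₁ hδ₂, fun k y hy => ⟨h₁ ?_, ?_⟩⟩
  · exact Metric.mem_thickening_iff.2 ⟨γ k, mem_range_self k,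
      (Metric.mem_ball.1 hy).trans_le (min_le_left _ _)⟩
  · rw [dist_comm]
    exact h₂ (by rw [dist_comm]; exact (Metric.mem_ball.1 hy).trans_le (min_le_right _ _))
      (mem_range_self k)

theorem continuousOn_compOp {E F : Type*} [NormedAddCommGroup E] [NormedAddCommGroup F]
    {f : E → F} {U : Set E}
    (hU : IsOpen U) (hf : ContinuousOn f U) : ContinuousOn (compOp f U) (mapsInto K U) := by
  intro γ hγ
  refine ContinuousAt.continuousWithinAt (Metric.continuousAt_iff.2 fun ε hε => ?_)
  obtain ⟨δ, hδ, h⟩ := exists_thickening_dist_lt hU hf hγ (half_pos hε)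
  have hη' : ∀ η : C(K, E), dist η γ < δ → ∀ k, η k ∈ Metric.ball (γ k) δ := fun η hη k =>
    (ContinuousMap.dist_apply_le_dist k).trans_lt hη
  refine ⟨δ, hδ, fun η hη => lt_of_le_of_lt ?_ (half_lt_self hε)⟩
  refine (ContinuousMap.dist_le (half_pos hε).le).2 fun k => ?_
  rw [compOp_apply hf hγ, compOp_apply hf fun k _ => (h k _ (hη' η hη k)).1]
  exact (h k _ (hη' η hη k)).2.le

/-- At each `k` the mean value inequality bounds the Taylor remainder on the ball around `γ k`,
where `fderiv 𝕜 f` varies by at most `ε`. As the radius is uniform in `k`, the bound holds in the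
sup norm. -/
theorem hasFDerivAt_compOp {F : Type*} [NormedAddCommGroup F] [NormedSpace 𝕜 F] {f : E → F}
    {U : Set E} (hU : IsOpen U) (hf : ContDiffOn 𝕜 1 f U) {γ : C(K, E)} (hγ : γ ∈ mapsInto K U) :
    HasFDerivAt (𝕜 := 𝕜) (compOp f U) (applyL 𝕜 K E F (compOp (fderiv 𝕜 f) U γ)) γ := by
  let : NormedSpace ℝ E := NormedSpace.restrictScalars ℝ 𝕜 E
  have hc := hf.continuousOn
  have hd := hf.continuousOn_fderiv_of_isOpen hU le_rfl
  rw [hasFDerivAt_iff_isLittleO_nhds_zero, Asymptotics.isLittleO_iff]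
  intro ε hε
  obtain ⟨δ, hδ, h⟩ := exists_thickening_dist_lt hU hd hγ hε
  filter_upwards [Metric.ball_mem_nhds (0 : C(K, E)) hδ] with η hη
  have hη' : ∀ k, γ k + η k ∈ Metric.ball (γ k) δ := fun k => by
    rw [mem_ball_zero_iff] at hη
    simpa using (η.norm_coe_le_norm k).trans_lt hη
  refine (ContinuousMap.norm_le _ (by positivity)).2 fun k => ?_
  have h1 : (compOp f U (γ + η) - compOp f U γ - applyL 𝕜 K E F (compOp (fderiv 𝕜 f) U γ) η) k =
      f (γ k + η k) - f (γ k) - fderiv 𝕜 f (γ k) (η k) := by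
    simp only [ContinuousMap.sub_apply, applyL_apply]
    rw [compOp_apply hc hγ, compOp_apply hd hγ, compOp_apply hc fun k _ => (h k _ (hη' k)).1]
    rfl
  rw [h1]
  have h2 := (convex_ball (γ k) δ).norm_image_sub_le_of_norm_hasFDerivWithin_le' (𝕜 := 𝕜) (f := f)
    (f' := fderiv 𝕜 f) (φ := fderiv 𝕜 f (γ k)) (C := ε) (x := γ k) (y := γ k + η k)
    (fun y hy => ((hf.contDiffAt (hU.mem_nhds (h k y hy).1)).differentiableAt
      one_ne_zero).hasFDerivAt.hasFDerivWithinAt)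
    (fun y hy => by simpa [dist_eq_norm] using (h k y hy).2.le)
    (Metric.mem_ball_self hδ) (hη' k)
  simp only [add_sub_cancel_left] at h2
  exact h2.trans (mul_le_mul_of_nonneg_left (η.norm_coe_le_norm k) hε.le)

/-- The derivative of the composition operator of `f` is that of `fderiv 𝕜 f` followed by the
bounded linear map `applyL`, which permits induction on `m`. The target `F` varies in the induction
since `f` is replaced by its derivative; the common universe keeps `E →L[𝕜] F` admissible. -/
theorem contDiffOn_compOp_nat {E : Type u} [NormedAddCommGroup E] [NormedSpace 𝕜 E] (m : ℕ) :
    ∀ {F : Type u} [NormedAddCommGroup F] [NormedSpace 𝕜 F] {f : E → F}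
    {U : Set E} (_ : IsOpen U) (_ : ContDiffOn 𝕜 m f U),
    ContDiffOn 𝕜 m (compOp (K := K) f U) (mapsInto K U) := by
  induction m with
  | zero =>
    intro F _ _ f U hU hf
    exact contDiffOn_zero.2 (continuousOn_compOp hU hf.continuousOn)
  | succ m ih =>
    intro F _ _ f U hU hf
    have h1 : ContDiffOn 𝕜 1 f U := hf.of_le (by norm_cast; omega)
    have hd : ∀ γ ∈ mapsInto K U, HasFDerivAt (𝕜 := 𝕜) (compOp f U)
      (applyL 𝕜 K E F (compOp (fderiv 𝕜 f) U γ)) γ := fun γ hγ => hasFDerivAt_compOp hU h1 hγ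
    push_cast at hf ⊢
    rw [contDiffOn_succ_iff_fderiv_of_isOpen (isOpen_mapsInto hU)]
    rw [contDiffOn_succ_iff_fderiv_of_isOpen hU] at hf
    refine ⟨fun γ hγ => (hd γ hγ).differentiableAt.differentiableWithinAt, by simp, ?_⟩
    refine ContDiffOn.congr ?_ fun γ hγ => (hd γ hγ).fderiv
    exact (applyL 𝕜 K E F).contDiff.comp_contDiffOn (ih hU hf.2.2)

theorem contDiffOn_compOp_infty {E : Type u} [NormedAddCommGroup E] [NormedSpace 𝕜 E]
    {F : Type u} [NormedAddCommGroup F] [NormedSpace 𝕜 F] {f : E → F}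
    {U : Set E} (hU : IsOpen U) (hf : ContDiffOn 𝕜 ∞ f U) :
    ContDiffOn 𝕜 ∞ (compOp (K := K) f U) (mapsInto K U) :=
  contDiffOn_infty.2 fun m => contDiffOn_compOp_nat m hU (contDiffOn_infty.1 hf m)

variable (K) in
/-- The action of a continuous multilinear map on continuous maps, pointwise. -/
noncomputable def pointwiseMultilinear {F : Type*} [NormedAddCommGroup F] [NormedSpace 𝕜 F] {m : ℕ}
    (p : E [×m]→L[𝕜] F) : C(K, E) [×m]→L[𝕜] C(K, F) :=
  MultilinearMap.mkContinuous
    { toFun := fun h => ⟨fun k => p fun i => h i k, by fun_prop⟩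
      map_update_add' := fun h i x y => by
        ext k
        have : ∀ z : C(K, E), (fun j => Function.update h i z j k) =
          Function.update (fun j => h j k) i (z k) := fun z => by
            ext j; by_cases hj : j = i
            · subst hj; simp
            · simp [hj]
        simp [this]
      map_update_smul' := fun h i c x => by
        ext k
        have : ∀ z : C(K, E), (fun j => Function.update h i z j k) =
          Function.update (fun j => h j k) i (z k) := fun z => by
            ext j; by_cases hj : j = i
            · subst hj; simp
            · simp [hj]
        simp [this] } ‖p‖ fun h => by
      refine (ContinuousMap.norm_le _ (by positivity)).2 fun k => (p.le_opNorm _).trans ?_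
      exact mul_le_mul_of_nonneg_left (Finset.prod_le_prod (fun _ _ => norm_nonneg _)
        fun i _ => (h i).norm_coe_le_norm k) (norm_nonneg _)

theorem norm_pointwiseMultilinear_le {F : Type*} [NormedAddCommGroup F] [NormedSpace 𝕜 F] {m : ℕ}
    (p : E [×m]→L[𝕜] F) : ‖pointwiseMultilinear K p‖ ≤ ‖p‖ :=
  MultilinearMap.mkContinuous_norm_le _ (norm_nonneg _) _

/-- Near a constant curve the single power series of `f` at `x` applies to all `k` at once. Acting
pointwise does not increase the norms of its terms, so the radius of convergence does not shrink. -/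
theorem analyticAt_compOp_const {F : Type*} [NormedAddCommGroup F] [NormedSpace 𝕜 F]
    [CompleteSpace F] {f : E → F} {U : Set E} (hU : IsOpen U) (hc : ContinuousOn f U) {x : E}
    (hx : x ∈ U) (hf : AnalyticAt 𝕜 f x) :
    AnalyticAt 𝕜 (compOp (K := K) f U) (ContinuousMap.const K x) := by
  obtain ⟨p, r, hp⟩ := hf
  obtain ⟨δ, hδ, hδU⟩ := Metric.isOpen_iff.1 hU x hx
  set q : FormalMultilinearSeries 𝕜 C(K, E) C(K, F) := fun m => pointwiseMultilinear K (p m)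
  have hpr : p.radius ≤ q.radius := by
    refine ENNReal.le_of_forall_nnreal_lt fun s hs => ?_
    obtain ⟨C, -, hC⟩ := p.norm_mul_pow_le_of_lt_radius hs
    exact q.le_radius_of_bound C fun m => (mul_le_mul_of_nonneg_right
      (norm_pointwiseMultilinear_le (p m)) (by positivity)).trans (hC m)
  -- The bound by `δ` keeps the perturbed curves inside `U`, where `compOp` is the true composition
  -- and not its default value zero.
  refine ⟨q, min r (ENNReal.ofReal δ), ⟨(min_le_left _ _).trans (hp.r_le.trans hpr),
    lt_min hp.r_pos (by simpa using hδ), fun {η} hη => ?_⟩⟩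
  rw [Metric.mem_eball, edist_zero_right, lt_min_iff] at hη
  have hηk : ∀ k, ‖η k‖ₑ ≤ ‖η‖ₑ := fun k => by
    rw [enorm_le_iff_norm_le]; exact η.norm_coe_le_norm k
  have hU' : ContinuousMap.const K x + η ∈ mapsInto K U := fun k _ => hδU (by
    have := (hηk k).trans_lt hη.2
    rw [← ofReal_norm, ENNReal.ofReal_lt_ofReal_iff hδ] at this
    simpa using this)
  have hs : Summable fun m => q m fun _ => η :=
    q.summable (by
      rw [Metric.mem_eball, edist_zero_right]
      exact hη.1.trans_le (hp.r_le.trans hpr))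
  have key : compOp f U (ContinuousMap.const K x + η) = ∑' m, q m fun _ => η := by
    ext k
    rw [compOp_apply hc hU']
    have h1 := (hp.hasSum (y := η k) (by
      rw [Metric.mem_eball, edist_zero_right]; exact (hηk k).trans_lt hη.1))
    exact h1.unique (ContinuousMap.hasSum_apply hs.hasSum k)
  rw [key]
  exact hs.hasSum

/-- The composition operator of a function of class `C^n`, near a constant map. -/
theorem exists_contDiffOn_compOp {E : Type u} [NormedAddCommGroup E] [NormedSpace 𝕜 E]
    {F : Type u} [NormedAddCommGroup F] [NormedSpace 𝕜 F] [CompleteSpace F] {n : ℕ∞ω}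
    (hn : n = ∞ ∨ n = ω) {f : E → F} {U : Set E} (hU : IsOpen U) (hf : ContDiffOn 𝕜 n f U) {x : E}
    (hx : x ∈ U) : ∃ 𝒰 : Set C(K, E), IsOpen 𝒰 ∧ ContinuousMap.const K x ∈ 𝒰 ∧
      𝒰 ⊆ mapsInto K U ∧ ContDiffOn 𝕜 n (compOp f U) 𝒰 := by
  have hxU : ContinuousMap.const K x ∈ mapsInto K U := fun _ _ => hx
  rcases hn with rfl | rfl
  · exact ⟨mapsInto K U, isOpen_mapsInto hU, hxU, subset_rfl, contDiffOn_compOp_infty hU hf⟩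
  · have h1 : AnalyticAt 𝕜 (compOp (K := K) f U) (ContinuousMap.const K x) :=
      analyticAt_compOp_const hU hf.continuousOn hx (hf.contDiffAt (hU.mem_nhds hx)).analyticAt
    -- Analyticity at a point is an open condition, so analyticity at the constant map gives a
    -- neighbourhood.
    refine ⟨mapsInto K U ∩ {γ | AnalyticAt 𝕜 (compOp (K := K) f U) γ},
      (isOpen_mapsInto hU).inter (isOpen_analyticAt 𝕜 _), ⟨hxU, h1⟩, inter_subset_left,
      fun γ hγ => hγ.2.contDiffAt.contDiffWithinAt⟩

end CompositionOperator

/-! ### Joint local flow of a commuting family -/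

section Flow

universe u

variable {𝕜 : Type*} [RCLike 𝕜]

variable (𝕜) in
/-- Constant maps, as a continuous linear map. -/
noncomputable def constCLM (K : Type*) [TopologicalSpace K] [CompactSpace K] (E : Type*)
    [NormedAddCommGroup E] [NormedSpace 𝕜 E] : E →L[𝕜] C(K, E) :=
  LinearMap.mkContinuous
    { toFun := fun x => ContinuousMap.const K x
      map_add' := fun _ _ => rfl
      map_smul' := fun _ _ => rfl } 1 fun x => by
    rw [one_mul]
    exact (ContinuousMap.norm_le _ (norm_nonneg _)).2 fun _ => le_rfl

variable {E : Type u} [NormedAddCommGroup E] [NormedSpace 𝕜 E] [CompleteSpace E]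
  [NormedSpace ℝ E] [IsScalarTower ℝ 𝕜 E]

/-- The extension of a curve on the unit interval to the line. -/
noncomputable def extCurve (g : C(unitInterval, E)) (t : ℝ) : E := g (projIcc 0 1 zero_le_one t)

omit [CompleteSpace E] [NormedSpace ℝ E] in
theorem continuous_extCurve (g : C(unitInterval, E)) : Continuous (extCurve g) :=
  g.continuous.comp continuous_projIcc

omit [CompleteSpace E] [NormedSpace ℝ E] in
theorem norm_extCurve_le (g : C(unitInterval, E)) (t : ℝ) : ‖extCurve g t‖ ≤ ‖g‖ :=
  g.norm_coe_le_norm _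

variable (𝕜 E) in
/-- The operator `g ↦ ∫₀ᵗ g`. -/
noncomputable def integCLM : C(unitInterval, E) →L[𝕜] C(unitInterval, E) :=
  haveI : SMulCommClass ℝ 𝕜 E := IsScalarTower.to_smulCommClass
  LinearMap.mkContinuous
    { toFun := fun g => ⟨fun t => ∫ s in (0 : ℝ)..t, extCurve g s,
        (intervalIntegral.continuous_primitive
          (fun a b => (continuous_extCurve g).intervalIntegrable a b) 0).comp
            continuous_subtype_val⟩
      map_add' := fun g h => by
        ext t
        exact intervalIntegral.integral_add ((continuous_extCurve g).intervalIntegrable _ _)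
          ((continuous_extCurve h).intervalIntegrable _ _)
      map_smul' := fun c g => by
        ext t
        exact intervalIntegral.integral_smul c (extCurve g) } 1 fun g => by
    refine (ContinuousMap.norm_le _ (by positivity)).2 fun t => ?_
    refine (intervalIntegral.norm_integral_le_of_norm_le_const
      (fun s _ => norm_extCurve_le g s)).trans ?_
    rw [sub_zero, abs_of_nonneg t.2.1, one_mul]
    exact mul_le_of_le_one_right (norm_nonneg _) t.2.2

omit [CompleteSpace E] in
theorem integCLM_apply (g : C(unitInterval, E)) (t : unitInterval) :
    integCLM 𝕜 E g t = ∫ s in (0 : ℝ)..t, extCurve g s := rfl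

/-- The derivative is one-sided because `extCurve` is constant outside `[0, 1]`; the Grönwall
argument of `variation_eq` uses right derivatives only. -/
theorem hasDerivWithinAt_integCLM (g : C(unitInterval, E)) {t : ℝ} (ht : t ∈ Ico (0 : ℝ) 1) :
    HasDerivWithinAt (extCurve (integCLM 𝕜 E g)) (extCurve g t) (Ici t) t := by
  have h1 : HasDerivWithinAt (fun t => ∫ s in (0 : ℝ)..t, extCurve g s) (extCurve g t) (Ici t) t :=
    ((continuous_extCurve g).integral_hasStrictDerivAt 0 t).hasDerivAt.hasDerivWithinAt
  have h2 : ∀ s ∈ Icc (0 : ℝ) 1, extCurve (integCLM 𝕜 E g) s = ∫ s in (0 : ℝ)..s, extCurve g s := by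
    intro s hs
    rw [extCurve, integCLM_apply, projIcc_of_mem _ hs]
  refine h1.congr_of_eventuallyEq ?_ (h2 t ⟨ht.1, ht.2.le⟩)
  filter_upwards [Icc_mem_nhdsGE ht.2] with s hs using h2 s ⟨ht.1.trans hs.1, hs.2⟩

/-- The parameter derivative of solutions of `γ' = A(γ) p`, for a commuting family `A`. -/
theorem variation_eq {P : Type} [NormedAddCommGroup P] [NormedSpace 𝕜 P] {A : E → P →L[𝕜] E}
    {U : Set E} (hU : IsOpen U) (hA : ContDiffOn 𝕜 1 A U)
    (hcomm : ∀ y ∈ U, ∀ p q, fderiv 𝕜 A y (A y p) q = fderiv 𝕜 A y (A y q) p)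
    {x : E} {p q : P} {γ u : C(unitInterval, E)} (hγU : γ ∈ mapsInto unitInterval U)
    (hγ : γ = constCLM 𝕜 unitInterval E x + integCLM 𝕜 E
      (applyL 𝕜 unitInterval P E (compOp A U γ) (constCLM 𝕜 _ P p)))
    (hu : u = integCLM 𝕜 E (applyL 𝕜 unitInterval P E (compOp A U γ) (constCLM 𝕜 _ P q) +
      applyL 𝕜 unitInterval P E (applyL 𝕜 unitInterval E (P →L[𝕜] E) (compOp (fderiv 𝕜 A) U γ) u)
        (constCLM 𝕜 _ P p))) :
    u 1 = A (γ 1) q := by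
  have hc := hA.continuousOn
  have hd := hA.continuousOn_fderiv_of_isOpen hU le_rfl
  have hγt : ∀ t, extCurve γ t ∈ U := fun t => hγU (mem_univ _)
  have dγ : ∀ t ∈ Ico (0 : ℝ) 1,
      HasDerivWithinAt (extCurve γ) (A (extCurve γ t) p) (Ici t) t := by
    intro t ht
    have h := (hasDerivWithinAt_integCLM (𝕜 := 𝕜) (applyL 𝕜 unitInterval P E (compOp A U γ)
      (constCLM 𝕜 _ P p)) ht).const_add x
    have e1 : (fun t => x + extCurve (integCLM 𝕜 E (applyL 𝕜 unitInterval P E (compOp A U γ)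
      (constCLM 𝕜 _ P p))) t) = extCurve γ := by
      conv_rhs => rw [hγ]
      rfl
    rw [e1] at h
    convert h using 1
    simp only [extCurve, applyL_apply, compOp_apply hc hγU]
    rfl
  have du : ∀ t ∈ Ico (0 : ℝ) 1, HasDerivWithinAt (extCurve u)
      (A (extCurve γ t) q + fderiv 𝕜 A (extCurve γ t) (extCurve u t) p) (Ici t) t := by
    intro t ht
    have h := hasDerivWithinAt_integCLM (𝕜 := 𝕜) (applyL 𝕜 unitInterval P E (compOp A U γ)
      (constCLM 𝕜 _ P q) + applyL 𝕜 unitInterval P E (applyL 𝕜 unitInterval E (P →L[𝕜] E)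
        (compOp (fderiv 𝕜 A) U γ) u) (constCLM 𝕜 _ P p)) ht
    rw [← hu] at h
    convert h using 1
    simp only [extCurve, applyL_apply, ContinuousMap.add_apply, compOp_apply hc hγU,
      compOp_apply hd hγU]
    rfl
  have dA : ∀ t ∈ Ico (0 : ℝ) 1, HasDerivWithinAt (fun t => A (extCurve γ t) q)
      (fderiv 𝕜 A (extCurve γ t) (A (extCurve γ t) p) q) (Ici t) t := by
    intro t ht
    have h1 : HasFDerivAt A (fderiv 𝕜 A (extCurve γ t)) (extCurve γ t) :=
      ((hA.contDiffAt (hU.mem_nhds (hγt t))).differentiableAt one_ne_zero).hasFDerivAt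
    have h2 := (h1.clm_apply (hasFDerivAt_const q _)).restrictScalars ℝ
    have h3 := h2.comp_hasDerivWithinAt t (dγ t ht)
    refine h3.congr_deriv ?_
    change A (extCurve γ t) ((0 : E →L[𝕜] P) _) + _ = _
    simp
  -- Commutation turns `DA(A p) q` into `DA(A q) p`, so `t ↦ t A(γ t) q` solves the same linear
  -- equation as `u`. The difference `d` satisfies `d' = DA(d) p` with `d 0 = 0` and vanishes by
  -- Grönwall; the claim is its value at `t = 1`.
  set d : ℝ → E := fun t => extCurve u t - t • A (extCurve γ t) q with hd_def
  have dd : ∀ t ∈ Ico (0 : ℝ) 1,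
      HasDerivWithinAt d (fderiv 𝕜 A (extCurve γ t) (d t) p) (Ici t) t := by
    intro t ht
    have h := (du t ht).sub ((hasDerivAt_id t).hasDerivWithinAt.smul (dA t ht))
    refine HasDerivWithinAt.congr_deriv (f := d) h ?_
    have e2 : ∀ v : E, t • v = (t : 𝕜) • v := fun v => by
      rw [← algebraMap_smul 𝕜 t, RCLike.algebraMap_eq_ofReal]
    have e3 : fderiv 𝕜 A (extCurve γ t) (d t) p = fderiv 𝕜 A (extCurve γ t) (extCurve u t) p -
        t • fderiv 𝕜 A (extCurve γ t) (A (extCurve γ t) p) q := by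
      rw [hcomm _ (hγt t) p q, hd_def, e2, map_sub, e2, map_smul]
      rfl
    rw [e3, id, one_smul]
    abel
  have hcont : ContinuousOn d (Icc 0 1) := by
    refine (continuous_extCurve u).continuousOn.sub (continuousOn_id.smul ?_)
    have : Continuous fun t => A (extCurve γ t) :=
      hc.comp_continuous (continuous_extCurve γ) hγt
    exact (this.clm_apply continuous_const).continuousOn
  have h0 : d 0 = 0 := by
    have : extCurve u 0 = 0 := by
      rw [hu, extCurve, integCLM_apply, projIcc_of_mem _ (by simp : (0 : ℝ) ∈ Icc (0 : ℝ) 1)]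
      simp
    simp [hd_def, this]
  have h1 := eq_zero_of_abs_deriv_le_mul_abs_self_of_eq_zero_right
    (K := ‖compOp (fderiv 𝕜 A) U γ‖ * ‖p‖) hcont dd h0 (fun t _ => by
      have e : fderiv 𝕜 A (extCurve γ t) = extCurve (compOp (fderiv 𝕜 A) U γ) t := by
        rw [extCurve, extCurve, compOp_apply hd hγU]
      rw [e]
      calc _ ≤ ‖extCurve (compOp (fderiv 𝕜 A) U γ) t‖ * ‖d t‖ * ‖p‖ :=
            ContinuousLinearMap.le_opNorm₂ _ _ _
        _ ≤ ‖compOp (fderiv 𝕜 A) U γ‖ * ‖d t‖ * ‖p‖ := by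
            gcongr; exact norm_extCurve_le _ t
        _ = _ := by ring) 1 (by simp)
  have hp : projIcc (0 : ℝ) 1 zero_le_one 1 = (1 : unitInterval) := projIcc_right _
  simp only [hd_def, one_smul, extCurve, hp] at h1
  exact sub_eq_zero.1 h1

/-- The local flow of a commuting family of vector fields of class `C^n`. -/
theorem exists_flow {P : Type} [NormedAddCommGroup P] [NormedSpace 𝕜 P] [CompleteSpace P]
    {n : ℕ∞ω} (hn : n = ∞ ∨ n = ω) {A : E → P →L[𝕜] E} {U : Set E} (hU : IsOpen U)
    (hA : ContDiffOn 𝕜 n A U)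
    (hcomm : ∀ y ∈ U, ∀ p q, fderiv 𝕜 A y (A y p) q = fderiv 𝕜 A y (A y q) p)
    {x₀ : E} (hx₀ : x₀ ∈ U) :
    ∃ (Ψ : P × E → E) (N : Set (P × E)), IsOpen N ∧ (0, x₀) ∈ N ∧ ContDiffOn 𝕜 n Ψ N ∧
      MapsTo Ψ N U ∧ (∀ x, (0, x) ∈ N → Ψ (0, x) = x) ∧
      ∀ w ∈ N, HasFDerivAt (fun p => Ψ (p, w.2)) (A (Ψ w)) w.1 := by
  have hn1 : 1 ≤ n := by rcases hn with rfl | rfl <;> simp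
  have hA1 : ContDiffOn 𝕜 1 A U := hA.of_le hn1
  obtain ⟨𝒰, h𝒰, hx𝒰, h𝒰U, hΦ⟩ := exists_contDiffOn_compOp (K := unitInterval) hn hU hA hx₀
  set Φ : C(unitInterval, E) → C(unitInterval, P →L[𝕜] E) := compOp A U
  set cE := constCLM 𝕜 unitInterval E
  set cP := constCLM 𝕜 unitInterval P
  set ap := applyL 𝕜 unitInterval P E
  set S := integCLM 𝕜 E
  -- The second component vanishes exactly when `γ` solves `γ(t) = x + ∫₀ᵗ A(γ) p`. The parameter
  -- `p` takes the role of time: the flow is evaluated at time one, so `p` may range over a space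
  -- over `𝕜`.
  set G : (P × E) × C(unitInterval, E) → (P × E) × C(unitInterval, E) :=
    fun z => (z.1, z.2 - (cE z.1.2 + S (ap (Φ z.2) (cP z.1.1))))
  set 𝒲 : Set ((P × E) × C(unitInterval, E)) := Prod.snd ⁻¹' 𝒰
  have h𝒲 : IsOpen 𝒲 := h𝒰.preimage continuous_snd
  have hΦ𝒲 : ContDiffOn 𝕜 n (fun z : (P × E) × C(unitInterval, E) => Φ z.2) 𝒲 :=
    hΦ.comp contDiff_snd.contDiffOn fun _ h => h
  have hG : ContDiffOn 𝕜 n G 𝒲 := by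
    refine contDiff_fst.contDiffOn.prodMk (contDiff_snd.contDiffOn.sub (ContDiffOn.add ?_ ?_))
    · exact (cE.contDiff.comp (contDiff_snd.comp contDiff_fst)).contDiffOn
    · refine S.contDiff.comp_contDiffOn ?_
      refine (ap.contDiff.comp_contDiffOn hΦ𝒲).clm_apply ?_
      exact (cP.contDiff.comp (contDiff_fst.comp contDiff_fst)).contDiffOn
  set a : (P × E) × C(unitInterval, E) := ((0, x₀), cE x₀)
  have ha : a ∈ 𝒲 := hx𝒰
  set L : P × E →L[𝕜] C(unitInterval, E) :=
    cE.comp (ContinuousLinearMap.snd 𝕜 P E) +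
      (S.comp ((ap (Φ (cE x₀))).comp cP)).comp (ContinuousLinearMap.fst 𝕜 P E)
  -- At `p = 0` the integral term does not depend on `γ` to first order, so the derivative of `G` is
  -- triangular with identity diagonal and is inverted by changing the sign of `L`.
  set f' : ((P × E) × C(unitInterval, E)) ≃L[𝕜] (P × E) × C(unitInterval, E) :=
    ContinuousLinearEquiv.equivOfInverse
      ((ContinuousLinearMap.fst 𝕜 _ _).prod
        (ContinuousLinearMap.snd 𝕜 _ _ - L.comp (ContinuousLinearMap.fst 𝕜 _ _)))
      ((ContinuousLinearMap.fst 𝕜 _ _).prod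
        (ContinuousLinearMap.snd 𝕜 _ _ + L.comp (ContinuousLinearMap.fst 𝕜 _ _)))
      (fun z => by ext <;> simp) (fun z => by ext <;> simp)
  have hf' : HasFDerivAt G (f' : _ →L[𝕜] _) a := by
    have h1 : HasFDerivAt (fun z : (P × E) × C(unitInterval, E) => z.1)
      (ContinuousLinearMap.fst 𝕜 _ _) a := hasFDerivAt_fst
    have h2 : HasFDerivAt (fun z : (P × E) × C(unitInterval, E) => z.2)
      (ContinuousLinearMap.snd 𝕜 _ _) a := hasFDerivAt_snd
    have h3 : HasFDerivAt (fun z : (P × E) × C(unitInterval, E) => cE z.1.2) _ a :=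
      (cE.comp (ContinuousLinearMap.snd 𝕜 P E)).hasFDerivAt.comp a h1
    have h4 : HasFDerivAt (fun z : (P × E) × C(unitInterval, E) => cP z.1.1) _ a :=
      (cP.comp (ContinuousLinearMap.fst 𝕜 P E)).hasFDerivAt.comp a h1
    have h5 : HasFDerivAt (fun z : (P × E) × C(unitInterval, E) => Φ z.2) _ a :=
      (((hΦ𝒲.contDiffAt (h𝒲.mem_nhds ha)).differentiableAt
        (fun h => by simp [h] at hn1)).hasFDerivAt)
    have h6 := S.hasFDerivAt.comp a ((ap.hasFDerivAt.comp a h5).clm_apply h4)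
    refine (h1.prodMk (h2.sub (h3.add h6))).congr_fderiv ?_
    have hz : cP a.1.1 = 0 := map_zero cP
    refine ContinuousLinearMap.ext fun z => Prod.ext rfl ?_
    simp [f', L, a, hz]
  obtain ⟨e, hae, heU, heG, hes⟩ :=
    exists_openPartialHomeomorph_contDiffOn hn1 h𝒲 hG ha f' hf'
  have hea : e a = ((0, x₀), 0) := by
    have hz : cP a.1.1 = 0 := map_zero cP
    rw [heG]
    refine Prod.ext rfl ?_
    simp only [G, hz, map_zero, a, add_zero, sub_self]
  set j : P × E → (P × E) × C(unitInterval, E) := fun w => (w, 0)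
  have hj : ContDiff 𝕜 n j := contDiff_id.prodMk contDiff_const
  set N : Set (P × E) := j ⁻¹' e.target
  have hN : IsOpen N := e.open_target.preimage hj.continuous
  set Γ : P × E → C(unitInterval, E) := fun w => (e.symm (j w)).2
  have hΓ : ContDiffOn 𝕜 n Γ N :=
    contDiff_snd.comp_contDiffOn (hes.comp hj.contDiffOn fun _ h => h)
  have hΓ𝒰 : ∀ w ∈ N, Γ w ∈ 𝒰 := fun w hw => heU (e.map_target hw)
  have hfst : ∀ w ∈ N, (e.symm (j w)).1 = w ∧
      Γ w = cE w.2 + S (ap (Φ (Γ w)) (cP w.1)) := by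
    intro w hw
    have h := e.right_inv hw
    rw [heG] at h
    have h1 : (e.symm (j w)).1 = w := congrArg Prod.fst h
    have h2 : Γ w - (cE (e.symm (j w)).1.2 + S (ap (Φ (Γ w)) (cP (e.symm (j w)).1.1))) = 0 :=
      congrArg Prod.snd h
    rw [h1] at h2
    exact ⟨h1, sub_eq_zero.1 h2⟩
  set ev : C(unitInterval, E) →L[𝕜] E := ContinuousMap.evalCLM 𝕜 1
  refine ⟨fun w => Γ w 1, N, hN, ?_, ev.contDiff.comp_contDiffOn hΓ,
    fun w hw => h𝒰U (hΓ𝒰 w hw) (mem_univ _), fun x hx => ?_, ?_⟩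
  · change ((0, x₀), 0) ∈ e.target
    rw [← hea]
    exact e.map_source hae
  · have h := (hfst _ hx).2
    have hz : cP (0 : P) = 0 := map_zero cP
    simp only [hz, map_zero, add_zero] at h
    exact congrArg (fun g : C(unitInterval, E) => g 1) h
  · rintro ⟨p, x⟩ hw
    have hk : HasFDerivAt (fun p' : P => ((p', x) : P × E)) (ContinuousLinearMap.inl 𝕜 P E) p :=
      hasFDerivAt_prodMk_left p x
    have hΓd : DifferentiableAt 𝕜 Γ (p, x) :=
      (hΓ.contDiffAt (hN.mem_nhds hw)).differentiableAt (fun h => by simp [h] at hn1)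
    have hd : HasFDerivAt (fun p' => Γ (p', x)) _ p := HasFDerivAt.comp (g := Γ) p hΓd.hasFDerivAt hk
    set D := (fderiv 𝕜 Γ (p, x)).comp (ContinuousLinearMap.inl 𝕜 P E)
    have hΦd := hasFDerivAt_compOp (𝕜 := 𝕜) hU hA1 (h𝒰U (hΓ𝒰 _ hw))
    have h1 : HasFDerivAt (fun p' => ap (Φ (Γ (p', x)))) _ p :=
      HasFDerivAt.comp (g := ap) (f := fun p' => Φ (Γ (p', x))) p ap.hasFDerivAt
        (HasFDerivAt.comp (g := Φ) (f := fun p' => Γ (p', x)) p hΦd hd)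
    have h2 := (S.hasFDerivAt.comp p (h1.clm_apply cP.hasFDerivAt)).const_add (cE x)
    have h3 : (fun p' => Γ (p', x)) =ᶠ[𝓝 p]
        fun p' => cE x + S (ap (Φ (Γ (p', x))) (cP p')) := by
      filter_upwards [hk.continuousAt.preimage_mem_nhds (hN.mem_nhds hw)] with p' hp'
      exact (hfst _ hp').2
    -- Differentiating the integral equation in `p` shows that `D q` solves the variational equation
    -- required by `variation_eq`.
    have h4 := hd.unique (h2.congr_of_eventuallyEq h3)
    refine (ev.hasFDerivAt.comp p hd).congr_fderiv (ContinuousLinearMap.ext fun q => ?_)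
    refine variation_eq hU hA1 hcomm (h𝒰U (hΓ𝒰 _ hw)) (hfst _ hw).2 (q := q) (u := D q) ?_
    conv_lhs => rw [h4]
    rfl

end Flow

/-! ### Simultaneous straightening of the family and the function -/

section NormalForm

universe u

variable {𝕜 : Type*} [RCLike 𝕜] [NormedSpace 𝕜 ℂ] {E : Type u} [NormedAddCommGroup E]
  [NormedSpace 𝕜 E] [CompleteSpace E] [NormedSpace ℝ E] [IsScalarTower ℝ 𝕜 E]
  {Z : Type*} [NormedAddCommGroup Z] [NormedSpace 𝕜 Z]

/-- Simultaneous normal form of a commuting family `A` of vector fields and a function `h` that is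
constant along them: in suitable coordinates `A` is constant and `h` is a coordinate. -/
theorem exists_normalForm {n : ℕ∞ω} (hn : n = ∞ ∨ n = ω) {A : E → ℂ →L[𝕜] E} {U : Set E}
    (hU : IsOpen U) (hA : ContDiffOn 𝕜 n A U)
    (hcomm : ∀ y ∈ U, ∀ p q, fderiv 𝕜 A y (A y p) q = fderiv 𝕜 A y (A y q) p)
    {h : E → ℂ} (hh : ContDiffOn 𝕜 n h U) (hhA : ∀ y ∈ U, ∀ p, fderiv 𝕜 h y (A y p) = 0)
    {x₀ : E} (hx₀ : x₀ ∈ U) (T : (ℂ × Z × ℂ) ≃L[𝕜] E) (hTA : ∀ p, T (p, 0, 0) = A x₀ p)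
    (hTh : ∀ v, fderiv 𝕜 h x₀ (T v) = v.2.2) :
    ∃ χ : OpenPartialHomeomorph E (ℂ × Z × ℂ), x₀ ∈ χ.source ∧ χ.source ⊆ U ∧
      ContDiffOn 𝕜 n χ χ.source ∧ ContDiffOn 𝕜 n χ.symm χ.target ∧
      (∀ y ∈ χ.source, h y = (χ y).2.2) ∧
      ∀ w ∈ χ.target, ∀ p, fderiv 𝕜 χ.symm w (p, 0, 0) = A (χ.symm w) p := by
  have hn1 : 1 ≤ n := by rcases hn with rfl | rfl <;> simp
  have hn0 : n ≠ 0 := fun h => by simp [h] at hn1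
  have hhd : ∀ y ∈ U, HasFDerivAt h (fderiv 𝕜 h y) y := fun y hy =>
    ((hh.contDiffAt (hU.mem_nhds hy)).differentiableAt hn0).hasFDerivAt
  have : CompleteSpace (ℂ × Z × ℂ) := T.isUniformEmbedding.toIsUniformInducing.completeSpace_congr
    T.surjective |>.2 inferInstance
  -- straightening of `h`
  set s : E → ℂ × Z × ℂ := fun y => ((T.symm y).1, (T.symm y).2.1, h y)
  have hT := T.symm.contDiff (n := n)
  have hs : ContDiffOn 𝕜 n s U := (contDiff_fst.comp hT).contDiffOn.prodMk
    ((contDiff_fst.comp (contDiff_snd.comp hT)).contDiffOn.prodMk hh)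
  have hs' : HasFDerivAt s (T.symm : E →L[𝕜] _) x₀ := by
    have h1 : HasFDerivAt T.symm (T.symm : E →L[𝕜] _) x₀ := T.symm.hasFDerivAt
    refine (h1.fst.prodMk (h1.snd.fst.prodMk (hhd x₀ hx₀))).congr_fderiv ?_
    ext v
    · rfl
    · rfl
    · have := hTh (T.symm v)
      simpa using this
  obtain ⟨e₁, hx₁, he₁U, he₁s, he₁⟩ := exists_openPartialHomeomorph_contDiffOn hn1 hU hs hx₀ _ hs'
  set b := s x₀
  have hb : e₁ x₀ = b := by rw [he₁s]
  have hbt : b ∈ e₁.target := hb ▸ e₁.map_source hx₁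
  -- Freezing the first coordinate at its value at `x₀` makes `σ` a parametrization of a transversal
  -- to the family through `x₀`, with `h` equal to the last coordinate on it.
  set k : ℂ × Z × ℂ → ℂ × Z × ℂ := fun w => (b.1, w.2)
  have hk : ContDiff 𝕜 n k := contDiff_const.prodMk contDiff_snd
  set σ : ℂ × Z × ℂ → E := fun w => e₁.symm (k w)
  have hσ : ContDiffOn 𝕜 n σ (k ⁻¹' e₁.target) := he₁.comp hk.contDiffOn fun _ h => h
  have hko : IsOpen (k ⁻¹' e₁.target) := e₁.open_target.preimage hk.continuous
  obtain ⟨Ψ, N, hN, h0N, hΨ, hΨU, hΨ0, hΨd⟩ := exists_flow hn hU hA hcomm hx₀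
  obtain ⟨r, hr, hrN⟩ := Metric.isOpen_iff.1 hN _ h0N
  rw [← ball_prod_same] at hrN
  -- the inverse of the chart
  set g : ℂ × Z × ℂ → ℂ × E := fun w => (w.1, σ w)
  have hg : ContDiffOn 𝕜 n g (k ⁻¹' e₁.target) := contDiff_fst.contDiffOn.prodMk hσ
  set D : Set (ℂ × Z × ℂ) := k ⁻¹' e₁.target ∩ g ⁻¹' (Metric.ball 0 r ×ˢ Metric.ball x₀ r)
  have hD : IsOpen D :=
    hg.continuousOn.isOpen_inter_preimage hko (Metric.isOpen_ball.prod Metric.isOpen_ball)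
  have hgD : ContDiffOn 𝕜 n g D := hg.mono inter_subset_left
  -- The point `w` is sent to the result of flowing for the parameter `w.1` from the point `σ w` of
  -- the transversal. The derivative at `a` is `T`: along `ℂ` it is `A x₀`, along the transversal it
  -- is that of `σ`.
  set m : ℂ × Z × ℂ → E := fun w => Ψ (g w)
  have hm : ContDiffOn 𝕜 n m D := hΨ.comp hgD fun w hw => hrN hw.2
  set a : ℂ × Z × ℂ := (0, b.2)
  have hka : k a = b := rfl
  have hσa : σ a = x₀ := by
    change e₁.symm (k a) = x₀
    rw [hka, ← hb, e₁.left_inv hx₁]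
  have hga : g a = (0, x₀) := Prod.ext rfl hσa
  have haD : a ∈ D := ⟨hbt, by
    rw [mem_preimage, hga]; exact ⟨Metric.mem_ball_self hr, Metric.mem_ball_self hr⟩⟩
  have hm' : HasFDerivAt m (T : _ →L[𝕜] E) a := by
    have d1 : HasFDerivAt e₁.symm (T : _ →L[𝕜] E) b := by
      have := e₁.hasFDerivAt_symm (f' := T.symm) hbt (by
        rw [← hb, e₁.left_inv hx₁, he₁s]; exact hs')
      simpa using this
    have d2 : HasFDerivAt k ((0 : _ →L[𝕜] ℂ).prod (ContinuousLinearMap.snd 𝕜 _ _)) a :=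
      (hasFDerivAt_const _ _).prodMk hasFDerivAt_snd
    have d3 : HasFDerivAt σ _ a := HasFDerivAt.comp (g := e₁.symm) a (by rw [hka]; exact d1) d2
    have d4 : HasFDerivAt g _ a := hasFDerivAt_fst.prodMk d3
    have d5 : HasFDerivAt Ψ (fderiv 𝕜 Ψ (0, x₀)) (0, x₀) :=
      ((hΨ.contDiffAt (hN.mem_nhds h0N)).differentiableAt hn0).hasFDerivAt
    have d6 : HasFDerivAt m _ a := HasFDerivAt.comp (g := Ψ) a (by rw [hga]; exact d5) d4
    refine d6.congr_fderiv (ContinuousLinearMap.ext fun v => ?_)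
    have e1 : ∀ p, fderiv 𝕜 Ψ (0, x₀) (p, 0) = A x₀ p := by
      have d7 := HasFDerivAt.comp (g := Ψ) (0 : ℂ) d5 (hasFDerivAt_prodMk_left (𝕜 := 𝕜) 0 x₀)
      have d8 := d7.unique (hΨd _ h0N)
      intro p
      have := congrArg (fun l : ℂ →L[𝕜] E => l p) d8
      simpa [hΨ0 _ h0N] using this
    have e2 : ∀ y, fderiv 𝕜 Ψ (0, x₀) (0, y) = y := by
      have d7 := HasFDerivAt.comp (g := Ψ) x₀ d5 (hasFDerivAt_prodMk_right (𝕜 := 𝕜) (0 : ℂ) x₀)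
      have d9 : (Ψ ∘ fun x => ((0 : ℂ), x)) =ᶠ[𝓝 x₀] id := by
        have : ContinuousAt (fun x : E => ((0 : ℂ), x)) x₀ := by fun_prop
        filter_upwards [this.preimage_mem_nhds (hN.mem_nhds h0N)] with x hx using hΨ0 x hx
      have d8 := d7.unique ((hasFDerivAt_id x₀).congr_of_eventuallyEq d9)
      intro y
      simpa using congrArg (fun l : E →L[𝕜] E => l y) d8
    have e3 : fderiv 𝕜 Ψ (0, x₀) (v.1, T (0, v.2)) = T v := by
      have : ((v.1, T (0, v.2)) : ℂ × E) = (v.1, 0) + (0, T (0, v.2)) := by simp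
      rw [this, map_add, e1, e2, ← hTA, ← map_add]
      exact congrArg T (Prod.ext (by simp) (Prod.ext (by simp) (by simp)))
    exact e3
  obtain ⟨e₂, ha₂, he₂D, he₂m, he₂⟩ := exists_openPartialHomeomorph_contDiffOn hn1 hD hm haD _ hm'
  have hma : m a = x₀ := by
    change Ψ (g a) = x₀
    rw [hga, hΨ0 _ h0N]
  have hhm : ∀ w ∈ D, h (m w) = w.2.2 := by
    intro w hw
    have hσU : h (σ w) = w.2.2 := by
      have := e₁.right_inv hw.1
      rw [he₁s] at this
      exact congrArg (fun v : ℂ × Z × ℂ => v.2.2) this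
    have hball : ∀ p ∈ Metric.ball (0 : ℂ) r, (p, σ w) ∈ N := fun p hp => hrN ⟨hp, hw.2.2⟩
    have hd : ∀ p ∈ Metric.ball (0 : ℂ) r, HasFDerivAt (fun p => h (Ψ (p, σ w))) (0 : ℂ →L[𝕜] ℂ) p := by
      intro p hp
      have d1 := HasFDerivAt.comp (g := h) p (hhd _ (hΨU (hball p hp))) (hΨd _ (hball p hp))
      refine d1.congr_fderiv (ContinuousLinearMap.ext fun q => ?_)
      exact hhA _ (hΨU (hball p hp)) q
    -- `h` is constant along the flow, so its value at `m w` is its value on the transversal.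
    have := Metric.isOpen_ball.is_const_of_fderiv_eq_zero (𝕜 := 𝕜)
      (convex_ball (0 : ℂ) r).isPreconnected
      (fun p hp => (hd p hp).differentiableAt.differentiableWithinAt)
      (fun p hp => (hd p hp).fderiv) hw.2.1 (Metric.mem_ball_self hr)
    change h (Ψ (w.1, σ w)) = _
    refine this.trans ?_
    simp only [hΨ0 _ (hball 0 (Metric.mem_ball_self hr)), hσU]
  refine ⟨e₂.symm, ?_, ?_, he₂, ?_, ?_, ?_⟩
  · rw [← hma, ← he₂m]; exact e₂.map_source ha₂
  · intro y hy
    have h1 := e₂.map_target hy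
    rw [← e₂.right_inv hy, he₂m]
    exact hΨU (hrN (he₂D h1).2)
  · rw [e₂.symm_symm, he₂m]; exact hm.mono he₂D
  · intro y hy
    have h1 := e₂.map_target hy
    rw [← hhm _ (he₂D h1), ← he₂m, e₂.right_inv hy]
  · intro w hw p
    rw [e₂.symm_symm, he₂m]
    have hwD := he₂D hw
    have d1 : HasFDerivAt m (fderiv 𝕜 m w) w :=
      ((hm.contDiffAt (hD.mem_nhds hwD)).differentiableAt hn0).hasFDerivAt
    have d2 := HasFDerivAt.comp (g := m) w.1 d1 (hasFDerivAt_prodMk_left (𝕜 := 𝕜) w.1 w.2)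
    have d3 := d2.unique (hΨd (g w) (hrN hwD.2))
    exact congrArg (fun l : ℂ →L[𝕜] E => l p) d3

end NormalForm

/-! ### Hamiltonian vector fields in a vector space -/

section HamiltonianVectorSpace

variable {𝕜 : Type*} [RCLike 𝕜] {E : Type*} [NormedAddCommGroup E] [NormedSpace 𝕜 E]
  [FiniteDimensional 𝕜 E]

/-- An alternating form in two variables as a bilinear map. -/
noncomputable def bilin (η : E [⋀^Fin 2]→L[𝕜] 𝕜) : E →L[𝕜] E →L[𝕜] 𝕜 :=
  LinearMap.toContinuousBilinearMap <| LinearMap.mk₂ 𝕜 (fun v w => η ![v, w])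
    (fun v v' w => by
      have h := η.map_update_add ![0, w] 0 v v'
      rwa [update_pair_zero, update_pair_zero, update_pair_zero] at h)
    (fun c v w => by
      have h := η.map_update_smul ![0, w] 0 c v
      rwa [update_pair_zero, update_pair_zero] at h)
    (fun v w w' => by
      have h := η.map_update_add ![v, 0] 1 w w'
      rwa [update_pair_one, update_pair_one, update_pair_one] at h)
    (fun c v w => by
      have h := η.map_update_smul ![v, 0] 1 c w
      rwa [update_pair_one, update_pair_one] at h)

@[simp]
theorem bilin_apply (η : E [⋀^Fin 2]→L[𝕜] 𝕜) (v w : E) : bilin η v w = η ![v, w] := rfl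

theorem contDiffOn_bilin {n : ℕ∞ω} {B : E → E [⋀^Fin 2]→L[𝕜] 𝕜} {U : Set E}
    (hB : ContDiffOn 𝕜 n B U) : ContDiffOn 𝕜 n (fun y => bilin (B y)) U := by
  rw [contDiffOn_clm_apply]
  intro v
  rw [contDiffOn_clm_apply]
  intro w
  exact (ContinuousAlternatingMap.apply 𝕜 E 𝕜 ![v, w]).contDiff.comp_contDiffOn hB

theorem apply_self_eq_zero {V : Type*} [AddCommGroup V] [Module 𝕜 V] [TopologicalSpace V]
    (η : V [⋀^Fin 2]→L[𝕜] 𝕜) (v : V) : η ![v, v] = 0 :=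
  η.map_eq_zero_of_eq ![v, v] (i := 0) (j := 1) rfl (by simp)

theorem apply_swap {V : Type*} [AddCommGroup V] [Module 𝕜 V] [TopologicalSpace V]
    (η : V [⋀^Fin 2]→L[𝕜] 𝕜) (v w : V) : η ![v, w] = -η ![w, v] := by
  have := η.toAlternatingMap.map_swap ![w, v] (i := 0) (j := 1) (by simp)
  rw [← ContinuousAlternatingMap.coe_toAlternatingMap, ← this]
  congr 1
  ext i
  fin_cases i <;> rfl

/-- In finite dimension non-degeneracy makes `v ↦ B y ![v, ·]` invertible, and inversion of
operators is `C^n`, so `v = -B⁻¹(df)` works. For `n = ∞` or `n = ω` no regularity is lost in passing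
from `f` to `df`. -/
theorem exists_contDiffOn_hamiltonian {n : ℕ∞ω} (hn : n = ∞ ∨ n = ω)
    {B : E → E [⋀^Fin 2]→L[𝕜] 𝕜} {U : Set E} (hU : IsOpen U) (hB : ContDiffOn 𝕜 n B U)
    (hnd : ∀ y ∈ U, ∀ v, v ≠ 0 → ∃ w, B y ![v, w] ≠ 0) {f : E → 𝕜} (hf : ContDiffOn 𝕜 n f U) :
    ∃ v : E → E, ContDiffOn 𝕜 n v U ∧ ∀ y ∈ U, ∀ w, B y ![v y, w] = -fderiv 𝕜 f y w := by
  have : CompleteSpace E := FiniteDimensional.complete 𝕜 E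
  have hinv : ∀ y ∈ U, ∃ e : E ≃L[𝕜] (E →L[𝕜] 𝕜), (e : E →L[𝕜] E →L[𝕜] 𝕜) = bilin (B y) := by
    intro y hy
    have hinj : Function.Injective (bilin (B y)).toLinearMap := by
      rw [← LinearMap.ker_eq_bot, LinearMap.ker_eq_bot']
      intro v hv
      by_contra hne
      obtain ⟨w, hw⟩ := hnd y hy v hne
      exact hw (congrArg (fun l : E →L[𝕜] 𝕜 => l w) hv)
    have hdim : Module.finrank 𝕜 E = Module.finrank 𝕜 (E →L[𝕜] 𝕜) := by
      rw [← (LinearMap.toContinuousLinearMap : (E →ₗ[𝕜] 𝕜) ≃ₗ[𝕜] E →L[𝕜] 𝕜).finrank_eq]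
      exact Subspace.dual_finrank_eq.symm
    refine ⟨(LinearEquiv.ofInjectiveOfFinrankEq _ hinj hdim).toContinuousLinearEquiv, ?_⟩
    ext v w
    rfl
  have hn1 : n + 1 ≤ n := by rcases hn with rfl | rfl <;> simp
  refine ⟨fun y => -(bilin (B y)).inverse (fderiv 𝕜 f y), ?_, fun y hy w => ?_⟩
  · refine (ContDiffOn.clm_apply ?_ (hf.fderiv_of_isOpen hU hn1)).neg
    intro y hy
    obtain ⟨e, he⟩ := hinv y hy
    have h1 := contDiffAt_map_inverse (𝕜 := 𝕜) (n := n) e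
    rw [he] at h1
    exact h1.comp_contDiffWithinAt y (contDiffOn_bilin hB y hy)
  · obtain ⟨e, he⟩ := hinv y hy
    have h1 : (bilin (B y)).inverse = e.symm := by rw [← he, ContinuousLinearMap.inverse_equiv]
    rw [← bilin_apply]
    simp only [h1]
    rw [← he, map_neg]
    simp

/-- Hamiltonian vector fields of functions in involution commute. -/
theorem fderiv_hamiltonian_comm {E : Type*} [NormedAddCommGroup E] [NormedSpace ℝ E]
    [FiniteDimensional ℝ E] {B : E → E [⋀^Fin 2]→L[ℝ] ℝ} {U : Set E} (hU : IsOpen U)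
    (hB : ContDiffOn ℝ 2 B U) (hnd : ∀ y ∈ U, ∀ v, v ≠ 0 → ∃ w, B y ![v, w] ≠ 0)
    (hclosed : ∀ y ∈ U, extDeriv B y = 0) {f g : E → ℝ} (hf : ContDiffOn ℝ 2 f U)
    (hg : ContDiffOn ℝ 2 g U) {v w : E → E} (hv : ContDiffOn ℝ 2 v U) (hw : ContDiffOn ℝ 2 w U)
    (hvf : ∀ y ∈ U, ∀ u, B y ![v y, u] = -fderiv ℝ f y u)
    (hwg : ∀ y ∈ U, ∀ u, B y ![w y, u] = -fderiv ℝ g y u)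
    (hvw : ∀ y ∈ U, B y ![v y, w y] = 0) {y : E} (hy : y ∈ U) :
    fderiv ℝ v y (w y) = fderiv ℝ w y (v y) := by
  have hUy := hU.mem_nhds hy
  set β : E → E →L[ℝ] E →L[ℝ] ℝ := fun y => bilin (B y)
  have hβ : ContDiffOn ℝ 2 β U := contDiffOn_bilin hB
  have dB : DifferentiableAt ℝ B y := (hB.contDiffAt hUy).differentiableAt two_ne_zero
  have dβ := ((hβ.contDiffAt hUy).differentiableAt two_ne_zero).hasFDerivAt
  have dv := ((hv.contDiffAt hUy).differentiableAt two_ne_zero).hasFDerivAt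
  have dw := ((hw.contDiffAt hUy).differentiableAt two_ne_zero).hasFDerivAt
  have ddf := (((hf.fderiv_of_isOpen hU (m := 1) (by norm_num)).contDiffAt hUy).differentiableAt
    one_ne_zero).hasFDerivAt
  have ddg := (((hg.fderiv_of_isOpen hU (m := 1) (by norm_num)).contDiffAt hUy).differentiableAt
    one_ne_zero).hasFDerivAt
  have hsf : IsSymmSndFDerivAt ℝ f y := (hf.contDiffAt hUy).isSymmSndFDerivAt (by simp)
  have hsg : IsSymmSndFDerivAt ℝ g y := (hg.contDiffAt hUy).isSymmSndFDerivAt (by simp)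
  set β' := fderiv ℝ β y
  set v' := fderiv ℝ v y
  set w' := fderiv ℝ w y
  set f'' := fderiv ℝ (fderiv ℝ f) y
  set g'' := fderiv ℝ (fderiv ℝ g) y
  -- This is the equation `B(v, c) = -df(c)` differentiated in the direction `a`.
  have e1 : ∀ a c, β y (v' a) c + β' a (v y) c = -f'' a c := by
    intro a c
    have h1 := (dβ.clm_apply dv).clm_apply (hasFDerivAt_const c y)
    have h2 : HasFDerivAt (fun y => -fderiv ℝ f y c) _ y :=
      (ddf.clm_apply (hasFDerivAt_const c y)).neg
    have h3 := h1.unique (h2.congr_of_eventuallyEq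
      (Filter.eventuallyEq_of_mem hUy fun z hz => hvf z hz c))
    simpa using congrArg (fun l : E →L[ℝ] ℝ => l a) h3
  have e2 : ∀ a c, β y (w' a) c + β' a (w y) c = -g'' a c := by
    intro a c
    have h1 := (dβ.clm_apply dw).clm_apply (hasFDerivAt_const c y)
    have h2 : HasFDerivAt (fun y => -fderiv ℝ g y c) _ y :=
      (ddg.clm_apply (hasFDerivAt_const c y)).neg
    have h3 := h1.unique (h2.congr_of_eventuallyEq
      (Filter.eventuallyEq_of_mem hUy fun z hz => hwg z hz c))
    simpa using congrArg (fun l : E →L[ℝ] ℝ => l a) h3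
  have e3 : ∀ c, f'' c (w y) + fderiv ℝ f y (w' c) = 0 := by
    intro c
    have h1 := ddf.clm_apply dw
    have h2 : (fun y => fderiv ℝ f y (w y)) =ᶠ[𝓝 y] fun _ => 0 :=
      Filter.eventuallyEq_of_mem hUy fun z hz => by
        have := hvf z hz (w z)
        rw [hvw z hz] at this
        linarith
    have h3 := h1.unique ((hasFDerivAt_const (0 : ℝ) y).congr_of_eventuallyEq h2)
    have := congrArg (fun l : E →L[ℝ] ℝ => l c) h3
    simp only [add_apply, ContinuousLinearMap.comp_apply,
      ContinuousLinearMap.flip_apply, zero_apply] at this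
    linarith
  -- Involution says that `dg(v)` vanishes identically; this is its derivative in the direction `c`.
  have e4 : ∀ c, g'' c (v y) + fderiv ℝ g y (v' c) = 0 := by
    intro c
    have h1 := ddg.clm_apply dv
    have h2 : (fun y => fderiv ℝ g y (v y)) =ᶠ[𝓝 y] fun _ => 0 :=
      Filter.eventuallyEq_of_mem hUy fun z hz => by
        have := hwg z hz (v z)
        rw [apply_swap, hvw z hz] at this
        linarith
    have h3 := h1.unique ((hasFDerivAt_const (0 : ℝ) y).congr_of_eventuallyEq h2)
    have := congrArg (fun l : E →L[ℝ] ℝ => l c) h3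
    simp only [add_apply, ContinuousLinearMap.comp_apply,
      ContinuousLinearMap.flip_apply, zero_apply] at this
    linarith
  have hβ' : ∀ a b c, fderiv ℝ (fun y => B y ![b, c]) y a = β' a b c := by
    intro a b c
    have h1 := (dβ.clm_apply (hasFDerivAt_const b y)).clm_apply (hasFDerivAt_const c y)
    have h2 : (fun y => B y ![b, c]) = fun y => β y b c := rfl
    rw [h2, h1.fderiv]
    simp [β']
  have e5 : ∀ a b c, β' a b c - β' b a c + β' c a b = 0 := by
    intro a b c
    have h1 := extDeriv_apply dB ![a, b, c]
    rw [hclosed y hy, Fin.sum_univ_three] at h1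
    have r0 : (0 : Fin 3).removeNth ![a, b, c] = ![b, c] := by ext i; fin_cases i <;> rfl
    have r1 : (1 : Fin 3).removeNth ![a, b, c] = ![a, c] := by ext i; fin_cases i <;> rfl
    have r2 : (2 : Fin 3).removeNth ![a, b, c] = ![a, b] := by ext i; fin_cases i <;> rfl
    rw [r0, r1, r2, hβ', hβ', hβ'] at h1
    simp at h1
    linarith
  have hnd' : ∀ u, (∀ c, β y u c = 0) → u = 0 := fun u hu => by
    by_contra hne
    obtain ⟨c, hc⟩ := hnd y hy u hne
    exact hc (hu c)
  -- The commutator is paired with an arbitrary `c`. The difference of `a1` and `a2` expresses the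
  -- pairing by `β'` and the Hessians, closedness `a3` leaves the term `-β' c v w`, and `a6`
  -- replaces that by `f''(c, w) + β(v' c, w)`. The Hessians of `f` cancel by symmetry, and the
  -- remainder `g''(c, v) + dg(v' c)` vanishes by `a5`.
  refine sub_eq_zero.1 (hnd' _ fun c => ?_)
  have a1 := e1 (w y) c
  have a2 := e2 (v y) c
  have a3 := e5 (v y) (w y) c
  have a4 := e3 c
  have a5 := e4 c
  have a6 := e1 c (w y)
  have a7 : β y (v' c) (w y) = fderiv ℝ g y (v' c) := by
    change B y ![v' c, w y] = _
    rw [apply_swap, hwg y hy, neg_neg]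
  have s1 : f'' (w y) c = f'' c (w y) := hsf.eq _ _
  have s2 : g'' (v y) c = g'' c (v y) := hsg.eq _ _
  rw [map_sub, sub_apply]
  linarith

end HamiltonianVectorSpace

/-! ### Leaves of a straightened commuting family -/

section Leaves

variable {E : Type*} [NormedAddCommGroup E] [NormedSpace ℝ E]
  {X : Type*} [TopologicalSpace X] [ChartedSpace E X]
  {Y : Type*} [NormedAddCommGroup Y] [NormedSpace ℝ Y]

/-- The open square in `ℂ` of centre `c` and half-width `r`. -/
def box (c : ℂ) (r : ℝ) : Set ℂ := {ζ | ζ.re ∈ Ioo (c.re - r) (c.re + r) ∧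
  ζ.im ∈ Ioo (c.im - r) (c.im + r)}

theorem isOpen_box (c : ℂ) (r : ℝ) : IsOpen (box c r) :=
  (isOpen_Ioo.preimage Complex.continuous_re).inter (isOpen_Ioo.preimage Complex.continuous_im)

theorem convex_box (c : ℂ) (r : ℝ) : Convex ℝ (box c r) :=
  ((convex_Ioo _ _).linear_preimage Complex.reLm).inter
    ((convex_Ioo _ _).linear_preimage Complex.imLm)

/-- A chart in which the vector fields `F ζ` are the constant fields `(ζ, 0)`. -/
structure IsStraightening (F : ℂ → VField ℝ E X) (χ : OpenPartialHomeomorph X (ℂ × Y)) :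
    Prop where
  mdifferentiableAt : ∀ x ∈ χ.source, MDifferentiableAt 𝓘(ℝ, E) 𝓘(ℝ, ℂ × Y) χ x
  mdifferentiableAt_symm : ∀ w ∈ χ.target, MDifferentiableAt 𝓘(ℝ, ℂ × Y) 𝓘(ℝ, E) χ.symm w
  frame : ∀ w ∈ χ.target, ∀ ζ : ℂ,
    mfderiv 𝓘(ℝ, ℂ × Y) 𝓘(ℝ, E) χ.symm w ((ζ, 0) : ℂ × Y) = F ζ (χ.symm w)
  target_eq : ∃ (c : ℂ) (r : ℝ) (T : Set Y), χ.target = box c r ×ˢ T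

/-- `S` is invariant under the flows of the vector fields `F ζ`, which are simultaneously
straightened by charts around the points of `S`. -/
structure IsStraightened (Y : Type*) [NormedAddCommGroup Y] [NormedSpace ℝ Y]
    (F : ℂ → VField ℝ E X) (S : Set X) : Prop where
  exists_chart : ∀ x ∈ S, ∃ χ : OpenPartialHomeomorph X (ℂ × Y), IsStraightening F χ ∧ x ∈ χ.source
  invariant : ∀ ζ t x y, FlowsTo (F ζ) t x y → x ∈ S → y ∈ S

/-- A locally constant property holds on a relatively clopen set. This continuity principle yields
uniqueness of integral curves, commutation of flows, and the statement on trajectories. -/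
theorem _root_.IsPreconnected.iff_of_eventually_iff {α : Type*} [TopologicalSpace α] {s : Set α}
    (hs : IsPreconnected s) (hso : IsOpen s) {P : α → Prop}
    (h : ∀ x ∈ s, ∀ᶠ y in 𝓝 x, (P y ↔ P x)) {x y : α} (hx : x ∈ s) (hy : y ∈ s) (hP : P x) :
    P y := by
  have key : s ⊆ s ∩ {y | P y} := by
    refine hs.subset_of_closure_inter_subset ?_ ⟨x, hx, hx, hP⟩ ?_
    · refine isOpen_iff_mem_nhds.2 fun z hz => ?_
      filter_upwards [h z hz.1, hso.mem_nhds hz.1] with w hw hws using ⟨hws, hw.2 hz.2⟩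
    · rintro z ⟨hz, hzs⟩
      obtain ⟨w, hw, hw'⟩ := ((mem_closure_iff_frequently.1 hz).and_eventually (h z hzs)).exists
      exact ⟨hzs, hw'.1 hw.2⟩
  exact (key hy).2

namespace FlowsTo

theorem symm {V : VField ℝ E X} {t : ℝ} {x y : X} (h : FlowsTo V t x y) : FlowsTo V (-t) y x := by
  obtain ⟨a, b, γ, h0, ht, rfl, rfl, hγ⟩ := h
  refine ⟨a - t, b - t, γ ∘ (· + t), ?_, ?_, by simp, by simp, ?_⟩
  · simpa using ht
  · exact ⟨by linarith [h0.1], by linarith [h0.2]⟩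
  · have := hγ.comp_add t
    convert this using 1
    ext s
    simp [sub_lt_iff_lt_add, lt_sub_iff_add_lt]

theorem time {V : VField ℝ E X} {a b : ℝ} {γ : ℝ → X} (hγ : IsMIntegralCurveOn γ V (Ioo a b))
    {s t : ℝ} (hs : s ∈ Ioo a b) (ht : t ∈ Ioo a b) : FlowsTo V (t - s) (γ s) (γ t) := by
  refine ⟨a - s, b - s, γ ∘ (· + s), ?_, ?_, by simp, by simp, ?_⟩
  · simpa using hs
  · exact ⟨by linarith [ht.1], by linarith [ht.2]⟩
  · have := hγ.comp_add s
    convert this using 1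
    ext s
    simp [sub_lt_iff_lt_add, lt_sub_iff_add_lt]

end FlowsTo

namespace IsStraightening

variable {F : ℂ → VField ℝ E X} {χ : OpenPartialHomeomorph X (ℂ × Y)}

theorem convex_fiber (hχ : IsStraightening F χ) (w : ℂ × Y) (ζ : ℂ) :
    Convex ℝ {t : ℝ | w + t • (ζ, 0) ∈ χ.target} := by
  obtain ⟨c, r, T, h⟩ := hχ.target_eq
  intro x hx y hy a b ha hb hab
  simp only [h, mem_ofPred_eq, mem_prod, Prod.fst_add, Prod.snd_add, Prod.smul_mk, smul_zero,
    add_zero] at hx hy ⊢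
  refine ⟨?_, hx.2⟩
  convert convex_box c r hx.1 hy.1 ha hb hab using 1
  have : w.1 = (a + b) • w.1 := by rw [hab, one_smul]
  conv_lhs => rw [this]
  module

/-- The frame condition concerns `χ.symm`; since `χ ∘ χ.symm` is the identity near `χ (γ t)`, the
derivative of `χ` carries `F ζ` back to `(ζ, 0)`. -/
theorem hasDerivAt_comp (hχ : IsStraightening F χ) {ζ : ℂ} {a b : ℝ} {γ : ℝ → X}
    (hγ : IsMIntegralCurveOn γ (F ζ) (Ioo a b)) {t : ℝ} (ht : t ∈ Ioo a b)
    (htχ : γ t ∈ χ.source) : HasDerivAt (χ ∘ γ) ((ζ, 0) : ℂ × Y) t := by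
  have h1 : HasMFDerivAt 𝓘(ℝ, ℝ) 𝓘(ℝ, E) γ t _ := (hγ t ht).hasMFDerivAt (Ioo_mem_nhds ht.1 ht.2)
  set D : E →L[ℝ] ℂ × Y := mfderiv 𝓘(ℝ, E) 𝓘(ℝ, ℂ × Y) χ (γ t)
  set D' : (ℂ × Y) →L[ℝ] E := mfderiv 𝓘(ℝ, ℂ × Y) 𝓘(ℝ, E) χ.symm (χ (γ t))
  have h2 := (hχ.mdifferentiableAt _ htχ).hasMFDerivAt
  have h3 : HasFDerivAt (χ ∘ γ) (D.comp ((1 : ℝ →L[ℝ] ℝ).smulRight (F ζ (γ t) : E))) t :=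
    (h2.comp t h1).hasFDerivAt
  have hw := χ.map_source htχ
  have h4 := (hχ.mdifferentiableAt_symm _ hw).hasMFDerivAt
  rw [← χ.left_inv htχ] at h2
  have h5 : HasFDerivAt (χ ∘ χ.symm) (D.comp D') (χ (γ t)) := by
    have := (h2.comp (χ (γ t)) h4).hasFDerivAt
    rw [χ.left_inv htχ] at this
    exact this
  have h6 : HasFDerivAt (χ ∘ χ.symm) (ContinuousLinearMap.id ℝ (ℂ × Y)) (χ (γ t)) := by
    refine (hasFDerivAt_id _).congr_of_eventuallyEq ?_
    filter_upwards [χ.open_target.mem_nhds hw] with y hy using χ.right_inv hy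
  have h7 : D (D' (ζ, 0)) = (ζ, 0) := congrArg (fun l : (ℂ × Y) →L[ℝ] (ℂ × Y) => l (ζ, 0))
    (h5.unique h6)
  have h8 : D' (ζ, 0) = F ζ (γ t) := by
    have := hχ.frame _ hw ζ
    rw [χ.left_inv htχ] at this
    exact this
  refine h3.hasDerivAt.congr_deriv ?_
  rw [h8] at h7
  change D ((1 : ℝ) • (F ζ (γ t) : E)) = _
  rw [one_smul, h7]

/-- Lines in a straightening chart are integral curves. -/
theorem isMIntegralCurveOn_line (hχ : IsStraightening F χ) {w : ℂ × Y} {ζ : ℂ} {s : Set ℝ}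
    (hs : ∀ t ∈ s, w + t • (ζ, 0) ∈ χ.target) :
    IsMIntegralCurveOn (fun t => χ.symm (w + t • (ζ, 0))) (F ζ) s := by
  intro t ht
  have h1 := (hχ.mdifferentiableAt_symm _ (hs t ht)).hasMFDerivAt
  have h2 : HasFDerivAt (fun t : ℝ => w + t • ((ζ, 0) : ℂ × Y))
      ((1 : ℝ →L[ℝ] ℝ).smulRight ((ζ, 0) : ℂ × Y)) t :=
    ((hasFDerivAt_id t).smul_const _).const_add w
  set D : (ℂ × Y) →L[ℝ] E := mfderiv 𝓘(ℝ, ℂ × Y) 𝓘(ℝ, E) χ.symm (w + t • (ζ, 0))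
  have h4 : D (ζ, 0) = F ζ (χ.symm (w + t • (ζ, 0))) := hχ.frame _ (hs t ht) ζ
  have h3 : HasMFDerivAt 𝓘(ℝ, ℝ) 𝓘(ℝ, E) (fun t : ℝ => χ.symm (w + t • (ζ, 0))) t
      (D.comp ((1 : ℝ →L[ℝ] ℝ).smulRight ((ζ, 0) : ℂ × Y))) :=
    HasMFDerivAt.comp (g := χ.symm) t h1 h2.hasMFDerivAt
  refine (h3.congr_mfderiv (ContinuousLinearMap.ext fun s => ?_)).hasMFDerivWithinAt
  have key : ∀ r : ℝ, D (r • (ζ, 0)) = r • (id (F ζ (χ.symm (w + t • (ζ, 0)))) : E) := fun r => by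
    rw [map_smul, h4]; rfl
  exact key s

/-- Integral curves are lines in a straightening chart. -/
theorem flowsTo_line (hχ : IsStraightening F χ) {w : ℂ × Y} {ζ : ℂ} {t : ℝ} (hw : w ∈ χ.target)
    (ht : w + t • (ζ, 0) ∈ χ.target) : FlowsTo (F ζ) t (χ.symm w) (χ.symm (w + t • (ζ, 0))) := by
  set O : Set ℝ := {t : ℝ | w + t • (ζ, 0) ∈ χ.target}
  have hO : IsOpen O := χ.open_target.preimage (by fun_prop)
  have h0 : (0 : ℝ) ∈ O := by
    change w + (0 : ℝ) • ((ζ, 0) : ℂ × Y) ∈ χ.target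
    rwa [zero_smul, add_zero]
  have hmin : min 0 t ∈ O := by rcases min_choice 0 t with h | h <;> rw [h]; exacts [h0, ht]
  have hmax : max 0 t ∈ O := by rcases max_choice 0 t with h | h <;> rw [h]; exacts [h0, ht]
  obtain ⟨a, ha, haO⟩ := (mem_nhdsLT_iff_exists_Ico_subset.1
    (mem_nhdsWithin_of_mem_nhds (hO.mem_nhds hmin) : O ∈ 𝓝[<] (min 0 t)))
  obtain ⟨b, hb, hbO⟩ := (mem_nhdsGT_iff_exists_Ioc_subset.1
    (mem_nhdsWithin_of_mem_nhds (hO.mem_nhds hmax) : O ∈ 𝓝[>] (max 0 t)))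
  have hab : Ioo a b ⊆ O := by
    have := (hχ.convex_fiber w ζ).ordConnected.out (haO ⟨le_rfl, ha⟩) (hbO ⟨hb, le_rfl⟩)
    exact Ioo_subset_Icc_self.trans this
  have ha' : a < min 0 t := ha
  have hb' : max 0 t < b := hb
  rw [lt_min_iff] at ha'
  rw [max_lt_iff] at hb'
  refine ⟨a, b, _, ⟨ha'.1, hb'.1⟩, ⟨ha'.2, hb'.2⟩, by simp only [zero_smul, add_zero], rfl,
    hχ.isMIntegralCurveOn_line fun t ht => hab ht⟩

/-- Two points of a slice are joined by a vertical and then a horizontal segment. The corner has the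
real part of `w` and the imaginary part of `w'`, so it stays in the target because a box is a
product of intervals. -/
theorem line_mem (hχ : IsStraightening F χ) {w w' : ℂ × Y} (hw : w ∈ χ.target)
    (hw' : w' ∈ χ.target) (h : w.2 = w'.2) :
    w + ((w' - w).1.im) • (Complex.I, 0) ∈ χ.target ∧
      w' = w + ((w' - w).1.im) • (Complex.I, 0) + ((w' - w).1.re) • ((1 : ℂ), (0 : Y)) := by
  obtain ⟨c, r, T, hT⟩ := hχ.target_eq
  rw [hT] at hw hw' ⊢
  refine ⟨⟨⟨?_, ?_⟩, by simpa using hw.2⟩, Prod.ext ?_ (by simp [h])⟩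
  · simpa using hw.1.1
  · simpa using hw'.1.2
  · apply Complex.ext <;> simp

theorem flowsTo_zero (hχ : IsStraightening F χ) (ζ : ℂ) {x : X} (hx : x ∈ χ.source) :
    FlowsTo (F ζ) 0 x x := by
  have := hχ.flowsTo_line (w := χ x) (ζ := ζ) (t := 0) (χ.map_source hx)
    (by rw [zero_smul, add_zero]; exact χ.map_source hx)
  rwa [zero_smul, add_zero, χ.left_inv hx] at this

/-- Points on the same slice of a straightening chart lie in one leaf. -/
theorem mem_leaf (hχ : IsStraightening F χ) {x y : X} (hx : x ∈ χ.source) (hy : y ∈ χ.source)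
    (h : (χ x).2 = (χ y).2) : y ∈ leaf (F 1) (F Complex.I) x := by
  obtain ⟨h1, h2⟩ := hχ.line_mem (χ.map_source hx) (χ.map_source hy) h
  have h3 := hχ.flowsTo_line (χ.map_source hx) h1
  have h4 := hχ.flowsTo_line h1 (h2 ▸ χ.map_source hy)
  rw [← h2, χ.left_inv hy] at h4
  rw [χ.left_inv hx] at h3
  exact Relation.ReflTransGen.single ⟨_, _, _, h3, h4⟩

end IsStraightening

namespace IsStraightened

variable {F : ℂ → VField ℝ E X} {S : Set X}

theorem flowsTo_zero (hF : IsStraightened Y F S) (ζ : ℂ) {x : X} (hx : x ∈ S) :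
    FlowsTo (F ζ) 0 x x := by
  obtain ⟨χ, hχ, hxχ⟩ := hF.exists_chart x hx
  exact hχ.flowsTo_zero ζ hxχ

theorem leaf_subset (hF : IsStraightened Y F S) {x : X} (hx : x ∈ S) :
    leaf (F 1) (F Complex.I) x ⊆ S := by
  intro y hy
  induction hy with
  | refl => exact hx
  | tail _ h ih =>
    obtain ⟨s, t, z, h1, h2⟩ := h
    exact hF.invariant _ _ _ _ h2 (hF.invariant _ _ _ _ h1 ih)

/-- A generating step of `leaf` always uses both fields, so a single flow is padded with time zero;
`flowsTo_zero` supplies the integral curve that this needs. -/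
theorem mem_leaf_of_flowsTo_one (hF : IsStraightened Y F S) {t : ℝ} {x y : X} (hx : x ∈ S)
    (h : FlowsTo (F 1) t x y) : y ∈ leaf (F 1) (F Complex.I) x :=
  Relation.ReflTransGen.single ⟨0, t, x, hF.flowsTo_zero _ hx, h⟩

theorem mem_leaf_of_flowsTo_I (hF : IsStraightened Y F S) {t : ℝ} {x y : X} (hx : x ∈ S)
    (h : FlowsTo (F Complex.I) t x y) : y ∈ leaf (F 1) (F Complex.I) x :=
  Relation.ReflTransGen.single ⟨t, 0, y, h, hF.flowsTo_zero _ (hF.invariant _ _ _ _ h hx)⟩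

theorem _root_.HamFol.mem_leaf_trans {V W : VField ℝ E X} {x y z : X} (h : y ∈ leaf V W x)
    (h' : z ∈ leaf V W y) : z ∈ leaf V W x :=
  Relation.ReflTransGen.trans h h'

/-- Flows are undone by negative times. Reversal exchanges the order of the two fields within a
step, so each step becomes two padded ones. -/
theorem mem_leaf_symm (hF : IsStraightened Y F S) {x y : X} (hx : x ∈ S)
    (h : y ∈ leaf (F 1) (F Complex.I) x) : x ∈ leaf (F 1) (F Complex.I) y := by
  induction h with
  | refl => exact Relation.ReflTransGen.refl
  | tail h₀ h ih =>
    obtain ⟨s, t, z, h1, h2⟩ := h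
    have hp := hF.leaf_subset hx h₀
    have hz := hF.invariant _ _ _ _ h1 hp
    have hq := hF.invariant _ _ _ _ h2 hz
    exact mem_leaf_trans (mem_leaf_trans (hF.mem_leaf_of_flowsTo_one hq h2.symm)
      (hF.mem_leaf_of_flowsTo_I hz h1.symm)) ih

theorem isPartition_leaves (hF : IsStraightened Y F S) :
    Setoid.IsPartition (leaves (F 1) (F Complex.I) S) := by
  refine ⟨?_, fun a => ⟨((↑) : S → X) ⁻¹' leaf (F 1) (F Complex.I) a,
    ⟨⟨a, rfl⟩, Relation.ReflTransGen.refl⟩, ?_⟩⟩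
  · rintro ⟨x, hx⟩
    exact (hx ▸ (Relation.ReflTransGen.refl : (x : X) ∈ leaf (F 1) (F Complex.I) x) :
      x ∈ (∅ : Set S))
  · rintro _ ⟨⟨x, rfl⟩, ha⟩
    ext y
    exact ⟨fun h => mem_leaf_trans (hF.mem_leaf_symm x.2 ha) h, fun h => mem_leaf_trans ha h⟩

theorem isPathConnected_leaf (hF : IsStraightened Y F S) {x : X} (hx : x ∈ S) :
    IsPathConnected (leaf (F 1) (F Complex.I) x) := by
  refine ⟨x, Relation.ReflTransGen.refl, fun {y} hy => ?_⟩
  have aux : ∀ {ζ t p q}, FlowsTo (F ζ) t p q →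
      (∀ s r, FlowsTo (F ζ) s p r → r ∈ leaf (F 1) (F Complex.I) x) →
      JoinedIn (leaf (F 1) (F Complex.I) x) p q := by
    rintro ζ t p q ⟨a, b, γ, h0, ht, rfl, rfl, hγ⟩ h
    have hseg : ∀ s ∈ Icc (0 : ℝ) 1, s * t ∈ Ioo a b := fun s hs => by
      simpa using (convex_Ioo a b) h0 ht (sub_nonneg.2 hs.2) hs.1 (by ring)
    -- The flow line itself, rescaled to `[0, 1]`, is a path; its intermediate points are reached by
    -- the same flow at shorter times.
    refine JoinedIn.ofLine (f := fun s => γ (s * t)) ?_ (by simp) (by simp) ?_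
    · exact hγ.continuousOn.comp (by fun_prop) hseg
    · rintro _ ⟨s, hs, rfl⟩
      exact h (s * t) _ ⟨a, b, γ, h0, hseg s hs, rfl, rfl, hγ⟩
  induction hy with
  | refl => exact JoinedIn.refl Relation.ReflTransGen.refl
  | tail h₀ h ih =>
    obtain ⟨s, t, z, h1, h2⟩ := h
    have hp := hF.leaf_subset hx h₀
    have hz := hF.invariant _ _ _ _ h1 hp
    refine (ih.trans (aux h1 fun s r hr => mem_leaf_trans h₀ (hF.mem_leaf_of_flowsTo_I hp hr))).trans
      (aux h2 fun s r hr => ?_)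
    exact mem_leaf_trans h₀ (mem_leaf_trans (hF.mem_leaf_of_flowsTo_I hp h1)
      (hF.mem_leaf_of_flowsTo_one hz hr))

variable [T2Space X]

/-- Uniqueness of integral curves. -/
theorem eqOn_integralCurve (hF : IsStraightened Y F S) {ζ : ℂ} {a b a' b' : ℝ} {γ β : ℝ → X}
    (hγ : IsMIntegralCurveOn γ (F ζ) (Ioo a b)) (hβ : IsMIntegralCurveOn β (F ζ) (Ioo a' b'))
    {t₀ : ℝ} (h : t₀ ∈ Ioo a b) (h' : t₀ ∈ Ioo a' b') (hS : γ t₀ ∈ S) (h₀ : γ t₀ = β t₀) {t : ℝ}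
    (ht : t ∈ Ioo a b) (ht' : t ∈ Ioo a' b') : γ t = β t := by
  have hpre : IsPreconnected (Ioo a b ∩ Ioo a' b') := by
    rw [Ioo_inter_Ioo]; exact isPreconnected_Ioo
  refine hpre.iff_of_eventually_iff (P := fun t => γ t = β t) (isOpen_Ioo.inter isOpen_Ioo) ?_
    ⟨h, h'⟩ ⟨ht, ht'⟩ h₀
  rintro s ⟨hs, hs'⟩
  have hγc : ContinuousAt γ s := (hγ.continuousOn).continuousAt (Ioo_mem_nhds hs.1 hs.2)
  have hβc : ContinuousAt β s := (hβ.continuousOn).continuousAt (Ioo_mem_nhds hs'.1 hs'.2)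
  by_cases hne : γ s = β s
  · obtain ⟨χ, hχ, hsχ⟩ := hF.exists_chart (γ s)
      (hF.invariant ζ _ _ _ (FlowsTo.time hγ h hs) hS)
    have e1 := hγc.preimage_mem_nhds (χ.open_source.mem_nhds hsχ)
    have e2 := hβc.preimage_mem_nhds (χ.open_source.mem_nhds (hne ▸ hsχ))
    obtain ⟨ε, hε, hball⟩ := Metric.mem_nhds_iff.1 (Filter.inter_mem (Filter.inter_mem e1 e2)
      (Filter.inter_mem (Ioo_mem_nhds hs.1 hs.2) (Ioo_mem_nhds hs'.1 hs'.2)))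
    filter_upwards [Metric.ball_mem_nhds s hε] with r hr
    refine ⟨fun _ => hne, fun _ => ?_⟩
    -- In a straightening chart both curves have the constant velocity `(ζ, 0)`, so their difference
    -- is constant. Away from coincidence points, the Hausdorff property separates the curves.
    have hd : ∀ r ∈ Metric.ball s ε, HasDerivAt (fun r => χ (γ r) - χ (β r)) 0 r := by
      intro r hr
      obtain ⟨⟨m1, m2⟩, m3, m4⟩ := hball hr
      have := (hχ.hasDerivAt_comp hγ m3 m1).sub (hχ.hasDerivAt_comp hβ m4 m2)
      rw [sub_self] at this
      exact this
    have hconst := Metric.isOpen_ball.is_const_of_deriv_eq_zero (convex_ball s ε).isPreconnected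
      (fun r hr => (hd r hr).differentiableAt.differentiableWithinAt)
      (fun r hr => (hd r hr).deriv) hr (Metric.mem_ball_self hε)
    simp only [hne, sub_self] at hconst
    exact χ.injOn (hball hr).1.1 (hball hr).1.2 (sub_eq_zero.1 hconst)
  · filter_upwards [(hγc.ne_iff_eventually_ne hβc).1 hne] with r hr
    exact ⟨fun h => absurd h hr, fun h => absurd h hne⟩

theorem flowsTo_unique (hF : IsStraightened Y F S) {ζ : ℂ} {t : ℝ} {x y y' : X} (hx : x ∈ S)
    (h : FlowsTo (F ζ) t x y) (h' : FlowsTo (F ζ) t x y') : y = y' := by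
  obtain ⟨a, b, γ, h0, ht, rfl, rfl, hγ⟩ := h
  obtain ⟨a', b', β, h0', ht', he, rfl, hβ⟩ := h'
  exact hF.eqOn_integralCurve hγ hβ h0 h0' hx he.symm ht ht'

/-- The second curve is shifted by `t` and glued to the first; by uniqueness they agree on the whole
overlap of their intervals. -/
theorem flowsTo_trans (hF : IsStraightened Y F S) {ζ : ℂ} {t t' : ℝ} {x y z : X} (hx : x ∈ S)
    (h : FlowsTo (F ζ) t x y) (h' : FlowsTo (F ζ) t' y z) : FlowsTo (F ζ) (t + t') x z := by
  have hy := hF.invariant ζ _ _ _ h hx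
  obtain ⟨a, b, γ, h0, ht, rfl, rfl, hγ⟩ := h
  obtain ⟨a', b', β, h0', ht', he, rfl, hβ⟩ := h'
  have hβ' : IsMIntegralCurveOn (β ∘ (· + -t)) (F ζ) (Ioo (a' + t) (b' + t)) := by
    have := hβ.comp_add (-t)
    convert this using 1
    ext s
    simp
  have htt : t ∈ Ioo (a' + t) (b' + t) := ⟨by linarith [h0'.1], by linarith [h0'.2]⟩
  have hagree : ∀ s ∈ Ioo a b, s ∈ Ioo (a' + t) (b' + t) → γ s = β (s + -t) := fun s hs hs' =>
    hF.eqOn_integralCurve hγ hβ' ht htt hy (by simp [he]) hs hs'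
  classical
  set δ : ℝ → X := fun s => if s ∈ Ioo a b then γ s else β (s + -t)
  have hδ1 : ∀ s ∈ Ioo a b, δ s = γ s := fun s hs => if_pos hs
  have hδ2 : ∀ s ∈ Ioo (a' + t) (b' + t), δ s = β (s + -t) := fun s hs => by
    by_cases h : s ∈ Ioo a b
    · rw [hδ1 s h, hagree s h hs]
    · exact if_neg h
  have hunion : Ioo (min a (a' + t)) (max b (b' + t)) = Ioo a b ∪ Ioo (a' + t) (b' + t) :=
    (Ioo_union_Ioo' (htt.1.trans ht.2) (ht.1.trans htt.2)).symm
  refine ⟨min a (a' + t), max b (b' + t), δ, ⟨min_lt_of_left_lt h0.1, lt_max_of_lt_left h0.2⟩, ?_,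
    hδ1 0 h0, ?_, ?_⟩
  · rw [hunion]
    exact Or.inr ⟨by linarith [ht'.1], by linarith [ht'.2]⟩
  · rw [hδ2 _ ⟨by linarith [ht'.1], by linarith [ht'.2]⟩]
    simp
  · rw [isMIntegralCurveOn_iff_isMIntegralCurveAt isOpen_Ioo, hunion]
    have aux : ∀ {α : ℝ → X} {u : Set ℝ}, IsOpen u → IsMIntegralCurveOn α (F ζ) u →
        (∀ s ∈ u, δ s = α s) → ∀ s ∈ u, IsMIntegralCurveAt δ (F ζ) s := by
      intro α u hu hα hδ s hs
      filter_upwards [hu.mem_nhds hs] with r hr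
      have e1 := (hα r hr).hasMFDerivAt (hu.mem_nhds hr)
      rw [hδ r hr]
      exact e1.congr_of_eventuallyEq (Filter.eventuallyEq_of_mem (hu.mem_nhds hr) hδ)
    rintro s (hs | hs)
    · exact aux isOpen_Ioo hγ hδ1 s hs
    · exact aux isOpen_Ioo hβ' hδ2 s hs

omit [T2Space X] in
theorem _root_.HamFol.IsStraightening.eventually_flowsTo {χ : OpenPartialHomeomorph X (ℂ × Y)}
    (hχ : IsStraightening F χ) {x : X} (hx : x ∈ χ.source) :
    ∀ᶠ ζ in 𝓝 (0 : ℂ), χ x + (ζ, 0) ∈ χ.target ∧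
      FlowsTo (F ζ) 1 x (χ.symm (χ x + (ζ, 0))) := by
  have hc : ContinuousAt (fun ζ : ℂ => χ x + (ζ, 0)) 0 := by fun_prop
  have h0 : χ x + ((0 : ℂ), (0 : Y)) ∈ χ.target := by
    rw [Prod.mk_zero_zero, add_zero]; exact χ.map_source hx
  filter_upwards [hc.preimage_mem_nhds (χ.open_target.mem_nhds h0)] with ζ hζ
  have := hχ.flowsTo_line (ζ := ζ) (t := 1) (χ.map_source hx) (by rw [one_smul]; exact hζ)
  rw [one_smul, χ.left_inv hx] at this
  exact ⟨hζ, this⟩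

/-- Inside one chart both flows are translations, which commute; uniqueness identifies the given
endpoints with those computed in the chart. -/
theorem eventually_commute_of_chart (hF : IsStraightened Y F S)
    {χ : OpenPartialHomeomorph X (ℂ × Y)} (hχ : IsStraightening F χ) {x x' : X} (hxS : x ∈ S)
    (hx : x ∈ χ.source) {θ : ℂ} {r : ℝ} (hr : χ x + r • (θ, 0) ∈ χ.target)
    (hx' : FlowsTo (F θ) r x x') :
    ∀ᶠ ζ in 𝓝 (0 : ℂ), ∀ y y', FlowsTo (F ζ) 1 x y → FlowsTo (F ζ) 1 x' y' →
      FlowsTo (F θ) r y y' := by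
  have hl := hχ.flowsTo_line (χ.map_source hx) hr
  rw [χ.left_inv hx] at hl
  obtain rfl := hF.flowsTo_unique hxS hx' hl
  have hx'S := hF.invariant _ _ _ _ hx' hxS
  filter_upwards [hχ.eventually_flowsTo hx, hχ.eventually_flowsTo (χ.map_target hr)] with
    ζ h1 h2 y y' hy hy'
  rw [χ.right_inv hr] at h2
  rw [hF.flowsTo_unique hxS hy h1.2, hF.flowsTo_unique hx'S hy' h2.2]
  have e : χ x + r • ((θ, 0) : ℂ × Y) + (ζ, 0) = χ x + (ζ, 0) + r • ((θ, 0) : ℂ × Y) := by abel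
  rw [e] at h2 ⊢
  exact hχ.flowsTo_line h1.1 h2.1

/-- The flows of the vector fields `F ζ` commute, for small times in one of the factors. -/
theorem eventually_commute (hF : IsStraightened Y F S) {θ : ℂ} {s : ℝ} {x x' : X} (hx : x ∈ S)
    (h : FlowsTo (F θ) s x x') :
    ∀ᶠ ζ in 𝓝 (0 : ℂ), ∀ y y', FlowsTo (F ζ) 1 x y → FlowsTo (F ζ) 1 x' y' →
      FlowsTo (F θ) s y y' := by
  obtain ⟨a, b, γ, h0, hs, rfl, rfl, hγ⟩ := h
  have hS : ∀ τ ∈ Ioo a b, γ τ ∈ S := fun τ hτ =>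
    hF.invariant _ _ _ _ (FlowsTo.time hγ h0 hτ) hx
  -- The local statement is propagated along the integral curve of `F θ`. The neighbourhood of
  -- admissible `ζ` may depend on `τ`: passing from `τ₀` to a nearby `τ` intersects it with the one
  -- given by a chart at `γ τ₀`.
  refine isPreconnected_Ioo.iff_of_eventually_iff (P := fun τ => ∀ᶠ ζ in 𝓝 (0 : ℂ), ∀ y y',
    FlowsTo (F ζ) 1 (γ 0) y → FlowsTo (F ζ) 1 (γ τ) y' → FlowsTo (F θ) τ y y') isOpen_Ioo ?_
    h0 hs ?_
  · intro τ₀ hτ₀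
    obtain ⟨χ, hχ, hxχ⟩ := hF.exists_chart (γ τ₀) (hS τ₀ hτ₀)
    have hc : ContinuousAt (fun τ : ℝ => χ (γ τ₀) + (τ - τ₀) • ((θ, 0) : ℂ × Y)) τ₀ := by fun_prop
    have hc2 : ContinuousAt γ τ₀ := hγ.continuousOn.continuousAt (Ioo_mem_nhds hτ₀.1 hτ₀.2)
    filter_upwards [hc.preimage_mem_nhds (χ.open_target.mem_nhds (by
      rw [sub_self, zero_smul, add_zero]; exact χ.map_source hxχ)),
      hc2.preimage_mem_nhds (χ.open_source.mem_nhds hxχ),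
      Ioo_mem_nhds hτ₀.1 hτ₀.2] with τ hτ hτχ hτab
    have hloc := hF.eventually_commute_of_chart hχ (hS _ hτ₀) hxχ hτ (FlowsTo.time hγ hτ₀ hτab)
    have hy0 : ∀ᶠ ζ in 𝓝 (0 : ℂ), ∀ y, FlowsTo (F ζ) 1 (γ 0) y → y ∈ S :=
      Filter.Eventually.of_forall fun ζ y hy => hF.invariant _ _ _ _ hy hx
    constructor
    · intro hP
      filter_upwards [hP, hloc, hχ.eventually_flowsTo hτχ] with ζ h1 h2 h3 y y' hy hy'
      have := hF.flowsTo_trans (hF.invariant _ _ _ _ hy hx) (h1 _ _ hy h3.2) (h2 _ _ hy' h3.2).symm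
      simpa using this
    · intro hP
      filter_upwards [hP, hloc, hχ.eventually_flowsTo hxχ] with ζ h1 h2 h3 y y' hy hy'
      have := hF.flowsTo_trans (hF.invariant _ _ _ _ hy hx) (h1 _ _ hy h3.2) (h2 _ _ h3.2 hy')
      simpa using this
  · refine Filter.Eventually.of_forall fun ζ y y' hy hy' => ?_
    rw [hF.flowsTo_unique hx hy hy']
    exact hF.flowsTo_zero θ (hF.invariant _ _ _ _ hy' hx)

/-- Points on nearby points of a slice flow, in nearby times, into the same slice. -/
theorem eventually_slice (hF : IsStraightened Y F S) {χ χ' : OpenPartialHomeomorph X (ℂ × Y)}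
    (hχ : IsStraightening F χ) (hχ' : IsStraightening F χ') {x x' : X} (hxS : x ∈ S)
    (hx : x ∈ χ.source) {θ : ℂ} {s : ℝ} (h : FlowsTo (F θ) s x x') (hx' : x' ∈ χ'.source) :
    ∀ᶠ p : ℝ × ℂ in 𝓝 (s, 0), ∀ q, FlowsTo (F θ) p.1 (χ.symm (χ x + (p.2, 0))) q →
      q ∈ χ'.source ∧ (χ' q).2 = (χ' x').2 := by
  have hx'S := hF.invariant _ _ _ _ h hxS
  have h1 := (((hF.eventually_commute hxS h).and (hχ.eventually_flowsTo hx)).and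
    (hχ'.eventually_flowsTo hx'))
  have h2 : Filter.Tendsto (fun p : ℝ × ℂ => p.2) (𝓝 (s, 0)) (𝓝 0) :=
    (continuous_snd.tendsto (s, (0 : ℂ)))
  have hc : ContinuousAt (fun p : ℝ × ℂ => χ' x' + (p.2, 0) + (p.1 - s) • ((θ, 0) : ℂ × Y))
    (s, 0) := by fun_prop
  filter_upwards [h2.eventually h1, hc.preimage_mem_nhds (χ'.open_target.mem_nhds (by
    rw [Prod.mk_zero_zero, sub_self, zero_smul, add_zero, add_zero]; exact χ'.map_source hx'))]
    with p ⟨⟨h3, h4⟩, h5⟩ h6 q hq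
  have hy := hF.invariant _ _ _ _ h4.2 hxS
  -- Moving the starting point by `p.2` moves the endpoint by `p.2` in `χ'`, by commutation. The
  -- remaining time `p.1 - s` is a translation along the slice of `χ'`.
  have h7 := hF.flowsTo_trans hy (h3 _ _ h4.2 h5.2) (hχ'.flowsTo_line h5.1 h6)
  rw [add_sub_cancel] at h7
  obtain rfl := hF.flowsTo_unique hy hq h7
  refine ⟨χ'.map_target h6, ?_⟩
  rw [χ'.right_inv h6]
  simp

omit [T2Space X] in
/-- The slice through `x` of the chart `c`. -/
def _root_.HamFol.slice (c : OpenPartialHomeomorph X (ℂ × Y)) (x : X) : Set X :=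
  {q | q ∈ c.source ∧ (c q).2 = (c x).2}

omit [T2Space X] in
theorem slice_subset (hF : IsStraightened Y F S) {c : OpenPartialHomeomorph X (ℂ × Y)}
    (hc : IsStraightening F c) {x : X} (hx : x ∈ c.source) (hxS : x ∈ S) : slice c x ⊆ S :=
  fun _ hq => hF.leaf_subset hxS (hc.mem_leaf hx hq.1 hq.2.symm)

/-- A time and a starting point on the slice form a point of a subset `D` of `ℝ × ℂ`. By
`eventually_slice` the endpoints for nearby data lie in one slice, and since `D` is Lindelöf,
countably many slices suffice. -/
theorem exists_countable_saturation (hF : IsStraightened Y F S)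
    {c : X → OpenPartialHomeomorph X (ℂ × Y)}
    (hc : ∀ x ∈ S, IsStraightening F (c x) ∧ x ∈ (c x).source) (θ : ℂ) {x : X} (hx : x ∈ S) :
    ∃ Q : Set X, Q.Countable ∧ Q ⊆ S ∧ ∀ p ∈ slice (c x) x, ∀ s q, FlowsTo (F θ) s p q →
      ∃ q₀ ∈ Q, q ∈ slice (c q₀) q₀ := by
  obtain ⟨hχ, hxχ⟩ := hc x hx
  set χ := c x
  set D : Set (ℝ × ℂ) := {d | (d.2, (χ x).2) ∈ χ.target ∧
    ∃ q, FlowsTo (F θ) d.1 (χ.symm (d.2, (χ x).2)) q}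
  have hD : ∀ d ∈ D, χ.symm (d.2, (χ x).2) ∈ S := fun d hd =>
    hF.slice_subset hχ hxχ hx ⟨χ.map_target hd.1, by rw [χ.right_inv hd.1]⟩
  have : Nonempty X := ⟨x⟩
  choose! f hf using fun (d : ℝ × ℂ) (hd : d ∈ D) => hd.2
  have hfS : ∀ d ∈ D, f d ∈ S := fun d hd => hF.invariant _ _ _ _ (hf d hd) (hD d hd)
  obtain ⟨t, htD, ht, hcov⟩ := TopologicalSpace.countable_cover_nhdsWithin
    (f := fun d => {d' : ℝ × ℂ | ∀ q, FlowsTo (F θ) d'.1 (χ.symm (d'.2, (χ x).2)) q →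
      q ∈ slice (c (f d)) (f d)}) (s := D) (by
    intro d hd
    refine mem_nhdsWithin_of_mem_nhds ?_
    have h1 := hF.eventually_slice hχ (hc _ (hfS d hd)).1 (hD d hd) (χ.map_target hd.1) (hf d hd)
      (hc _ (hfS d hd)).2
    rw [χ.right_inv hd.1] at h1
    have h2 : Filter.Tendsto (fun d' : ℝ × ℂ => (d'.1, d'.2 - d.2)) (𝓝 d) (𝓝 (d.1, 0)) := by
      have : Continuous fun d' : ℝ × ℂ => (d'.1, d'.2 - d.2) := by fun_prop
      simpa using this.tendsto d
    filter_upwards [h2.eventually h1] with d' hd' q hq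
    refine hd' q ?_
    simpa using hq)
  refine ⟨f '' t, ht.image f, ?_, fun p hp s q hq => ?_⟩
  · rintro _ ⟨d, hd, rfl⟩
    exact hfS d (htD hd)
  · have e : ((χ p).1, (χ x).2) = χ p := Prod.ext rfl hp.2.symm
    have hpD : (s, (χ p).1) ∈ D := by
      refine ⟨?_, q, ?_⟩
      · simp only [e]; exact χ.map_source hp.1
      · simp only [e]; rwa [χ.left_inv hp.1]
    obtain ⟨d, hd, hd'⟩ := mem_iUnion₂.1 (hcov hpD)
    refine ⟨f d, mem_image_of_mem f hd, hd' q ?_⟩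
    simp only [e]; rwa [χ.left_inv hp.1]

theorem exists_countable_cover_leaf (hF : IsStraightened Y F S)
    {c : X → OpenPartialHomeomorph X (ℂ × Y)}
    (hc : ∀ x ∈ S, IsStraightening F (c x) ∧ x ∈ (c x).source) {x₀ : X} (hx₀ : x₀ ∈ S) :
    ∃ Q : Set X, Q.Countable ∧ Q ⊆ S ∧
      ∀ q ∈ leaf (F 1) (F Complex.I) x₀, ∃ q₀ ∈ Q, q ∈ slice (c q₀) q₀ := by
  choose! Q hQ hQS hQs using fun (θ : ℂ) (x : X) (hx : x ∈ S) =>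
    hF.exists_countable_saturation hc θ hx
  -- Starting from `{x₀}`, the centres of all slices met by one further flow are adjoined. The union
  -- `R` of the countable stages is countable and closed under this operation, so its slices contain
  -- every point reached from `x₀`.
  set step : Set X → Set X := fun T => ⋃ x ∈ T, (Q 1 x ∪ Q Complex.I x)
  have hstep : ∀ n, (step^[n] {x₀}).Countable ∧ step^[n] {x₀} ⊆ S := by
    intro n
    induction n with
    | zero => simpa using hx₀
    | succ n ih =>
      rw [Function.iterate_succ_apply']
      exact ⟨ih.1.biUnion fun x hx => (hQ _ x (ih.2 hx)).union (hQ _ x (ih.2 hx)),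
        iUnion₂_subset fun x hx => union_subset (hQS _ x (ih.2 hx)) (hQS _ x (ih.2 hx))⟩
  set R : Set X := ⋃ n, step^[n] {x₀}
  have hRS : R ⊆ S := iUnion_subset fun n => (hstep n).2
  have hR : ∀ x ∈ R, Q 1 x ⊆ R ∧ Q Complex.I x ⊆ R := by
    intro x hx
    obtain ⟨n, hn⟩ := mem_iUnion.1 hx
    have : Q 1 x ∪ Q Complex.I x ⊆ R := by
      refine subset_trans ?_ (subset_iUnion _ (n + 1))
      rw [Function.iterate_succ_apply']
      exact subset_biUnion_of_mem (u := fun x => Q 1 x ∪ Q Complex.I x) hn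
    exact union_subset_iff.1 this
  refine ⟨R, countable_iUnion fun n => (hstep n).1, hRS, fun q hq => ?_⟩
  induction hq with
  | refl => exact ⟨x₀, mem_iUnion.2 ⟨0, rfl⟩, (hc x₀ hx₀).2, rfl⟩
  | tail _ h ih =>
    obtain ⟨s, t, z, h1, h2⟩ := h
    obtain ⟨q₀, hq₀, hq₀'⟩ := ih
    obtain ⟨q₁, hq₁, hq₁'⟩ := hQs _ q₀ (hRS hq₀) _ hq₀' _ _ h1
    have hq₁R := (hR q₀ hq₀).2 hq₁
    obtain ⟨q₂, hq₂, hq₂'⟩ := hQs _ q₁ (hRS hq₁R) _ hq₁' _ _ h2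
    exact ⟨q₂, (hR q₁ hq₁R).1 hq₂, hq₂'⟩

/-- Near a common point, displacement by `ζ` in either chart is the time-one flow of `F ζ`, so the
transverse coordinate of `χ` is locally constant along a slice of `c`. The relevant part of the
slice is a subset of `ℂ`, hence Lindelöf. -/
theorem countable_slice_image (hF : IsStraightened Y F S) {c χ : OpenPartialHomeomorph X (ℂ × Y)}
    (hc : IsStraightening F c) (hχ : IsStraightening F χ) {x : X} (hx : x ∈ c.source)
    (hxS : x ∈ S) : ((fun q => (χ q).2) '' (slice c x ∩ χ.source)).Countable := by
  set g : ℂ → X := fun ζ => c.symm (ζ, (c x).2)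
  set D : Set ℂ := {ζ | (ζ, (c x).2) ∈ c.target ∧ g ζ ∈ χ.source}
  obtain ⟨t, htD, ht, hcov⟩ := TopologicalSpace.countable_cover_nhdsWithin
    (f := fun ζ => {ζ' : ℂ | (χ (g ζ')).2 = (χ (g ζ)).2}) (s := D) (by
    intro ζ hζ
    refine mem_nhdsWithin_of_mem_nhds ?_
    have hgS : g ζ ∈ S :=
      hF.slice_subset hc hx hxS ⟨c.map_target hζ.1, by rw [c.right_inv hζ.1]⟩
    have h1 := (hc.eventually_flowsTo (c.map_target hζ.1)).and (hχ.eventually_flowsTo hζ.2)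
    have h2 : Filter.Tendsto (fun ζ' : ℂ => ζ' - ζ) (𝓝 ζ) (𝓝 0) := by
      have : Continuous fun ζ' : ℂ => ζ' - ζ := by fun_prop
      simpa using this.tendsto ζ
    filter_upwards [h2.eventually h1] with ζ' ⟨h3, h4⟩
    have h5 := hF.flowsTo_unique hgS h3.2 h4.2
    rw [c.right_inv hζ.1] at h5
    have h6 : g ζ' = χ.symm (χ (g ζ) + (ζ' - ζ, 0)) := by
      rw [← h5]; simp [g]
    change (χ (g ζ')).2 = (χ (g ζ)).2
    rw [h6, χ.right_inv h4.1]
    simp)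
  refine (ht.image fun ζ => (χ (g ζ)).2).mono ?_
  rintro _ ⟨q, ⟨hq, hqχ⟩, rfl⟩
  have e : g (c q).1 = q := by
    have : ((c q).1, (c x).2) = c q := Prod.ext rfl hq.2.symm
    simp only [g, this, c.left_inv hq.1]
  have hqD : (c q).1 ∈ D := by
    refine ⟨?_, e.symm ▸ hqχ⟩
    have : ((c q).1, (c x).2) = c q := Prod.ext rfl hq.2.symm
    rw [this]; exact c.map_source hq.1
  obtain ⟨ζ, hζ, hζ'⟩ := mem_iUnion₂.1 (hcov hqD)
  refine ⟨ζ, hζ, ?_⟩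
  have : (χ (g (c q).1)).2 = (χ (g ζ)).2 := hζ'
  rw [e] at this
  exact this.symm

/-- A leaf meets a straightening chart in countably many slices. -/
theorem countable_leaf_image (hF : IsStraightened Y F S) {χ : OpenPartialHomeomorph X (ℂ × Y)}
    (hχ : IsStraightening F χ) {x₀ : X} (hx₀ : x₀ ∈ S) :
    ((fun q => (χ q).2) '' (leaf (F 1) (F Complex.I) x₀ ∩ χ.source)).Countable := by
  have : Nonempty (OpenPartialHomeomorph X (ℂ × Y)) := ⟨χ⟩
  choose! c hc using hF.exists_chart
  obtain ⟨Q, hQ, hQS, hcov⟩ := hF.exists_countable_cover_leaf hc hx₀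
  refine (hQ.biUnion fun q hq => hF.countable_slice_image (hc q (hQS hq)).1 hχ (hc q (hQS hq)).2
    (hQS hq)).mono ?_
  rintro _ ⟨q, ⟨hq, hqχ⟩, rfl⟩
  obtain ⟨q₀, hq₀, hq₀'⟩ := hcov q hq
  exact mem_biUnion hq₀ ⟨q, ⟨hq₀', hqχ⟩, rfl⟩

end IsStraightened

end Leaves

/-- A linear splitting adapted to an injection `a` into the kernel of a surjection `l`. -/
theorem exists_splitting {𝕜 : Type*} [RCLike 𝕜] {E P Z : Type*} [NormedAddCommGroup E]
    [NormedSpace 𝕜 E] [FiniteDimensional 𝕜 E] [NormedAddCommGroup P] [NormedSpace 𝕜 P]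
    [FiniteDimensional 𝕜 P] [NormedAddCommGroup Z] [NormedSpace 𝕜 Z] [FiniteDimensional 𝕜 Z]
    (a : P →ₗ[𝕜] E) (l : E →ₗ[𝕜] P) (ha : Function.Injective a) (hl : Function.Surjective l)
    (hla : ∀ p, l (a p) = 0)
    (hdim : Module.finrank 𝕜 Z + 2 * Module.finrank 𝕜 P = Module.finrank 𝕜 E) :
    ∃ T : (P × Z × P) ≃L[𝕜] E, (∀ p, T (p, 0, 0) = a p) ∧ ∀ v, l (T v) = v.2.2 := by
  -- The third factor enters through a section `s` of `l`. The kernel of `l` splits into the image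
  -- of `a` and the kernel of a left inverse `r` of `a'`, and the latter is identified with `Z` by
  -- dimension.
  obtain ⟨s, hs⟩ := l.exists_rightInverse_of_surjective (LinearMap.range_eq_top.2 hl)
  set a' : P →ₗ[𝕜] LinearMap.ker l := a.codRestrict _ hla
  have ha' : Function.Injective a' := fun p q h => ha (congrArg Subtype.val h)
  obtain ⟨r, hr⟩ := a'.exists_leftInverse_of_injective (LinearMap.ker_eq_bot.2 ha')
  have hr' : ∀ p, r (a' p) = p := fun p => congrArg (fun f => f p) hr
  have hs' : ∀ p, l (s p) = p := fun p => congrArg (fun f => f p) hs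
  have hrs : Function.Surjective r := fun p => ⟨a' p, hr' p⟩
  have d1 := l.finrank_range_add_finrank_ker
  have d2 := r.finrank_range_add_finrank_ker
  rw [LinearMap.range_eq_top.2 hl, finrank_top] at d1
  rw [LinearMap.range_eq_top.2 hrs, finrank_top] at d2
  have hZ : Module.finrank 𝕜 Z = Module.finrank 𝕜 (LinearMap.ker r) := by omega
  set b := LinearEquiv.ofFinrankEq Z (LinearMap.ker r) hZ
  set b' : Z →ₗ[𝕜] E := (LinearMap.ker l).subtype ∘ₗ (LinearMap.ker r).subtype ∘ₗ b.toLinearMap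
  set T : (P × Z × P) →ₗ[𝕜] E := a.coprod (b'.coprod s)
  have hT : ∀ v, T v = a v.1 + (b' v.2.1 + s v.2.2) := fun v => rfl
  have hlT : ∀ v, l (T v) = v.2.2 := fun v => by
    have : l (b' v.2.1) = 0 := ((b v.2.1 : LinearMap.ker r) : LinearMap.ker l).2
    rw [hT, map_add, map_add, hla, this, hs', zero_add, zero_add]
  have hinj : Function.Injective T := by
    rw [← LinearMap.ker_eq_bot, LinearMap.ker_eq_bot']
    rintro ⟨p, z, c⟩ h
    have hc : c = 0 := by simpa [h] using (hlT (p, z, c)).symm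
    subst hc
    have h1 : a' p + (b z : LinearMap.ker l) = 0 := Subtype.ext (by
      have h3 : a p + b' z = 0 := by simpa [hT] using h
      exact h3)
    have h2 : r (b z : LinearMap.ker l) = 0 := (b z).2
    have hp : p = 0 := by
      have := congrArg r h1
      rwa [map_add, hr', h2, add_zero, map_zero] at this
    subst hp
    have hz : b z = 0 := Subtype.ext (by simpa using h1)
    rw [(map_eq_zero_iff b b.injective).1 hz]
    rfl
  refine ⟨(LinearEquiv.ofInjectiveOfFinrankEq T hinj ?_).toContinuousLinearEquiv, fun p => ?_, hlT⟩
  · rw [Module.finrank_prod, Module.finrank_prod]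
    omega
  · change T (p, 0, 0) = _
    simp [hT]

theorem _root_.HasMFDerivAt.restrictScalars {𝕜 E F : Type*} [RCLike 𝕜] [NormedAddCommGroup E]
    [NormedAddCommGroup F] [NormedSpace 𝕜 E] [NormedSpace 𝕜 F] [NormedSpace ℝ E] [NormedSpace ℝ F]
    [IsScalarTower ℝ 𝕜 E] [IsScalarTower ℝ 𝕜 F] {X Y : Type*} [TopologicalSpace X]
    [ChartedSpace E X] [TopologicalSpace Y] [ChartedSpace F Y] {f : X → Y} {x : X} {D : E →L[𝕜] F}
    (h : HasMFDerivAt 𝓘(𝕜, E) 𝓘(𝕜, F) f x D) :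
    HasMFDerivAt 𝓘(ℝ, E) 𝓘(ℝ, F) f x (D.restrictScalars ℝ) :=
  ⟨h.1, h.2.restrictScalars ℝ⟩

/-! ### Adapted charts on a manifold -/

section Adapted

universe u

variable {𝕜 : Type*} [RCLike 𝕜] [NormedSpace 𝕜 ℂ] {E : Type u} [NormedAddCommGroup E]
  [NormedSpace 𝕜 E] {X : Type*} [TopologicalSpace X] [ChartedSpace E X]
  {Z : Type*} [NormedAddCommGroup Z] [NormedSpace 𝕜 Z]

variable (𝕜) in
/-- A commuting family `A` of vector fields, and a map `h` to `ℂ` that is constant along them,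
both non-degenerate at the points of `S`. -/
structure IsIntegrable (n : ℕ∞ω) (A : X → ℂ →L[𝕜] E) (h : X → ℂ) (S : Set X) : Prop where
  exists_local : ∀ φ ∈ atlas E X, ∃ B : E → ℂ →L[𝕜] E, ContDiffOn 𝕜 n B φ.target ∧
    (∀ y ∈ φ.target, ∀ p, mfderiv 𝓘(𝕜, E) 𝓘(𝕜, E) φ.symm y (B y p) = A (φ.symm y) p) ∧
    ∀ y ∈ φ.target, ∀ p q, fderiv 𝕜 B y (B y p) q = fderiv 𝕜 B y (B y q) p
  contMDiff : ContMDiff 𝓘(𝕜, E) 𝓘(𝕜, ℂ) n h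
  mfderiv_apply : ∀ x p, mfderiv 𝓘(𝕜, E) 𝓘(𝕜, ℂ) h x (A x p) = (0 : ℂ)
  injective : ∀ x ∈ S, Function.Injective (A x)
  surjective : ∀ x ∈ S, Function.Surjective (mfderiv 𝓘(𝕜, E) 𝓘(𝕜, ℂ) h x)

variable (𝕜) in
/-- A chart in which `A` is constant and `h` is a coordinate. -/
structure IsAdapted (n : ℕ∞ω) (A : X → ℂ →L[𝕜] E) (h : X → ℂ)
    (χ : OpenPartialHomeomorph X (ℂ × Z × ℂ)) : Prop where
  contMDiffOn : ContMDiffOn 𝓘(𝕜, E) 𝓘(𝕜, ℂ × Z × ℂ) n χ χ.source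
  contMDiffOn_symm : ContMDiffOn 𝓘(𝕜, ℂ × Z × ℂ) 𝓘(𝕜, E) n χ.symm χ.target
  eq_snd_snd : ∀ x ∈ χ.source, h x = (χ x).2.2
  frame : ∀ w ∈ χ.target, ∀ p : ℂ,
    mfderiv 𝓘(𝕜, ℂ × Z × ℂ) 𝓘(𝕜, E) χ.symm w ((p, 0, 0) : ℂ × Z × ℂ) = A (χ.symm w) p
  target_eq : ∃ (c : ℂ) (r : ℝ) (T : Set (Z × ℂ)), χ.target = box c r ×ˢ T

theorem exists_box_subset {Y : Type*} [TopologicalSpace Y] {w : ℂ × Y} {U : Set (ℂ × Y)}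
    (hU : U ∈ 𝓝 w) : ∃ (r : ℝ) (T : Set Y), 0 < r ∧ IsOpen T ∧ w.2 ∈ T ∧ box w.1 r ×ˢ T ⊆ U := by
  obtain ⟨V, hV, T, hT, hVT⟩ := mem_nhds_prod_iff.1 hU
  obtain ⟨T', hT', hT'o, hwT'⟩ := mem_nhds_iff.1 hT
  obtain ⟨r, hr, hrV⟩ := Metric.mem_nhds_iff.1 hV
  refine ⟨r / 2, T', by positivity, hT'o, hwT', (prod_mono ?_ hT').trans hVT⟩
  rintro ζ ⟨h1, h2⟩
  refine hrV ?_
  rw [Metric.mem_ball, dist_eq_norm]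
  refine (Complex.norm_le_abs_re_add_abs_im _).trans_lt ?_
  have e1 : |(ζ - w.1).re| < r / 2 := by
    rw [abs_lt, Complex.sub_re]; constructor <;> linarith [h1.1, h1.2]
  have e2 : |(ζ - w.1).im| < r / 2 := by
    rw [abs_lt, Complex.sub_im]; constructor <;> linarith [h2.1, h2.2]
  linarith

theorem mem_box_self (c : ℂ) {r : ℝ} (hr : 0 < r) : c ∈ box c r :=
  ⟨⟨by linarith, by linarith⟩, ⟨by linarith, by linarith⟩⟩

variable [FiniteDimensional 𝕜 E] [FiniteDimensional 𝕜 ℂ] [FiniteDimensional 𝕜 Z]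
  [NormedSpace ℝ E] [IsScalarTower ℝ 𝕜 E]

/-- The normal form in the vector space is applied in the chart at `x₀`, and the target is then cut
down to a box times an open set, so that its slices are convex. -/
theorem IsIntegrable.exists_isAdapted {n : ℕ∞ω} (hn : n = ∞ ∨ n = ω) [IsManifold 𝓘(𝕜, E) n X]
    {A : X → ℂ →L[𝕜] E} {h : X → ℂ} {S : Set X} (hA : IsIntegrable 𝕜 n A h S)
    (hdim : Module.finrank 𝕜 Z + 2 * Module.finrank 𝕜 ℂ = Module.finrank 𝕜 E) {x₀ : X}
    (hx₀ : x₀ ∈ S) :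
    ∃ χ : OpenPartialHomeomorph X (ℂ × Z × ℂ), IsAdapted 𝕜 n A h χ ∧ x₀ ∈ χ.source := by
  have : CompleteSpace E := FiniteDimensional.complete 𝕜 E
  have hn1 : 1 ≤ n := by rcases hn with rfl | rfl <;> simp
  have hn0 : n ≠ 0 := fun h => by simp [h] at hn1
  have : IsManifold 𝓘(𝕜, E) 1 X := IsManifold.of_le hn1
  set φ := chartAt E x₀
  have hφ : φ ∈ atlas E X := chart_mem_atlas E x₀
  have hφd := mdifferentiable_of_mem_atlas (I := 𝓘(𝕜, E)) hφ
  obtain ⟨B, hB, hBA, hBc⟩ := hA.exists_local φ hφ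
  have hφs : ContMDiffOn 𝓘(𝕜, E) 𝓘(𝕜, E) n φ.symm φ.target := contMDiffOn_chart_symm
  have hφc : ContMDiffOn 𝓘(𝕜, E) 𝓘(𝕜, E) n φ φ.source := contMDiffOn_chart
  have hh : ContDiffOn 𝕜 n (h ∘ φ.symm) φ.target :=
    contMDiffOn_iff_contDiffOn.1 (hA.contMDiff.comp_contMDiffOn hφs)
  have hd : ∀ y ∈ φ.target, ∀ v : E, fderiv 𝕜 (h ∘ φ.symm) y v =
      mfderiv 𝓘(𝕜, E) 𝓘(𝕜, ℂ) h (φ.symm y) (mfderiv 𝓘(𝕜, E) 𝓘(𝕜, E) φ.symm y v) := by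
    intro y hy v
    have h1 := (hA.contMDiff (φ.symm y)).mdifferentiableAt hn0
    have h2 := hφd.symm.mdifferentiableAt (x := y) hy
    rw [← mfderiv_eq_fderiv, mfderiv_comp y h1 h2]
    rfl
  have hy₀ : φ x₀ ∈ φ.target := φ.map_source (mem_chart_source E x₀)
  have hx : φ.symm (φ x₀) = x₀ := φ.left_inv (mem_chart_source E x₀)
  obtain ⟨T, hTa, hTl⟩ := exists_splitting (𝕜 := 𝕜) (P := ℂ) (Z := Z) (B (φ x₀)).toLinearMap
    (fderiv 𝕜 (h ∘ φ.symm) (φ x₀)).toLinearMap (fun p q hpq => by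
      refine hA.injective x₀ hx₀ ?_
      have h1 := hBA _ hy₀ p
      have h2 := hBA _ hy₀ q
      rw [hx] at h1 h2
      rw [← h1, ← h2]
      exact congrArg _ hpq) (fun c => by
      obtain ⟨v, hv⟩ := hA.surjective x₀ hx₀ c
      obtain ⟨u, hu⟩ := hφd.symm.mfderiv_surjective (x := φ x₀) hy₀ (hx.symm ▸ v)
      refine ⟨u, ?_⟩
      have h1 := hd _ hy₀ u
      refine h1.trans ?_
      rw [hu]
      have key : ∀ {x' : X} (hx' : x' = x₀), mfderiv 𝓘(𝕜, E) 𝓘(𝕜, ℂ) h x' (hx'.symm ▸ v) = c := by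
        rintro _ rfl
        exact hv
      exact key hx) (fun p => by
      have h1 := hd _ hy₀ (B (φ x₀) p)
      rw [hBA _ hy₀] at h1
      exact h1.trans (hA.mfderiv_apply _ _)) hdim
  obtain ⟨ψ, hxψ, hψU, hψ, hψs, hψh, hψA⟩ := exists_normalForm hn φ.open_target hB hBc hh
    (fun y hy p => by
      have h1 := hd _ hy (B y p)
      rw [hBA _ hy] at h1
      exact h1.trans (hA.mfderiv_apply _ _)) hy₀ T hTa hTl
  set χ₀ := φ.trans ψ
  have hx₀χ : x₀ ∈ χ₀.source := by
    rw [OpenPartialHomeomorph.trans_source]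
    exact ⟨mem_chart_source E x₀, hxψ⟩
  obtain ⟨r, T', hr, hT'o, hwT', hsub⟩ := exists_box_subset
    (χ₀.open_target.mem_nhds (χ₀.map_source hx₀χ))
  have hBo : IsOpen (box (χ₀ x₀).1 r ×ˢ T') := (isOpen_box _ _).prod hT'o
  -- Restricting the inverse chart prescribes the target rather than the source.
  set χ := (χ₀.symm.restrOpen _ hBo).symm
  have hχs : χ.source ⊆ χ₀.source := by
    intro x hx
    have := χ.map_source hx
    have h2 := (χ₀.symm.restrOpen _ hBo).map_source (x := χ x) this
    have h3 : (χ₀.symm.restrOpen _ hBo) (χ x) = x := χ.left_inv hx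
    rw [h3] at h2
    exact h2.1
  have hχt : χ.target = box (χ₀ x₀).1 r ×ˢ T' := inter_eq_right.2 hsub
  have hχt₀ : ∀ w ∈ χ.target, w ∈ χ₀.target := fun w hw => hw.1
  have hψt : ∀ w ∈ χ₀.target, w ∈ ψ.target ∧ ψ.symm w ∈ φ.target := fun w hw => by
    rwa [OpenPartialHomeomorph.trans_target] at hw
  have hχ₀s : ∀ x ∈ χ₀.source, x ∈ φ.source ∧ φ x ∈ ψ.source := fun x hx => by
    rwa [OpenPartialHomeomorph.trans_source] at hx
  refine ⟨χ, ⟨?_, ?_, ?_, ?_, ⟨_, _, _, hχt⟩⟩, ?_⟩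
  · exact (contMDiffOn_iff_contDiffOn.2 hψ).comp (hφc.mono fun x hx => (hχ₀s x (hχs hx)).1)
      fun x hx => (hχ₀s x (hχs hx)).2
  · exact hφs.comp ((contMDiffOn_iff_contDiffOn.2 hψs).mono fun w hw => (hψt w (hχt₀ w hw)).1)
      fun w hw => (hψt w (hχt₀ w hw)).2
  · intro x hx
    obtain ⟨h1, h2⟩ := hχ₀s x (hχs hx)
    have := hψh _ h2
    rwa [Function.comp_apply, φ.left_inv h1] at this
  · intro w hw p
    obtain ⟨h1, h2⟩ := hψt w (hχt₀ w hw)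
    have d1 := hφd.symm.mdifferentiableAt (x := ψ.symm w) h2
    have d2 : DifferentiableAt 𝕜 ψ.symm w :=
      (hψs.contDiffAt (ψ.open_target.mem_nhds h1)).differentiableAt hn0
    have h3 : mfderiv 𝓘(𝕜, ℂ × Z × ℂ) 𝓘(𝕜, E) (φ.symm ∘ ψ.symm) w = _ :=
      mfderiv_comp w d1 d2.mdifferentiableAt
    change mfderiv 𝓘(𝕜, ℂ × Z × ℂ) 𝓘(𝕜, E) (φ.symm ∘ ψ.symm) w _ = _
    rw [h3]
    have h4 := hψA w h1 p
    rw [← mfderiv_eq_fderiv] at h4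
    have h5 := hBA _ h2 p
    exact (congrArg _ h4).trans h5
  · have h := (χ₀.symm.restrOpen _ hBo).map_source (x := χ₀ x₀) ⟨χ₀.map_source hx₀χ,
      mem_box_self _ hr, hwT'⟩
    have h3 : (χ₀.symm.restrOpen _ hBo) (χ₀ x₀) = x₀ := χ₀.left_inv hx₀χ
    rw [h3] at h
    exact h

end Adapted

/-! ### Hamiltonian vector fields in charts -/

section HamiltonianFrames

variable {𝕜 : Type*} [RCLike 𝕜] {E : Type*} [NormedAddCommGroup E] [NormedSpace 𝕜 E]
  {X : Type*} [TopologicalSpace X] [ChartedSpace E X]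

theorem TwoForm.inChart_apply (Ω : TwoForm 𝕜 E X) (φ : OpenPartialHomeomorph X E) (y v w : E) :
    Ω.inChart φ y ![v, w] = Ω (φ.symm y) ![mfderiv 𝓘(𝕜, E) 𝓘(𝕜, E) φ.symm y v,
      mfderiv 𝓘(𝕜, E) 𝓘(𝕜, E) φ.symm y w] := by
  change Ω (φ.symm y) _ = _
  congr 1
  ext i
  fin_cases i <;> rfl

theorem TwoForm.IsNondegenerate.inChart [IsManifold 𝓘(𝕜, E) 1 X] {Ω : TwoForm 𝕜 E X}
    (hΩ : Ω.IsNondegenerate) {φ : OpenPartialHomeomorph X E} (hφ : φ ∈ atlas E X) {y : E}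
    (hy : y ∈ φ.target) {v : E} (hv : v ≠ 0) : ∃ w, Ω.inChart φ y ![v, w] ≠ 0 := by
  have hφd := mdifferentiable_of_mem_atlas (I := 𝓘(𝕜, E)) hφ
  obtain ⟨w, hw⟩ := hΩ (φ.symm y) (mfderiv 𝓘(𝕜, E) 𝓘(𝕜, E) φ.symm y v) fun h =>
    hv (hφd.symm.mfderiv_injective (x := y) hy (h.trans (map_zero _).symm))
  obtain ⟨u, rfl⟩ := hφd.symm.mfderiv_surjective (x := y) hy w
  exact ⟨u, fun h => hw ((TwoForm.inChart_apply Ω φ y v u).symm.trans h)⟩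

theorem fderiv_comp_chart_symm [IsManifold 𝓘(𝕜, E) 1 X] {F : Type*} [NormedAddCommGroup F]
    [NormedSpace 𝕜 F] {h : X → F} {φ : OpenPartialHomeomorph X E} (hφ : φ ∈ atlas E X) {y : E}
    (hy : y ∈ φ.target) (hh : MDifferentiableAt 𝓘(𝕜, E) 𝓘(𝕜, F) h (φ.symm y)) (v : E) :
    fderiv 𝕜 (h ∘ φ.symm) y v =
      mfderiv 𝓘(𝕜, E) 𝓘(𝕜, F) h (φ.symm y) (mfderiv 𝓘(𝕜, E) 𝓘(𝕜, E) φ.symm y v) := by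
  have h2 := (mdifferentiable_of_mem_atlas (I := 𝓘(𝕜, E)) hφ).symm.mdifferentiableAt (x := y) hy
  rw [← mfderiv_eq_fderiv, mfderiv_comp y hh h2]
  rfl

theorem contDiffOn_comp_chart_symm {n : ℕ∞ω} [IsManifold 𝓘(𝕜, E) n X] {F : Type*}
    [NormedAddCommGroup F] [NormedSpace 𝕜 F] {h : X → F} (hh : ContMDiff 𝓘(𝕜, E) 𝓘(𝕜, F) n h)
    {φ : OpenPartialHomeomorph X E} (hφ : φ ∈ atlas E X) :
    ContDiffOn 𝕜 n (h ∘ φ.symm) φ.target :=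
  contMDiffOn_iff_contDiffOn.1 (hh.comp_contMDiffOn
    (contMDiffOn_symm_of_mem_maximalAtlas (IsManifold.subset_maximalAtlas hφ)))

/-- The Hamiltonian vector field is of class `C^n` in charts. -/
theorem exists_hamVF_inChart [FiniteDimensional 𝕜 E] {n : ℕ∞ω} (hn : n = ∞ ∨ n = ω)
    [IsManifold 𝓘(𝕜, E) n X] {Ω : TwoForm 𝕜 E X} (hΩ : Ω.IsRegular n) (hnd : Ω.IsNondegenerate)
    {h : X → 𝕜} (hh : ContMDiff 𝓘(𝕜, E) 𝓘(𝕜, 𝕜) n h) {φ : OpenPartialHomeomorph X E}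
    (hφ : φ ∈ atlas E X) :
    ∃ v : E → E, ContDiffOn 𝕜 n v φ.target ∧
      (∀ y ∈ φ.target, mfderiv 𝓘(𝕜, E) 𝓘(𝕜, E) φ.symm y (v y) = hamVF Ω h (φ.symm y)) ∧
      ∀ y ∈ φ.target, ∀ u, Ω.inChart φ y ![v y, u] = -fderiv 𝕜 (h ∘ φ.symm) y u := by
  have hn1 : 1 ≤ n := by rcases hn with rfl | rfl <;> simp
  have hn0 : n ≠ 0 := fun h => by simp [h] at hn1
  have : IsManifold 𝓘(𝕜, E) 1 X := IsManifold.of_le hn1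
  obtain ⟨v, hv, hvh⟩ := exists_contDiffOn_hamiltonian hn φ.open_target (hΩ φ hφ)
    (fun y hy v hv => hnd.inChart hφ hy hv) (contDiffOn_comp_chart_symm hh hφ)
  refine ⟨v, hv, fun y hy => eq_hamVF hnd h _ _ fun w => ?_, hvh⟩
  obtain ⟨u, rfl⟩ := (mdifferentiable_of_mem_atlas (I := 𝓘(𝕜, E)) hφ).symm.mfderiv_surjective
    (x := y) hy w
  refine (TwoForm.inChart_apply Ω φ y (v y) u).symm.trans ((hvh y hy u).trans ?_)
  exact congrArg Neg.neg (fderiv_comp_chart_symm hφ hy ((hh _).mdifferentiableAt hn0) u)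

end HamiltonianFrames

/-! ### Integrability of holomorphic Hamiltonian systems -/

section Holomorphic

variable {E : Type*} [NormedAddCommGroup E] [NormedSpace ℂ E]
  {X : Type*} [TopologicalSpace X] [ChartedSpace E X]

/-- The family `p ↦ p X_H`. -/
noncomputable def holFrame (Ω : TwoForm ℂ E X) (H : X → ℂ) (x : X) : ℂ →L[ℂ] E :=
  (ContinuousLinearMap.id ℂ ℂ).smulRight (hamVF Ω H x : E)

/-- For `B p = p v` both sides of the commutation relation equal `p q Dv(v)`, by complex linearity.
Constancy of `H` is `Ω(X_H, X_H) = 0`, and regularity of the value gives `X_H ≠ 0` through `dH =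
-Ω(X_H, ·)`. -/
theorem IsHHS.isIntegrable [FiniteDimensional ℂ E] [IsManifold 𝓘(ℂ, E) ω X] {Ω : TwoForm ℂ E X}
    {H : X → ℂ} (h : IsHHS Ω H) {e : ℂ} (he : IsRegularValue ℂ E H e) :
    IsIntegrable ℂ ω (holFrame Ω H) H (H ⁻¹' {e}) := by
  have hsurj : ∀ x, H x = e → ∃ w, (mfderiv 𝓘(ℂ, E) 𝓘(ℂ, ℂ) H x w : ℂ) ≠ 0 := by
    intro x hx
    by_contra! hw
    exact he x hx (ContinuousLinearMap.ext hw)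
  refine ⟨fun φ hφ => ?_, h.holomorphic, fun x p => ?_, fun x hx p q hpq => ?_, fun x hx (c : ℂ) => ?_⟩
  · obtain ⟨v, hv, hvV, -⟩ := exists_hamVF_inChart (Or.inr rfl) h.holomorphic_form h.nondegenerate
      h.holomorphic hφ
    have hB : ContDiffOn ℂ ω (fun y => (ContinuousLinearMap.id ℂ ℂ).smulRight (v y)) φ.target := by
      rw [contDiffOn_clm_apply]
      exact fun p => contDiffOn_const.smul hv
    refine ⟨_, hB, fun y hy p => ?_, fun y hy p q => ?_⟩
    · refine ((mfderiv 𝓘(ℂ, E) 𝓘(ℂ, E) φ.symm y).map_smul p (v y)).trans ?_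
      rw [hvV y hy]
      rfl
    · have hvd := ((hv.contDiffAt (φ.open_target.mem_nhds hy)).differentiableAt
        (by simp)).hasFDerivAt
      have hBd := ((hB.contDiffAt (φ.open_target.mem_nhds hy)).differentiableAt
        (by simp)).hasFDerivAt
      have key : ∀ (a : E) (q : ℂ), fderiv ℂ (fun y => (ContinuousLinearMap.id ℂ ℂ).smulRight (v y))
          y a q = q • fderiv ℂ v y a := by
        intro a q
        have h1 := hBd.clm_apply (hasFDerivAt_const q y)
        have h2 := h1.unique (hvd.const_smul q)
        simpa using congrArg (fun l : E →L[ℂ] E => l a) h2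
      rw [key, key]
      simp only [ContinuousLinearMap.smulRight_apply, map_smul, ContinuousLinearMap.id_apply]
      exact smul_comm _ _ _
  · have h1 := hamVF_spec h.nondegenerate H x (hamVF Ω H x)
    rw [apply_self_eq_zero] at h1
    have h2 := (mfderiv 𝓘(ℂ, E) 𝓘(ℂ, ℂ) H x).map_smul p (hamVF Ω H x)
    refine h2.trans ?_
    rw [neg_eq_zero.1 h1.symm]
    exact smul_zero p
  · have hne : (hamVF Ω H x : E) ≠ 0 := by
      intro h0
      obtain ⟨w, hw⟩ := hsurj x hx
      have h1 := hamVF_spec h.nondegenerate H x w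
      have h3 : Ω.contract x (hamVF Ω H x) w = 0 := by
        rw [show hamVF Ω H x = 0 from h0, map_zero]
        rfl
      exact hw (neg_eq_zero.1 (h1.symm.trans h3))
    exact smul_left_injective ℂ hne hpq
  · obtain ⟨w, hw⟩ := hsurj x hx
    refine ⟨((c : ℂ) / (show ℂ from mfderiv 𝓘(ℂ, E) 𝓘(ℂ, ℂ) H x w)) • w, ?_⟩
    exact ((mfderiv 𝓘(ℂ, E) 𝓘(ℂ, ℂ) H x).map_smul _ w).trans (div_mul_cancel₀ c hw)

end Holomorphic

/-! ### Integrability of pseudo-holomorphic Hamiltonian systems -/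

section PseudoHolomorphic

variable {E : Type*} [NormedAddCommGroup E] [NormedSpace ℝ E]
  {X : Type*} [TopologicalSpace X] [ChartedSpace E X]

/-- The family `p ↦ (re p) V + (im p) W`. -/
noncomputable def frameOf (V W : VField ℝ E X) (x : X) : ℂ →L[ℝ] E :=
  Complex.reCLM.smulRight (V x : E) + Complex.imCLM.smulRight (W x : E)

theorem frameOf_apply (V W : VField ℝ E X) (x : X) (p : ℂ) :
    frameOf V W x p = p.re • (V x : E) + p.im • (W x : E) := rfl

theorem contract_zero (Ω : TwoForm ℝ E X) (x : X) (w : TangentSpace 𝓘(ℝ, E) x) :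
    Ω x ![0, w] = 0 := congrArg (fun f => f w) (map_zero (Ω.contract x))

variable [IsManifold 𝓘(ℝ, E) ∞ X] {J : EndField E X} {ΩR : TwoForm ℝ E X} {HR HI : X → ℝ}

/-- Anticompatibility for the pair `v`, `J w`, combined with `J² = -1`. -/
theorem IsPHHS.apply_J_swap (h : IsPHHS J ΩR HR HI) (x : X) (v w : TangentSpace 𝓘(ℝ, E) x) :
    ΩR x ![J x v, w] = ΩR x ![v, J x w] := by
  have h1 := h.anticompatible x v (J x w)
  have h2 : ΩR.contract x (J x v) (-w) = -ΩR.contract x (J x v) w := map_neg _ w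
  rw [h.almostComplex.sq_eq] at h1
  have h3 := h2.symm.trans h1
  exact neg_injective h3

/-- By the previous identity `Ω_R(·, J ·)` is antisymmetric as well as symmetric on the pair `v, v`.
For `v = X_{H_R}` this is the involution of `H_R` and `H_I`. -/
theorem IsPHHS.apply_V_W (h : IsPHHS J ΩR HR HI) (x : X) (v : TangentSpace 𝓘(ℝ, E) x) :
    ΩR x ![v, J x v] = 0 := by
  have h1 := h.apply_J_swap x v v
  rw [apply_swap] at h1
  linarith

theorem IsPHHS.applyJ_eq [FiniteDimensional ℝ E] (h : IsPHHS J ΩR HR HI) (x : X) :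
    J x (hamVF ΩR HR x) = -hamVF ΩR HI x := by
  have h1 : -J x (hamVF ΩR HR x) = hamVF ΩR HI x := by
    refine eq_hamVF h.nondegenerate HI x _ fun w => ?_
    rw [h.primitive]
    exact congrArg (fun f => f w) (map_neg (ΩR.contract x) (J x (hamVF ΩR HR x)))
  rw [← h1, neg_neg]

theorem complexHam_eq {X : Type*} (HR HI : X → ℝ) : complexHam HR HI =
    fun x => Complex.equivRealProdCLM.symm (HR x, HI x) := by
  funext x
  exact (Complex.equivRealProdCLM_symm_apply (HR x, HI x)).symm ▸ by
    simp [complexHam, Complex.ext_iff]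

theorem IsPHHS.contMDiff_complexHam (h : IsPHHS J ΩR HR HI) :
    ContMDiff 𝓘(ℝ, E) 𝓘(ℝ, ℂ) ∞ (complexHam HR HI) := by
  rw [complexHam_eq]
  exact (Complex.equivRealProdCLM.symm.contDiff.contMDiff).comp
    (h.smooth_re.prodMk_space h.smooth_im)

theorem IsPHHS.mfderiv_complexHam (h : IsPHHS J ΩR HR HI) (x : X) (v : TangentSpace 𝓘(ℝ, E) x) :
    (mfderiv 𝓘(ℝ, E) 𝓘(ℝ, ℂ) (complexHam HR HI) x v : ℂ) =
      ⟨(mfderiv 𝓘(ℝ, E) 𝓘(ℝ, ℝ) HR x v : ℝ), (mfderiv 𝓘(ℝ, E) 𝓘(ℝ, ℝ) HI x v : ℝ)⟩ := by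
  have d := (h.contMDiff_complexHam x).mdifferentiableAt (by simp)
  have h1 : mfderiv 𝓘(ℝ, E) 𝓘(ℝ, ℝ) (Complex.reCLM ∘ complexHam HR HI) x = _ :=
    mfderiv_comp x Complex.reCLM.differentiableAt.mdifferentiableAt d
  have h2 : mfderiv 𝓘(ℝ, E) 𝓘(ℝ, ℝ) (Complex.imCLM ∘ complexHam HR HI) x = _ :=
    mfderiv_comp x Complex.imCLM.differentiableAt.mdifferentiableAt d
  rw [ContinuousLinearMap.mfderiv_eq] at h1 h2
  apply Complex.ext
  · exact (congrArg (fun f => f v) h1).symm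
  · exact (congrArg (fun f => f v) h2).symm

theorem IsPHHS.mfderiv_complexHam' [FiniteDimensional ℝ E] (h : IsPHHS J ΩR HR HI) (x : X)
    (v : TangentSpace 𝓘(ℝ, E) x) :
    (mfderiv 𝓘(ℝ, E) 𝓘(ℝ, ℂ) (complexHam HR HI) x v : ℂ) =
      ⟨-ΩR x ![hamVF ΩR HR x, v], ΩR x ![J x (hamVF ΩR HR x), v]⟩ := by
  refine (h.mfderiv_complexHam x v).trans ?_
  apply Complex.ext
  · exact (neg_eq_iff_eq_neg.2 (hamVF_spec h.nondegenerate HR x v)).symm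
  · exact h.primitive x v

/-- `dH ∘ J = i dH`. -/
theorem IsPHHS.mfderiv_complexHam_J [FiniteDimensional ℝ E] (h : IsPHHS J ΩR HR HI) (x : X)
    (v : TangentSpace 𝓘(ℝ, E) x) :
    (mfderiv 𝓘(ℝ, E) 𝓘(ℝ, ℂ) (complexHam HR HI) x (J x v) : ℂ) =
      Complex.I * (show ℂ from mfderiv 𝓘(ℝ, E) 𝓘(ℝ, ℂ) (complexHam HR HI) x v) := by
  refine (h.mfderiv_complexHam' x (J x v)).trans ?_
  rw [h.mfderiv_complexHam', h.anticompatible, ← h.apply_J_swap]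
  apply Complex.ext <;> simp

/-- The family spanned by `X_{H_R}` and `J X_{H_R}`. -/
noncomputable abbrev pseudoFrame (J : EndField E X) (ΩR : TwoForm ℝ E X) (HR : X → ℝ) :
    X → ℂ →L[ℝ] E := frameOf (hamVF ΩR HR) (applyJ J (hamVF ΩR HR))

/-- `p ↦ (re p) X_{H_R} + (im p) J X_{H_R}` is complex linear. -/
theorem IsPHHS.J_pseudoFrame (h : IsPHHS J ΩR HR HI) (x : X) (p : ℂ) :
    J x (pseudoFrame J ΩR HR x p) = pseudoFrame J ΩR HR x (Complex.I * p) := by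
  have h1 := (J x).map_add (p.re • hamVF ΩR HR x) (p.im • applyJ J (hamVF ΩR HR) x)
  have h2 := (J x).map_smul p.re (hamVF ΩR HR x)
  have h3 := (J x).map_smul p.im (applyJ J (hamVF ΩR HR) x)
  have h4 : J x (applyJ J (hamVF ΩR HR) x) = -hamVF ΩR HR x := h.almostComplex.sq_eq x _
  refine h1.trans ?_
  rw [h2, h3, h4, frameOf_apply]
  simp only [Complex.mul_re, Complex.I_re, Complex.I_im, Complex.mul_im, zero_mul, one_mul,
    zero_sub, zero_add, smul_neg, neg_smul]
  exact add_comm _ _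

/-- Since `J X_{H_R} = -X_{H_I}`, the family is spanned by Hamiltonian fields of two functions in
involution, which commute by `fderiv_hamiltonian_comm`. Injectivity and surjectivity reduce to
`X_{H_R} ≠ 0` and `dH ≠ 0` because the frame and `dH` are complex linear with respect to `J`. -/
theorem IsPHHS.isIntegrable [FiniteDimensional ℝ E] (h : IsPHHS J ΩR HR HI) {e : ℂ}
    (he : IsRegularValue ℝ E (complexHam HR HI) e) :
    IsIntegrable ℝ ∞ (pseudoFrame J ΩR HR) (complexHam HR HI) (complexHam HR HI ⁻¹' {e}) := by
  have hsurj : ∀ x, complexHam HR HI x = e →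
      ∃ w, (mfderiv 𝓘(ℝ, E) 𝓘(ℝ, ℂ) (complexHam HR HI) x w : ℂ) ≠ 0 := by
    intro x hx
    by_contra! hw
    exact he x hx (ContinuousLinearMap.ext hw)
  refine ⟨fun φ hφ => ?_, h.contMDiff_complexHam, fun x p => ?_, fun x hx => ?_, fun x hx (c : ℂ) => ?_⟩
  · have : IsManifold 𝓘(ℝ, E) 1 X := IsManifold.of_le (n := ∞) (by simp)
    obtain ⟨v, hv, hvV, hvf⟩ := exists_hamVF_inChart (Or.inl rfl) h.smooth_form h.nondegenerate
      h.smooth_re hφ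
    obtain ⟨w, hw, hwW, hwf⟩ := exists_hamVF_inChart (Or.inl rfl) h.smooth_form h.nondegenerate
      h.smooth_im hφ
    have hB : ContDiffOn ℝ ∞ (fun y => Complex.reCLM.smulRight (v y) +
        Complex.imCLM.smulRight (-w y)) φ.target := by
      rw [contDiffOn_clm_apply]
      exact fun p => (contDiffOn_const.smul hv).add (contDiffOn_const.smul hw.neg)
    refine ⟨_, hB, fun y hy p => ?_, fun y hy p q => ?_⟩
    · set D : E →L[ℝ] E := mfderiv 𝓘(ℝ, E) 𝓘(ℝ, E) φ.symm y
      have e1 : D (v y) = hamVF ΩR HR (φ.symm y) := hvV y hy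
      have e2 : D (w y) = hamVF ΩR HI (φ.symm y) := hwW y hy
      have e3 : applyJ J (hamVF ΩR HR) (φ.symm y) = -hamVF ΩR HI (φ.symm y) := h.applyJ_eq _
      rw [frameOf_apply]
      change D (p.re • v y + p.im • -w y) = _
      rw [map_add, map_smul, map_smul, map_neg, e1, e2, e3]
      rfl
    · have hy' := φ.open_target.mem_nhds hy
      have hvd := ((hv.contDiffAt hy').differentiableAt (by simp)).hasFDerivAt
      have hwd := ((hw.contDiffAt hy').differentiableAt (by simp)).hasFDerivAt
      have hBd := ((hB.contDiffAt hy').differentiableAt (by simp)).hasFDerivAt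
      have h2 : (2 : ℕ∞ω) ≤ ∞ := WithTop.coe_le_coe.2 le_top
      have hc := fderiv_hamiltonian_comm φ.open_target ((h.smooth_form φ hφ).of_le h2)
        (fun y hy v hv => h.nondegenerate.inChart hφ hy hv) (h.closed φ hφ)
        ((contDiffOn_comp_chart_symm h.smooth_re hφ).of_le h2)
        ((contDiffOn_comp_chart_symm h.smooth_im hφ).of_le h2) (hv.of_le h2) (hw.of_le h2) hvf hwf
        (fun y hy => by
          refine (TwoForm.inChart_apply ΩR φ y (v y) (w y)).trans ?_
          rw [hvV y hy, hwW y hy, ← neg_neg (hamVF ΩR HI _), ← h.applyJ_eq]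
          have h1 := map_neg (ΩR.contract (φ.symm y) (hamVF ΩR HR (φ.symm y)))
            (J _ (hamVF ΩR HR (φ.symm y)))
          exact h1.trans (neg_eq_zero.2 (h.apply_V_W _ _))) hy
      have key : ∀ (a : E) (q : ℂ), fderiv ℝ (fun y => Complex.reCLM.smulRight (v y) +
          Complex.imCLM.smulRight (-w y)) y a q =
          q.re • fderiv ℝ v y a - q.im • fderiv ℝ w y a := by
        intro a q
        have h1 := hBd.clm_apply (hasFDerivAt_const q y)
        have h2 := h1.unique ((hvd.const_smul q.re).add (hwd.neg.const_smul q.im))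
        simpa [sub_eq_add_neg] using congrArg (fun l : E →L[ℝ] E => l a) h2
      have e1 : ∀ p : ℂ, (Complex.reCLM.smulRight (v y) + Complex.imCLM.smulRight (-w y)) p =
        p.re • v y + p.im • -w y := fun p => rfl
      rw [key, key]
      simp only [e1, map_add, map_smul, map_neg, hc]
      module
  · have h1 : ∀ u, ΩR x ![hamVF ΩR HR x, u] = 0 → ΩR x ![J x (hamVF ΩR HR x), u] = 0 →
        (mfderiv 𝓘(ℝ, E) 𝓘(ℝ, ℂ) (complexHam HR HI) x u : ℂ) = 0 := fun u h1 h2 => by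
      rw [h.mfderiv_complexHam', h1, h2, neg_zero]
      rfl
    have e1 := h1 (hamVF ΩR HR x) (apply_self_eq_zero _ _) (by
      rw [apply_swap, h.apply_V_W, neg_zero])
    have e2 := h1 (J x (hamVF ΩR HR x)) (h.apply_V_W _ _) (apply_self_eq_zero _ _)
    clear h1
    set D : E →L[ℝ] ℂ := mfderiv 𝓘(ℝ, E) 𝓘(ℝ, ℂ) (complexHam HR HI) x
    have key : ∀ V W : E, D V = 0 → D W = 0 → D (p.re • V + p.im • W) = 0 := by
      intro V W h1 h2
      rw [map_add, map_smul, map_smul, h1, h2, smul_zero, smul_zero, add_zero]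
    exact key _ _ e1 e2
  · have hne : (hamVF ΩR HR x : E) ≠ 0 := by
      intro h0
      obtain ⟨w, hw⟩ := hsurj x hx
      apply hw
      have h0' : hamVF ΩR HR x = 0 := h0
      rw [h.mfderiv_complexHam', h0', map_zero, contract_zero, neg_zero]
      rfl
    rw [injective_iff_map_eq_zero]
    intro p hp
    set V : E := hamVF ΩR HR x
    have h1 : J x (pseudoFrame J ΩR HR x p) = 0 := by
      rw [hp]
      exact map_zero (J x)
    rw [h.J_pseudoFrame] at h1
    set W : E := applyJ J (hamVF ΩR HR) x
    have a1 : p.re • V + p.im • W = 0 := hp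
    have a2 : (Complex.I * p).re • V + (Complex.I * p).im • W = 0 := h1
    simp only [Complex.mul_re, Complex.I_re, Complex.I_im, Complex.mul_im, zero_mul, one_mul,
      zero_sub, zero_add] at a2
    -- Multiplication of `A p = 0` by the conjugate of `p`, with `J` acting as `i`, leaves `|p|² V =
    -- 0`.
    have a3 : (p.re ^ 2 + p.im ^ 2) • V = p.re • (p.re • V + p.im • W) -
      p.im • (-p.im • V + p.re • W) := by module
    rw [a1, a2, smul_zero, smul_zero, sub_zero] at a3
    have a4 := (smul_eq_zero.1 a3).resolve_right hne
    apply Complex.ext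
    · simp only [Complex.zero_re]; nlinarith [sq_nonneg p.re, sq_nonneg p.im]
    · simp only [Complex.zero_im]; nlinarith [sq_nonneg p.re, sq_nonneg p.im]
  · obtain ⟨w, hw⟩ := hsurj x hx
    have e2 := h.mfderiv_complexHam_J x w
    set D : E →L[ℝ] ℂ := mfderiv 𝓘(ℝ, E) 𝓘(ℝ, ℂ) (complexHam HR HI) x
    set z : ℂ := D w
    have hz : z ≠ 0 := hw
    -- This is the vector `w` multiplied by the complex number `c / z` through `J`; as `dH ∘ J = i
    -- dH`, its image is `(c / z) z = c`.
    refine ⟨((c / z : ℂ).re • w + (c / z : ℂ).im • J x w : TangentSpace 𝓘(ℝ, E) x), ?_⟩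
    have key : ∀ w v : E, D w = z → D v = Complex.I * z →
        D ((c / z : ℂ).re • w + (c / z : ℂ).im • v) = ((c / z : ℂ).re : ℂ) * z +
          ((c / z : ℂ).im : ℂ) * (Complex.I * z) := by
      intro w v h1 h2
      rw [map_add, map_smul, map_smul, h1, h2, Complex.real_smul, Complex.real_smul]
    refine (key _ _ rfl e2).trans ?_
    have := Complex.re_add_im (c / z)
    calc _ = (((c / z : ℂ).re : ℂ) + ((c / z : ℂ).im : ℂ) * Complex.I) * z := by ring
      _ = c := by rw [this, div_mul_cancel₀ _ hz]

end PseudoHolomorphic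

/-! ### Passage to real vector fields -/

section RealFrame

universe u

variable {𝕜 : Type*} [RCLike 𝕜] [NormedSpace 𝕜 ℂ] [IsScalarTower ℝ 𝕜 ℂ] {E : Type u}
  [NormedAddCommGroup E] [NormedSpace 𝕜 E] [NormedSpace ℝ E] [IsScalarTower ℝ 𝕜 E]
  {X : Type*} [TopologicalSpace X] [ChartedSpace E X]
  {Z : Type*} [NormedAddCommGroup Z] [NormedSpace 𝕜 Z] [NormedSpace ℝ Z] [IsScalarTower ℝ 𝕜 Z]
  {n : ℕ∞ω} {A : X → ℂ →L[𝕜] E} {h : X → ℂ}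

/-- The real vector fields of a family of vector fields. -/
noncomputable def realFrame (A : X → ℂ →L[𝕜] E) (ζ : ℂ) : VField ℝ E X := fun x => A x ζ

theorem IsAdapted.isStraightening (hn : n ≠ 0) {χ : OpenPartialHomeomorph X (ℂ × Z × ℂ)}
    (hχ : IsAdapted 𝕜 n A h χ) : IsStraightening (realFrame A) χ := by
  have h1 : ∀ x ∈ χ.source, MDifferentiableAt 𝓘(𝕜, E) 𝓘(𝕜, ℂ × Z × ℂ) χ x := fun x hx =>
    (hχ.contMDiffOn.contMDiffAt (χ.open_source.mem_nhds hx)).mdifferentiableAt hn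
  have h2 : ∀ x ∈ χ.target, MDifferentiableAt 𝓘(𝕜, ℂ × Z × ℂ) 𝓘(𝕜, E) χ.symm x := fun x hx =>
    (hχ.contMDiffOn_symm.contMDiffAt (χ.open_target.mem_nhds hx)).mdifferentiableAt hn
  refine ⟨fun x hx => ?_, fun w hw => ?_, fun w hw ζ => ?_, hχ.target_eq⟩
  · exact (HasMFDerivAt.restrictScalars (h1 x hx).hasMFDerivAt).mdifferentiableAt
  · exact (HasMFDerivAt.restrictScalars (h2 w hw).hasMFDerivAt).mdifferentiableAt
  · rw [(HasMFDerivAt.restrictScalars (h2 w hw).hasMFDerivAt).mfderiv]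
    exact hχ.frame w hw ζ

theorem eq_of_flowsTo (hn : n ≠ 0) (hh : ContMDiff 𝓘(𝕜, E) 𝓘(𝕜, ℂ) n h)
    (hA : ∀ x p, mfderiv 𝓘(𝕜, E) 𝓘(𝕜, ℂ) h x (A x p) = (0 : ℂ)) {ζ : ℂ} {t : ℝ} {x y : X}
    (hxy : FlowsTo (realFrame A ζ) t x y) : h y = h x := by
  obtain ⟨a, b, γ, h0, ht, rfl, rfl, hγ⟩ := hxy
  have key : ∀ t ∈ Ioo a b, HasDerivAt (h ∘ γ) 0 t := by
    intro t ht
    have h1 : HasMFDerivAt 𝓘(ℝ, ℝ) 𝓘(ℝ, E) γ t _ :=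
      (hγ t ht).hasMFDerivAt (Ioo_mem_nhds ht.1 ht.2)
    have h2 : HasMFDerivAt 𝓘(ℝ, E) 𝓘(ℝ, ℂ) h (γ t) _ :=
      HasMFDerivAt.restrictScalars ((hh (γ t)).mdifferentiableAt hn).hasMFDerivAt
    have h4 := hA (γ t) ζ
    set D : E →L[𝕜] ℂ := mfderiv 𝓘(𝕜, E) 𝓘(𝕜, ℂ) h (γ t)
    have h3 : HasFDerivAt (h ∘ γ)
        ((D.restrictScalars ℝ).comp ((1 : ℝ →L[ℝ] ℝ).smulRight (A (γ t) ζ))) t :=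
      (h2.comp t h1).hasFDerivAt
    refine h3.hasDerivAt.congr_deriv ?_
    change D ((1 : ℝ) • (A (γ t) ζ)) = 0
    rw [one_smul]
    exact h4
  refine isOpen_Ioo.is_const_of_deriv_eq_zero isPreconnected_Ioo
    (fun t ht => (key t ht).differentiableAt.differentiableWithinAt)
    (fun t ht => (key t ht).deriv) ht h0

variable [FiniteDimensional 𝕜 E] [FiniteDimensional 𝕜 ℂ] [FiniteDimensional 𝕜 Z]

theorem IsIntegrable.isStraightened (hn : n = ∞ ∨ n = ω) [IsManifold 𝓘(𝕜, E) n X] {e : ℂ}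
    (hA : IsIntegrable 𝕜 n A h (h ⁻¹' {e}))
    (hdim : Module.finrank 𝕜 Z + 2 * Module.finrank 𝕜 ℂ = Module.finrank 𝕜 E) :
    IsStraightened (Z × ℂ) (realFrame A) (h ⁻¹' {e}) := by
  have hn0 : n ≠ 0 := by rcases hn with rfl | rfl <;> simp
  refine ⟨fun x hx => ?_, fun ζ t x y hxy hx => ?_⟩
  · obtain ⟨χ, hχ, hxχ⟩ := hA.exists_isAdapted (Z := Z) hn hdim hx
    exact ⟨χ, hχ.isStraightening hn0, hxχ⟩
  · exact (eq_of_flowsTo hn0 hA.contMDiff hA.mfderiv_apply hxy).trans hx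

end RealFrame

/-! ### Charts of the level set -/

section SliceChart

universe u

variable {𝕜 : Type*} [RCLike 𝕜] [NormedSpace 𝕜 ℂ] {E : Type u}
  [NormedAddCommGroup E] [NormedSpace 𝕜 E]
  {X : Type*} [TopologicalSpace X] [ChartedSpace E X]
  {Z : Type*} [NormedAddCommGroup Z] [NormedSpace 𝕜 Z]
  {n : ℕ∞ω} {A : X → ℂ →L[𝕜] E} {h : X → ℂ} {e : ℂ} {m : ℕ}
  {χ : OpenPartialHomeomorph X (ℂ × Z × ℂ)}

/-- The model of the transversal to leaves of dimension `d` in a manifold of dimension `m`. -/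
abbrev Transverse (𝕜 : Type*) (m d : ℕ) : Type _ := {i : Fin m // ¬(i : ℕ) < d} → 𝕜

theorem card_fin_lt {m d : ℕ} (hm : d ≤ m) : Fintype.card {i : Fin m // (i : ℕ) < d} = d := by
  rw [Fintype.card_congr (β := Fin d) ⟨fun i => ⟨i.1, i.2⟩,
    fun i => ⟨⟨i, i.2.trans_le hm⟩, i.2⟩, fun _ => rfl, fun _ => rfl⟩, Fintype.card_fin]

theorem finrank_transverse (𝕜 : Type*) [RCLike 𝕜] {m d : ℕ} (hm : d ≤ m) :
    Module.finrank 𝕜 (Transverse 𝕜 m d) = m - d := by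
  rw [Module.finrank_fintype_fun_eq_card, Fintype.card_subtype_compl, card_fin_lt hm,
    Fintype.card_fin]

/-- The first `d` coordinates are identified with the factor `ℂ` and the others are the transversal,
so adapted charts take the coordinate form that the definition of a foliation asks for. -/
theorem exists_linear_chart (𝕜 : Type*) [RCLike 𝕜] [NormedSpace 𝕜 ℂ] [FiniteDimensional 𝕜 ℂ]
    {m d : ℕ} (hd : Module.finrank 𝕜 ℂ = d) (hm : d ≤ m) :
    ∃ Λ : (ℂ × Transverse 𝕜 m d) ≃L[𝕜] EuclideanSpace 𝕜 (Fin m),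
      ∀ u v, (∀ i : Fin m, d ≤ (i : ℕ) → Λ u i = Λ v i) ↔ u.2 = v.2 := by
  set b : ({i : Fin m // (i : ℕ) < d} → 𝕜) ≃ₗ[𝕜] ℂ :=
    LinearEquiv.ofFinrankEq _ _ (by rw [Module.finrank_fintype_fun_eq_card, card_fin_lt hm, hd])
  set T : EuclideanSpace 𝕜 (Fin m) →ₗ[𝕜] ℂ × Transverse 𝕜 m d :=
    { toFun := fun x => (b fun i => x i.1, fun i => x i.1)
      map_add' := fun x y => Prod.ext (b.map_add _ _) rfl
      map_smul' := fun c x => Prod.ext (b.map_smul c _) rfl }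
  have hT : Function.Injective T := by
    intro x y hxy
    have h1 := b.injective (congrArg Prod.fst hxy)
    have h2 := congrArg Prod.snd hxy
    ext i
    by_cases hi : (i : ℕ) < d
    · exact congrFun h1 ⟨i, hi⟩
    · exact congrFun h2 ⟨i, hi⟩
  have hfr : Module.finrank 𝕜 (EuclideanSpace 𝕜 (Fin m)) =
      Module.finrank 𝕜 (ℂ × Transverse 𝕜 m d) := by
    rw [Module.finrank_prod, finrank_transverse 𝕜 hm, finrank_euclideanSpace_fin]
    omega
  set L := (LinearEquiv.ofInjectiveOfFinrankEq T hT hfr).toContinuousLinearEquiv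
  have hL : ∀ u (i : {i : Fin m // ¬(i : ℕ) < d}), u.2 i = L.symm u i.1 := fun u i => by
    conv_lhs => rw [← L.apply_symm_apply u]
    rfl
  refine ⟨L.symm, fun u v => ⟨fun H => ?_, fun H i hi => ?_⟩⟩
  · ext i
    rw [hL, hL, H _ (not_lt.1 i.2)]
  · have := congrFun H ⟨i, not_lt.2 hi⟩
    rwa [hL, hL] at this

/-- The parametrization of the slice at height `e` by Euclidean space. -/
noncomputable def sliceMap (Λ : (ℂ × Z) ≃L[𝕜] EuclideanSpace 𝕜 (Fin m)) (e : ℂ)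
    (v : EuclideanSpace 𝕜 (Fin m)) : ℂ × Z × ℂ := ((Λ.symm v).1, (Λ.symm v).2, e)

theorem contDiff_sliceMap (Λ : (ℂ × Z) ≃L[𝕜] EuclideanSpace 𝕜 (Fin m)) (e : ℂ) :
    ContDiff 𝕜 n (sliceMap Λ e) :=
  (contDiff_fst.comp Λ.symm.contDiff).prodMk
    ((contDiff_snd.comp Λ.symm.contDiff).prodMk contDiff_const)

/-- The left inverse of `sliceMap`. -/
noncomputable def sliceProj (Λ : (ℂ × Z) ≃L[𝕜] EuclideanSpace 𝕜 (Fin m)) (w : ℂ × Z × ℂ) :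
    EuclideanSpace 𝕜 (Fin m) := Λ (w.1, w.2.1)

theorem contDiff_sliceProj (Λ : (ℂ × Z) ≃L[𝕜] EuclideanSpace 𝕜 (Fin m)) :
    ContDiff 𝕜 n (sliceProj Λ) :=
  Λ.contDiff.comp (contDiff_fst.prodMk (contDiff_fst.comp contDiff_snd))

@[simp]
theorem sliceProj_sliceMap (Λ : (ℂ × Z) ≃L[𝕜] EuclideanSpace 𝕜 (Fin m)) (e : ℂ)
    (v : EuclideanSpace 𝕜 (Fin m)) : sliceProj Λ (sliceMap Λ e v) = v := Λ.apply_symm_apply v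

theorem sliceMap_sliceProj (Λ : (ℂ × Z) ≃L[𝕜] EuclideanSpace 𝕜 (Fin m)) {w : ℂ × Z × ℂ}
    (hw : w.2.2 = e) : sliceMap Λ e (sliceProj Λ w) = w := by
  subst hw
  simp [sliceMap, sliceProj]

theorem IsAdapted.energy_symm (hχ : IsAdapted 𝕜 n A h χ) {w : ℂ × Z × ℂ} (hw : w ∈ χ.target) :
    h (χ.symm w) = w.2.2 := by
  rw [hχ.eq_snd_snd _ (χ.map_target hw), χ.right_inv hw]

open Classical in
/-- The chart of the level set `h⁻¹(e)` induced by an adapted chart. -/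
noncomputable def sliceChart (Λ : (ℂ × Z) ≃L[𝕜] EuclideanSpace 𝕜 (Fin m))
    (hχ : IsAdapted 𝕜 n A h χ) (p₀ : h ⁻¹' {e}) :
    OpenPartialHomeomorph (h ⁻¹' {e}) (EuclideanSpace 𝕜 (Fin m)) where
  toFun p := sliceProj Λ (χ p)
  -- The point `p₀` is only a default value: on the target the condition always holds, because `h`
  -- is the last coordinate of `χ`.
  invFun v := if hv : χ.symm (sliceMap Λ e v) ∈ h ⁻¹' {e} then ⟨_, hv⟩ else p₀
  source := Subtype.val ⁻¹' χ.source
  target := sliceMap Λ e ⁻¹' χ.target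
  map_source' p hp := by
    have : (χ p).2.2 = e := (hχ.eq_snd_snd _ hp).symm.trans p.2
    change sliceMap Λ e (sliceProj Λ (χ p)) ∈ χ.target
    rw [sliceMap_sliceProj Λ this]
    exact χ.map_source hp
  map_target' v hv := by
    have : χ.symm (sliceMap Λ e v) ∈ h ⁻¹' {e} := hχ.energy_symm hv
    rw [dif_pos this]
    exact χ.map_target hv
  left_inv' p hp := by
    have : (χ p).2.2 = e := (hχ.eq_snd_snd _ hp).symm.trans p.2
    have h2 : χ.symm (sliceMap Λ e (sliceProj Λ (χ p))) = p := by
      rw [sliceMap_sliceProj Λ this, χ.left_inv hp]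
    have h3 : χ.symm (sliceMap Λ e (sliceProj Λ (χ p))) ∈ h ⁻¹' {e} := by
      rw [h2]
      exact p.2
    rw [dif_pos h3]
    exact Subtype.ext h2
  right_inv' v hv := by
    have : χ.symm (sliceMap Λ e v) ∈ h ⁻¹' {e} := hχ.energy_symm hv
    rw [dif_pos this]
    change sliceProj Λ (χ (χ.symm (sliceMap Λ e v))) = v
    rw [χ.right_inv hv, sliceProj_sliceMap]
  open_source := χ.open_source.preimage continuous_subtype_val
  open_target := χ.open_target.preimage (contDiff_sliceMap (n := 0) Λ e).continuous
  continuousOn_toFun := (contDiff_sliceProj (n := 0) Λ).continuous.comp_continuousOn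
    (χ.continuousOn.comp continuous_subtype_val.continuousOn fun _ hp => hp)
  continuousOn_invFun := by
    rw [continuousOn_iff_continuous_domRestrict]
    refine continuous_induced_rng.2 ?_
    have h1 : ContinuousOn (fun v => χ.symm (sliceMap Λ e v)) (sliceMap Λ e ⁻¹' χ.target) :=
      χ.continuousOn_symm.comp (contDiff_sliceMap (n := 0) Λ e).continuous.continuousOn
        fun _ hv => hv
    refine (continuousOn_iff_continuous_domRestrict.1 h1).congr fun v => ?_
    have : χ.symm (sliceMap Λ e v) ∈ h ⁻¹' {e} := hχ.energy_symm v.2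
    simp only [domRestrict_apply, Function.comp_apply]
    rw [dif_pos this]

variable {Λ : (ℂ × Z) ≃L[𝕜] EuclideanSpace 𝕜 (Fin m)} {hχ : IsAdapted 𝕜 n A h χ} {p₀ : h ⁻¹' {e}}

theorem sliceChart_apply (p : h ⁻¹' {e}) : sliceChart Λ hχ p₀ p = sliceProj Λ (χ p) := rfl

theorem sliceChart_target : (sliceChart Λ hχ p₀).target = sliceMap Λ e ⁻¹' χ.target := rfl

theorem coe_sliceChart_symm {v : EuclideanSpace 𝕜 (Fin m)} (hv : sliceMap Λ e v ∈ χ.target) :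
    ((sliceChart Λ hχ p₀).symm v : X) = χ.symm (sliceMap Λ e v) := by
  have : χ.symm (sliceMap Λ e v) ∈ h ⁻¹' {e} := hχ.energy_symm hv
  exact congrArg Subtype.val (dif_pos this)

/-- The charts of the level set induced by adapted charts. -/
@[reducible]
noncomputable def sliceChartedSpace (Λ : (ℂ × Z) ≃L[𝕜] EuclideanSpace 𝕜 (Fin m))
    (hex : ∀ p : h ⁻¹' {e}, ∃ χ : OpenPartialHomeomorph X (ℂ × Z × ℂ),
      IsAdapted 𝕜 n A h χ ∧ (p : X) ∈ χ.source) :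
    ChartedSpace (EuclideanSpace 𝕜 (Fin m)) (h ⁻¹' {e}) where
  atlas := {φ | ∃ (χ : OpenPartialHomeomorph X (ℂ × Z × ℂ)) (hχ : IsAdapted 𝕜 n A h χ)
    (p₀ : h ⁻¹' {e}), φ = sliceChart Λ hχ p₀}
  chartAt p := sliceChart Λ (hex p).choose_spec.1 p
  mem_chart_source p := (hex p).choose_spec.2
  chart_mem_atlas _ := ⟨_, _, _, rfl⟩

/-- The coordinate changes are those of the adapted charts, composed with the affine inclusion
`sliceMap` and the linear projection `sliceProj`. -/
theorem isManifold_slice (Λ : (ℂ × Z) ≃L[𝕜] EuclideanSpace 𝕜 (Fin m))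
    (hex : ∀ p : h ⁻¹' {e}, ∃ χ : OpenPartialHomeomorph X (ℂ × Z × ℂ),
      IsAdapted 𝕜 n A h χ ∧ (p : X) ∈ χ.source) :
    let := sliceChartedSpace Λ hex
    IsManifold 𝓘(𝕜, EuclideanSpace 𝕜 (Fin m)) n (h ⁻¹' {e}) := by
  let := sliceChartedSpace Λ hex
  refine isManifold_of_contDiffOn _ _ _ ?_
  rintro _ _ ⟨χ, hχ, p₀, rfl⟩ ⟨χ', hχ', p₀', rfl⟩
  simp only [modelWithCornersSelf_coe, modelWithCornersSelf_coe_symm, Function.comp_id,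
    Function.id_comp, preimage_id, range_id, inter_univ]
  have key : ContDiffOn 𝕜 n (fun v => sliceProj Λ (χ' (χ.symm (sliceMap Λ e v))))
      (sliceMap Λ e ⁻¹' (χ.target ∩ χ.symm ⁻¹' χ'.source)) := by
    refine contMDiffOn_iff_contDiffOn.1 ?_
    refine (contDiff_sliceProj Λ).contMDiff.comp_contMDiffOn ?_
    refine hχ'.contMDiffOn.comp (hχ.contMDiffOn_symm.comp (contDiff_sliceMap Λ e).contMDiff.contMDiffOn
      fun v hv => hv.1) fun v hv => hv.2
  have hs : ((sliceChart Λ hχ p₀).symm ≫ₕ sliceChart Λ hχ' p₀').source ⊆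
      sliceMap Λ e ⁻¹' (χ.target ∩ χ.symm ⁻¹' χ'.source) := by
    intro v hv
    rw [OpenPartialHomeomorph.trans_source] at hv
    have h1 : sliceMap Λ e v ∈ χ.target := hv.1
    have h2 : ((sliceChart Λ hχ p₀).symm v : X) ∈ χ'.source := hv.2
    rw [coe_sliceChart_symm h1] at h2
    exact ⟨h1, h2⟩
  refine (key.mono hs).congr fun v hv => ?_
  change sliceProj Λ (χ' ((sliceChart Λ hχ p₀).symm v : X)) = _
  rw [coe_sliceChart_symm (hs hv).1]

end SliceChart

/-! ### The level set as an embedded and foliated submanifold -/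

section SliceEmbedding

universe u

variable {𝕜 : Type*} [RCLike 𝕜] [NormedSpace 𝕜 ℂ] {E : Type u}
  [NormedAddCommGroup E] [NormedSpace 𝕜 E]
  {X : Type*} [TopologicalSpace X] [ChartedSpace E X]
  {Z : Type*} [NormedAddCommGroup Z] [NormedSpace 𝕜 Z]
  {n : ℕ∞ω} {A : X → ℂ →L[𝕜] E} {h : X → ℂ} {e : ℂ} {m : ℕ}
  {χ : OpenPartialHomeomorph X (ℂ × Z × ℂ)}

/-- The affine identification of the model of an adapted chart with `E` in which the slice at
height `e` becomes a linear subspace. -/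
noncomputable def sliceHomeomorph (Λ : (ℂ × Z) ≃L[𝕜] EuclideanSpace 𝕜 (Fin m))
    (G : (EuclideanSpace 𝕜 (Fin m) × ℂ) ≃L[𝕜] E) (e : ℂ) : (ℂ × Z × ℂ) ≃ₜ E where
  toFun w := G (sliceProj Λ w, w.2.2 - e)
  invFun y := ((Λ.symm (G.symm y).1).1, (Λ.symm (G.symm y).1).2, (G.symm y).2 + e)
  left_inv w := by simp [sliceProj]
  right_inv y := by simp [sliceProj]
  continuous_toFun := G.continuous.comp ((contDiff_sliceProj (n := 0) Λ).continuous.prodMk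
    (by fun_prop))
  continuous_invFun := by fun_prop

/-- After `sliceHomeomorph` an adapted chart becomes an `E`-valued chart of `X` in which the
inclusion is `v ↦ G (v, 0)`, an immersion with complement `ℂ`. -/
theorem isSmoothEmbedding_slice [IsManifold 𝓘(𝕜, E) n X]
    (Λ : (ℂ × Z) ≃L[𝕜] EuclideanSpace 𝕜 (Fin m)) (G : (EuclideanSpace 𝕜 (Fin m) × ℂ) ≃L[𝕜] E)
    (hex : ∀ p : h ⁻¹' {e}, ∃ χ : OpenPartialHomeomorph X (ℂ × Z × ℂ),
      IsAdapted 𝕜 n A h χ ∧ (p : X) ∈ χ.source) :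
    letI := sliceChartedSpace Λ hex
    IsSmoothEmbedding 𝓘(𝕜, EuclideanSpace 𝕜 (Fin m)) 𝓘(𝕜, E) n
      (Subtype.val : h ⁻¹' {e} → X) := by
  let := sliceChartedSpace Λ hex
  have := isManifold_slice Λ hex
  refine ⟨IsImmersionOfComplement.isImmersion (F := ℂ) fun p => ?_, IsEmbedding.subtypeVal⟩
  obtain ⟨χ, hχ, hp⟩ := hex p
  have hG : ContDiff 𝕜 n (sliceHomeomorph Λ G e) :=
    G.contDiff.comp ((contDiff_sliceProj Λ).prodMk ((contDiff_snd.comp contDiff_snd).sub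
      contDiff_const))
  have hG' : ContDiff 𝕜 n (sliceHomeomorph Λ G e).symm := by
    have h1 : ContDiff 𝕜 n fun y => Λ.symm (G.symm y).1 :=
      Λ.symm.contDiff.comp (contDiff_fst.comp G.symm.contDiff)
    exact (contDiff_fst.comp h1).prodMk ((contDiff_snd.comp h1).prodMk
      ((contDiff_snd.comp G.symm.contDiff).add contDiff_const))
  refine IsImmersionAtOfComplement.mk_of_charts G (sliceChart Λ hχ p)
    (χ.transHomeomorph (sliceHomeomorph Λ G e)) hp hp
    (IsManifold.subset_maximalAtlas ⟨_, _, _, rfl⟩) ?_ (fun _ h => h) ?_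
  · rw [IsManifold.mem_maximalAtlas_iff_contMDiffOn]
    exact ⟨hG.contMDiff.comp_contMDiffOn hχ.contMDiffOn,
      hχ.contMDiffOn_symm.comp hG'.contMDiff.contMDiffOn fun _ h => h⟩
  · intro v hv
    have hv' : sliceMap Λ e v ∈ χ.target := by simpa [sliceChart_target] using hv
    change G (sliceProj Λ (χ ((sliceChart Λ hχ p).symm v : X)),
      (χ ((sliceChart Λ hχ p).symm v : X)).2.2 - e) = G (v, 0)
    rw [coe_sliceChart_symm hv', χ.right_inv hv', sliceProj_sliceMap]
    simp [sliceMap]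

variable [IsScalarTower ℝ 𝕜 ℂ] [NormedSpace ℝ E] [IsScalarTower ℝ 𝕜 E] [NormedSpace ℝ Z]
  [IsScalarTower ℝ 𝕜 Z]

/-- On the level set the last coordinate of `χ` is fixed, so the slices are the fibres of the
transverse coordinate `(χ ·).2`. A component of a leaf has a connected countable set of transverse
coordinates, hence a single one. Conversely, a slice is the image of a convex box and lies in the
leaf. -/
theorem isFoliationChart_sliceChart [T2Space X] (hn : n ≠ 0)
    {Λ : (ℂ × Z) ≃L[𝕜] EuclideanSpace 𝕜 (Fin m)} {d : ℕ}
    (hΛ : ∀ u v, (∀ i : Fin m, d ≤ (i : ℕ) → Λ u i = Λ v i) ↔ u.2 = v.2)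
    (hF : IsStraightened (Z × ℂ) (realFrame A) (h ⁻¹' {e})) (hχ : IsAdapted 𝕜 n A h χ)
    (p₀ : h ⁻¹' {e}) :
    IsFoliationChart d (leaves (realFrame A 1) (realFrame A Complex.I) (h ⁻¹' {e}))
      (sliceChart Λ hχ p₀) := by
  have hχs := hχ.isStraightening hn
  rintro _ ⟨x₀, rfl⟩ p ⟨hpχ, hpl⟩
  have hz : ∀ q : h ⁻¹' {e}, (q : X) ∈ χ.source →
      ((∀ i : Fin m, d ≤ (i : ℕ) → sliceChart Λ hχ p₀ q i = sliceChart Λ hχ p₀ p i) ↔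
        (χ q).2 = (χ p).2) := by
    intro q hq
    have h1 : (χ q).2.2 = (χ p).2.2 := by
      rw [← hχ.eq_snd_snd _ hq, ← hχ.eq_snd_snd _ hpχ]
      exact (q.2 : h q = e).trans (p.2 : h p = e).symm
    simp only [sliceChart_apply, sliceProj]
    rw [hΛ, Prod.ext_iff]
    exact ⟨fun H => ⟨H, h1⟩, fun H => H.1⟩
  obtain ⟨c, r, T, hT⟩ := hχ.target_eq
  apply Subset.antisymm
  · intro q hq
    have hsub := connectedComponentIn_subset ((sliceChart Λ hχ p₀).source ∩
      Subtype.val ⁻¹' leaf (realFrame A 1) (realFrame A Complex.I) x₀) p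
    refine ⟨(hsub hq).1, (hz q (hsub hq).1).2 ?_⟩
    have hpre := (isPreconnected_connectedComponentIn (x := p) (F := (sliceChart Λ hχ p₀).source ∩
      Subtype.val ⁻¹' leaf (realFrame A 1) (realFrame A Complex.I) x₀)).image
        (fun q => (χ (q : X)).2) (continuous_snd.comp_continuousOn (χ.continuousOn.comp
          continuous_subtype_val.continuousOn fun q hq => (hsub hq).1))
    have hcount : ((fun q : h ⁻¹' {e} => (χ (q : X)).2) '' connectedComponentIn
        ((sliceChart Λ hχ p₀).source ∩
          Subtype.val ⁻¹' leaf (realFrame A 1) (realFrame A Complex.I) x₀) p).Countable := by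
      refine (hF.countable_leaf_image hχs x₀.2).mono ?_
      rintro _ ⟨q, hq, rfl⟩
      exact ⟨q, ⟨(hsub hq).2, (hsub hq).1⟩, rfl⟩
    -- A countable subset of a metric space is totally disconnected, so the connected image is one
    -- point.
    exact hcount.isTotallyDisconnected _ Subset.rfl hpre ⟨q, hq, rfl⟩
      ⟨p, mem_connectedComponentIn ⟨hpχ, hpl⟩, rfl⟩
  · have hset : {y | y ∈ (sliceChart Λ hχ p₀).source ∧
        ∀ i : Fin m, d ≤ (i : ℕ) → sliceChart Λ hχ p₀ y i = sliceChart Λ hχ p₀ p i} =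
        (fun ζ => (sliceChart Λ hχ p₀).symm (Λ (ζ, (χ p).2.1))) '' box c r := by
      have hmem : ∀ ζ ∈ box c r, sliceMap Λ e (Λ (ζ, (χ p).2.1)) = (ζ, (χ p).2) ∧
          ((ζ, (χ p).2) : ℂ × Z × ℂ) ∈ χ.target := by
        intro ζ hζ
        have h1 : (χ p).2.2 = e := (hχ.eq_snd_snd _ hpχ).symm.trans p.2
        refine ⟨?_, ?_⟩
        · simp only [sliceMap, ContinuousLinearEquiv.symm_apply_apply, ← h1]
        · have := χ.map_source hpχ
          rw [hT] at this ⊢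
          exact ⟨hζ, this.2⟩
      ext y
      constructor
      · rintro ⟨hy, hy'⟩
        have h2 := (hz y hy).1 hy'
        have h3 := χ.map_source hy
        rw [hT] at h3
        refine ⟨(χ y).1, h3.1, Subtype.ext ?_⟩
        obtain ⟨h4, h5⟩ := hmem _ h3.1
        change ((sliceChart Λ hχ p₀).symm (Λ ((χ y).1, (χ p).2.1)) : X) = y
        rw [coe_sliceChart_symm (h4.symm ▸ h5), h4, ← h2]
        exact χ.left_inv hy
      · rintro ⟨ζ, hζ, rfl⟩
        obtain ⟨h4, h5⟩ := hmem _ hζ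
        have h6 : ((sliceChart Λ hχ p₀).symm (Λ (ζ, (χ p).2.1)) : X) = χ.symm (ζ, (χ p).2) := by
          rw [coe_sliceChart_symm (h4.symm ▸ h5), h4]
        have h7 : ((sliceChart Λ hχ p₀).symm (Λ (ζ, (χ p).2.1)) : X) ∈ χ.source :=
          h6 ▸ χ.map_target h5
        exact ⟨h7, (hz _ h7).2 (by rw [h6, χ.right_inv h5])⟩
    refine IsPreconnected.subset_connectedComponentIn ?_ ⟨hpχ, fun _ _ => rfl⟩ ?_
    · rw [hset]
      refine (convex_box c r).isPreconnected.image _ ?_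
      refine (sliceChart Λ hχ p₀).continuousOn_symm.comp (by fun_prop) fun ζ hζ => ?_
      rw [sliceChart_target]
      have h1 : (χ p).2.2 = e := (hχ.eq_snd_snd _ hpχ).symm.trans p.2
      have := χ.map_source hpχ
      rw [hT] at this
      rw [mem_preimage, hT]
      simp only [sliceMap, ContinuousLinearEquiv.symm_apply_apply, ← h1]
      exact ⟨hζ, this.2⟩
    · rintro y ⟨hy, hy'⟩
      exact ⟨hy, mem_leaf_trans hpl (hχs.mem_leaf hpχ hy ((hz y hy).1 hy').symm)⟩

theorem isFoliation_slice [T2Space X] [IsManifold 𝓘(𝕜, E) n X] (hn : n ≠ 0)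
    {Λ : (ℂ × Z) ≃L[𝕜] EuclideanSpace 𝕜 (Fin m)} {d : ℕ} (hd : d ≤ m)
    (hΛ : ∀ u v, (∀ i : Fin m, d ≤ (i : ℕ) → Λ u i = Λ v i) ↔ u.2 = v.2)
    (hF : IsStraightened (Z × ℂ) (realFrame A) (h ⁻¹' {e}))
    (hex : ∀ p : h ⁻¹' {e}, ∃ χ : OpenPartialHomeomorph X (ℂ × Z × ℂ),
      IsAdapted 𝕜 n A h χ ∧ (p : X) ∈ χ.source) :
    letI := sliceChartedSpace Λ hex
    IsFoliation 𝕜 m n d (leaves (realFrame A 1) (realFrame A Complex.I) (h ⁻¹' {e})) := by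
  let := sliceChartedSpace Λ hex
  have := isManifold_slice Λ hex
  refine ⟨hF.isPartition_leaves, ?_, fun p => ⟨hd, ?_⟩⟩
  · rintro _ ⟨x, rfl⟩
    refine (hF.isPathConnected_leaf x.2).preimage_coe (hF.leaf_subset x.2)
  · obtain ⟨χ, hχ, hp⟩ := hex p
    exact ⟨sliceChart Λ hχ p, IsManifold.subset_maximalAtlas ⟨_, _, _, rfl⟩, hp,
      isFoliationChart_sliceChart hn hΛ hF hχ p⟩

end SliceEmbedding

/-! ### Restriction of almost complex structures -/

section Restriction

/-- The trivialization at the middle base point cancels against its inverse as long as `g x` lies in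
the chart at `g x₀`. -/
theorem inTangentCoordinates_comp {𝕜 : Type*} [NontriviallyNormedField 𝕜]
    {E E' E'' : Type*} [NormedAddCommGroup E] [NormedSpace 𝕜 E] [NormedAddCommGroup E']
    [NormedSpace 𝕜 E'] [NormedAddCommGroup E''] [NormedSpace 𝕜 E'']
    {M M' M'' N : Type*} [TopologicalSpace M] [ChartedSpace E M] [IsManifold 𝓘(𝕜, E) 1 M]
    [TopologicalSpace M'] [ChartedSpace E' M'] [IsManifold 𝓘(𝕜, E') 1 M']
    [TopologicalSpace M''] [ChartedSpace E'' M''] [IsManifold 𝓘(𝕜, E'') 1 M'']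
    (f : N → M) (g : N → M') (h : N → M'') (φ : N → E →L[𝕜] E') (ψ : N → E' →L[𝕜] E'') {x₀ x : N}
    (hx : g x ∈ (chartAt E' (g x₀)).source) :
    inTangentCoordinates 𝓘(𝕜, E) 𝓘(𝕜, E'') f h (fun x => (ψ x).comp (φ x)) x₀ x =
      (inTangentCoordinates 𝓘(𝕜, E') 𝓘(𝕜, E'') g h ψ x₀ x).comp
        (inTangentCoordinates 𝓘(𝕜, E) 𝓘(𝕜, E') f g φ x₀ x) := by
  ext v
  have hx' : g x ∈ (trivializationAt E' (TangentSpace 𝓘(𝕜, E')) (g x₀)).baseSet := hx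
  have h1 := (trivializationAt E' (TangentSpace 𝓘(𝕜, E')) (g x₀)).symmL_continuousLinearMapAt
    (R := 𝕜) hx' (φ x ((trivializationAt E (TangentSpace 𝓘(𝕜, E)) (f x₀)).symmL 𝕜 (f x) v))
  exact congrArg (fun u => (trivializationAt E'' (TangentSpace 𝓘(𝕜, E'')) (h x₀)).continuousLinearMapAt
    𝕜 (h x) (ψ x u)) h1.symm

variable {E F : Type*} [NormedAddCommGroup E] [NormedSpace ℝ E] [NormedAddCommGroup F]
  [NormedSpace ℝ F] {X S : Type*} [TopologicalSpace X] [ChartedSpace E X]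
  [TopologicalSpace S] [ChartedSpace F S]

theorem retraction_mfderiv {f : S → X} (hf : ContMDiff 𝓘(ℝ, F) 𝓘(ℝ, E) ∞ f) {ρ : X → S} {p : S}
    (hρ : ContMDiffAt 𝓘(ℝ, E) 𝓘(ℝ, F) ∞ ρ (f p)) (hρf : ∀ᶠ q in 𝓝 p, ρ (f q) = q)
    (v : TangentSpace 𝓘(ℝ, F) p) :
    (mfderiv 𝓘(ℝ, E) 𝓘(ℝ, F) ρ (f p) (mfderiv 𝓘(ℝ, F) 𝓘(ℝ, E) f p v) : F) = v := by
  have h1 := (hρ.mdifferentiableAt (by simp)).hasMFDerivAt.comp p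
    ((hf p).mdifferentiableAt (by simp)).hasMFDerivAt
  have h2 : HasMFDerivAt 𝓘(ℝ, F) 𝓘(ℝ, F) (ρ ∘ f) p (ContinuousLinearMap.id ℝ F) :=
    (hasMFDerivAt_id p).congr_of_eventuallyEq hρf
  exact congrArg (fun l : F →L[ℝ] F => l v) (hasMFDerivAt_unique h1 h2)

/-- An almost complex structure restricts to a submanifold whose tangent spaces are closed
under it. -/
theorem exists_restrict_almostComplex [IsManifold 𝓘(ℝ, E) ∞ X]
    [IsManifold 𝓘(ℝ, F) ∞ S] {J : EndField E X} (hJ : IsAlmostComplex J) {f : S → X}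
    (hf : ContMDiff 𝓘(ℝ, F) 𝓘(ℝ, E) ∞ f)
    (hret : ∀ p, ∃ ρ : X → S, ContMDiffAt 𝓘(ℝ, E) 𝓘(ℝ, F) ∞ ρ (f p) ∧ ∀ᶠ q in 𝓝 p, ρ (f q) = q)
    (hinv : ∀ p v, ∃ u, mfderiv 𝓘(ℝ, F) 𝓘(ℝ, E) f p u =
      J (f p) (mfderiv 𝓘(ℝ, F) 𝓘(ℝ, E) f p v)) :
    ∃ J' : EndField F S, IsAlmostComplex J' ∧
      ∀ p v, mfderiv 𝓘(ℝ, F) 𝓘(ℝ, E) f p (J' p v) = J (f p) (mfderiv 𝓘(ℝ, F) 𝓘(ℝ, E) f p v) := by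
  have : IsManifold 𝓘(ℝ, E) 1 X := IsManifold.of_le (n := ∞) (by simp)
  have : IsManifold 𝓘(ℝ, F) 1 S := IsManifold.of_le (n := ∞) (by simp)
  have hinj : ∀ p, Function.Injective (mfderiv 𝓘(ℝ, F) 𝓘(ℝ, E) f p) := by
    intro p u v huv
    obtain ⟨ρ, hρ, hρf⟩ := hret p
    rw [← retraction_mfderiv hf hρ hρf u, ← retraction_mfderiv hf hρ hρf v, huv]
  have hex : ∀ p, ∃ L : F →L[ℝ] F, ∀ v : F,
      mfderiv 𝓘(ℝ, F) 𝓘(ℝ, E) f p (L v) = J (f p) (mfderiv 𝓘(ℝ, F) 𝓘(ℝ, E) f p v) := by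
    intro p
    obtain ⟨ρ, hρ, hρf⟩ := hret p
    set D : F →L[ℝ] E := mfderiv 𝓘(ℝ, F) 𝓘(ℝ, E) f p
    set R : E →L[ℝ] F := mfderiv 𝓘(ℝ, E) 𝓘(ℝ, F) ρ (f p)
    -- The restricted structure is `dρ ∘ J ∘ df` for a local retraction `ρ`; it intertwines because
    -- `J (df v)` is tangent to the submanifold and `df ∘ dρ` fixes such vectors.
    refine ⟨R.comp ((show E →L[ℝ] E from J (f p)).comp D), fun v => ?_⟩
    obtain ⟨u, hu⟩ := hinv p v
    have h1 : R (D u) = u := retraction_mfderiv hf hρ hρf u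
    have h2 : D u = J (f p) (D v) := hu
    have h3 : D (R (D u)) = D u := congrArg D h1
    have h4 : D (R (D u)) = D (R (J (f p) (D v))) := congrArg (fun w => D (R w)) h2
    exact h4.symm.trans (h3.trans h2)
  choose J' hJ' using hex
  refine ⟨J', ⟨fun p₀ => ?_, fun p v => hinj p ?_⟩, hJ'⟩
  · rw [contMDiffAt_hom_bundle]
    refine ⟨contMDiffAt_id, ?_⟩
    obtain ⟨ρ, hρ, hρf⟩ := hret p₀
    have hfc := (hf p₀).continuousAt
    have c1 : ContMDiffAt 𝓘(ℝ, F) 𝓘(ℝ, F →L[ℝ] E) ∞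
        (inTangentCoordinates 𝓘(ℝ, F) 𝓘(ℝ, E) id f (fun p => mfderiv 𝓘(ℝ, F) 𝓘(ℝ, E) f p) p₀) p₀ :=
      (hf p₀).mfderiv_const (by simp)
    have c2 : ContMDiffAt 𝓘(ℝ, F) 𝓘(ℝ, E →L[ℝ] E) ∞
        (inTangentCoordinates 𝓘(ℝ, E) 𝓘(ℝ, E) f f (fun p => J (f p)) p₀) p₀ :=
      ((contMDiffAt_hom_bundle _).1 (hJ.smooth (f p₀))).2.comp p₀ (hf p₀)
    have c3 : ContMDiffAt 𝓘(ℝ, F) 𝓘(ℝ, E →L[ℝ] F) ∞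
        (inTangentCoordinates 𝓘(ℝ, E) 𝓘(ℝ, F) f (fun p => ρ (f p))
          (fun p => mfderiv 𝓘(ℝ, E) 𝓘(ℝ, F) ρ (f p)) p₀) p₀ :=
      ContMDiffAt.mfderiv (fun _ => ρ) f
        (hρ.comp (p₀, f p₀) (contMDiffAt_snd (M := S) (N := X))) (hf p₀) (by simp)
    -- Injectivity of `df` makes `J'` independent of the retraction, so near `p₀` the single
    -- retraction chosen at `p₀` computes it, and in coordinates it is a composite of three smooth
    -- families.
    refine (c3.clm_comp (c2.clm_comp c1)).congr_of_eventuallyEq ?_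
    have hs : ∀ᶠ p in 𝓝 p₀, f p ∈ (chartAt E (f p₀)).source :=
      hfc.eventually ((chartAt E (f p₀)).open_source.mem_nhds (mem_chart_source E (f p₀)))
    have hρ' : ∀ᶠ x in 𝓝 (f p₀), ContMDiffAt 𝓘(ℝ, E) 𝓘(ℝ, F) 1 ρ x :=
      (contMDiffAt_iff_contMDiffAt_nhds (by simp)).1
        (hρ.of_le (by simp))
    filter_upwards [hs, hρf.eventually_nhds, hfc.eventually hρ'] with p hp hpρ hpρ'
    let D : S → F →L[ℝ] E := fun p => mfderiv 𝓘(ℝ, F) 𝓘(ℝ, E) f p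
    let K : S → E →L[ℝ] E := fun p => J (f p)
    let R : S → E →L[ℝ] F := fun p => mfderiv 𝓘(ℝ, E) 𝓘(ℝ, F) ρ (f p)
    have e1 : J' p = (R p).comp ((K p).comp (D p)) := by
      ext v
      have h1 := (hpρ'.mdifferentiableAt one_ne_zero).hasMFDerivAt.comp p
        ((hf p).mdifferentiableAt (by simp)).hasMFDerivAt
      have h2 : HasMFDerivAt 𝓘(ℝ, F) 𝓘(ℝ, F) (ρ ∘ f) p (ContinuousLinearMap.id ℝ F) :=
        (hasMFDerivAt_id p).congr_of_eventuallyEq hpρ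
      have h3 : R p (D p (J' p v)) = J' p v :=
        congrArg (fun l : F →L[ℝ] F => l (J' p v)) (hasMFDerivAt_unique h1 h2)
      have h4 : R p (D p (J' p v)) = R p (K p (D p v)) := congrArg (R p) (hJ' p v)
      exact h3.symm.trans h4
    have e2 : ρ (f p₀) = p₀ := hρf.self_of_nhds
    have e3 : ρ (f p) = p := hpρ.self_of_nhds
    have s1 := inTangentCoordinates_comp (𝕜 := ℝ) (M'' := S) id f id D
      (fun p => (R p).comp (K p)) (x₀ := p₀) (x := p) hp
    have s2 := inTangentCoordinates_comp (𝕜 := ℝ) (M'' := S) f f id K R (x₀ := p₀) (x := p) hp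
    have s3 : inTangentCoordinates 𝓘(ℝ, E) 𝓘(ℝ, F) f (fun p => ρ (f p)) R p₀ p =
        inTangentCoordinates 𝓘(ℝ, E) 𝓘(ℝ, F) f id R p₀ p := by
      simp only [inTangentCoordinates, id_eq]
      rw [e2, e3]
    have s0 : ContinuousLinearMap.inCoordinates F (TangentSpace 𝓘(ℝ, F)) F (TangentSpace 𝓘(ℝ, F))
        p₀ p p₀ p (J' p) = inTangentCoordinates 𝓘(ℝ, F) 𝓘(ℝ, F) id id
        (fun p => ((R p).comp (K p)).comp (D p)) p₀ p := congrArg _ e1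
    refine s0.trans (s1.trans ?_)
    rw [s2, ← s3]
    rfl
  · have h1 := hJ' p (J' p v)
    have h2 := congrArg (J (f p)) (hJ' p v)
    refine h1.trans (h2.trans ((hJ.sq_eq _ _).trans ?_))
    exact (map_neg (mfderiv 𝓘(ℝ, F) 𝓘(ℝ, E) f p) v).symm

end Restriction

/-! ### Tangent spaces of the level set and of its leaves -/

section SliceTangent

universe u

variable {E : Type u} [NormedAddCommGroup E] [NormedSpace ℝ E]
  {X : Type*} [TopologicalSpace X] [ChartedSpace E X]
  {Z : Type*} [NormedAddCommGroup Z] [NormedSpace ℝ Z]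
  {A : X → ℂ →L[ℝ] E} {h : X → ℂ} {e : ℂ} {m : ℕ}
  {χ : OpenPartialHomeomorph X (ℂ × Z × ℂ)}
  {Λ : (ℂ × Z) ≃L[ℝ] EuclideanSpace ℝ (Fin m)}
  {hex : ∀ p : h ⁻¹' {e}, ∃ χ : OpenPartialHomeomorph X (ℂ × Z × ℂ),
      IsAdapted ℝ ∞ A h χ ∧ (p : X) ∈ χ.source}

theorem IsAdapted.mdifferentiable (hχ : IsAdapted ℝ ∞ A h χ) :
    χ.MDifferentiable 𝓘(ℝ, E) 𝓘(ℝ, ℂ × Z × ℂ) :=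
  ⟨hχ.contMDiffOn.mdifferentiableOn (by simp), hχ.contMDiffOn_symm.mdifferentiableOn (by simp)⟩

theorem contMDiffOn_sliceChart_symm (hχ : IsAdapted ℝ ∞ A h χ) (p₀ : h ⁻¹' {e}) :
    letI := sliceChartedSpace Λ hex
    ContMDiffOn 𝓘(ℝ, EuclideanSpace ℝ (Fin m)) 𝓘(ℝ, EuclideanSpace ℝ (Fin m)) ∞
      (sliceChart Λ hχ p₀).symm (sliceChart Λ hχ p₀).target := by
  let := sliceChartedSpace Λ hex
  have := isManifold_slice Λ hex
  exact contMDiffOn_symm_of_mem_maximalAtlas (IsManifold.subset_maximalAtlas ⟨_, _, _, rfl⟩)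

theorem exists_slice_retraction (p : h ⁻¹' {e}) :
    letI := sliceChartedSpace Λ hex
    ∃ ρ : X → h ⁻¹' {e}, ContMDiffAt 𝓘(ℝ, E) 𝓘(ℝ, EuclideanSpace ℝ (Fin m)) ∞ ρ p ∧
      ∀ᶠ q : h ⁻¹' {e} in 𝓝 p, ρ (q : X) = q := by
  let := sliceChartedSpace Λ hex
  obtain ⟨χ, hχ, hp⟩ := hex p
  have h1 : ContMDiffAt 𝓘(ℝ, E) 𝓘(ℝ, EuclideanSpace ℝ (Fin m)) ∞ (fun x => sliceProj Λ (χ x)) p :=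
    (contDiff_sliceProj Λ).contMDiff.contMDiffAt.comp (p : X)
      (hχ.contMDiffOn.contMDiffAt (χ.open_source.mem_nhds hp))
  have h2 : sliceProj Λ (χ p) ∈ (sliceChart Λ hχ p).target :=
    (sliceChart Λ hχ p).map_source (x := p) hp
  refine ⟨fun x => (sliceChart Λ hχ p).symm (sliceProj Λ (χ x)), ?_, ?_⟩
  · exact ((contMDiffOn_sliceChart_symm (hex := hex) hχ p).contMDiffAt
      ((sliceChart Λ hχ p).open_target.mem_nhds h2)).comp (p : X) h1
  · filter_upwards [(sliceChart Λ hχ p).open_source.mem_nhds hp] with q hq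
    exact (sliceChart Λ hχ p).left_inv hq

theorem slice_mfderiv_injective
    (hι : letI := sliceChartedSpace Λ hex
      ContMDiff 𝓘(ℝ, EuclideanSpace ℝ (Fin m)) 𝓘(ℝ, E) ∞ (Subtype.val : h ⁻¹' {e} → X))
    (p : h ⁻¹' {e}) :
    letI := sliceChartedSpace Λ hex
    Function.Injective (mfderiv 𝓘(ℝ, EuclideanSpace ℝ (Fin m)) 𝓘(ℝ, E)
      (Subtype.val : h ⁻¹' {e} → X) p) := by
  let := sliceChartedSpace Λ hex
  intro u v huv
  obtain ⟨ρ, hρ, hρf⟩ := exists_slice_retraction (Λ := Λ) (hex := hex) p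
  rw [← retraction_mfderiv hι hρ hρf u, ← retraction_mfderiv hι hρ hρf v, huv]

/-- The tangent spaces of a level set are the kernels of the differential. -/
theorem exists_slice_mfderiv_eq [FiniteDimensional ℝ E]
    (hι : letI := sliceChartedSpace Λ hex
      ContMDiff 𝓘(ℝ, EuclideanSpace ℝ (Fin m)) 𝓘(ℝ, E) ∞ (Subtype.val : h ⁻¹' {e} → X))
    (hh : ContMDiff 𝓘(ℝ, E) 𝓘(ℝ, ℂ) ∞ h) (hm : m + 2 = Module.finrank ℝ E) (p : h ⁻¹' {e})
    (hs : Function.Surjective (mfderiv 𝓘(ℝ, E) 𝓘(ℝ, ℂ) h p)) (w : TangentSpace 𝓘(ℝ, E) (p : X)) :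
    letI := sliceChartedSpace Λ hex
    (mfderiv 𝓘(ℝ, E) 𝓘(ℝ, ℂ) h p w : ℂ) = 0 ↔
      ∃ u, mfderiv 𝓘(ℝ, EuclideanSpace ℝ (Fin m)) 𝓘(ℝ, E)
        (Subtype.val : h ⁻¹' {e} → X) p u = w := by
  let := sliceChartedSpace Λ hex
  have hinj := slice_mfderiv_injective hι p
  have h1 := ((hh (p : X)).mdifferentiableAt (by simp)).hasMFDerivAt.comp p
    ((hι p).mdifferentiableAt (by simp)).hasMFDerivAt
  have h2 : HasMFDerivAt 𝓘(ℝ, EuclideanSpace ℝ (Fin m)) 𝓘(ℝ, ℂ) (h ∘ (Subtype.val : h ⁻¹' {e} → X))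
      p (0 : EuclideanSpace ℝ (Fin m) →L[ℝ] ℂ) := by
    have : h ∘ (Subtype.val : h ⁻¹' {e} → X) = fun _ => e := funext fun q => q.2
    rw [this]
    exact hasMFDerivAt_const e p
  have h3 := hasMFDerivAt_unique h1 h2
  set D : EuclideanSpace ℝ (Fin m) →L[ℝ] E :=
    mfderiv 𝓘(ℝ, EuclideanSpace ℝ (Fin m)) 𝓘(ℝ, E) (Subtype.val : h ⁻¹' {e} → X) p
  set L : E →L[ℝ] ℂ := mfderiv 𝓘(ℝ, E) 𝓘(ℝ, ℂ) h p
  have h4 : ∀ u, L (D u) = 0 := fun u =>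
    congrArg (fun l : EuclideanSpace ℝ (Fin m) →L[ℝ] ℂ => l u) h3
  have hle : LinearMap.range D.toLinearMap ≤ LinearMap.ker L.toLinearMap := by
    rintro _ ⟨u, rfl⟩
    exact h4 u
  have d1 := L.toLinearMap.finrank_range_add_finrank_ker
  rw [LinearMap.range_eq_top.2 (show Function.Surjective L.toLinearMap from hs), finrank_top, Complex.finrank_real_complex] at d1
  have d2 := LinearMap.finrank_range_of_inj (f := D.toLinearMap) hinj
  rw [finrank_euclideanSpace_fin] at d2
  -- Both spaces have dimension `m`: the range by injectivity, the kernel because `dh` is onto the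
  -- real plane `ℂ` and `m + 2 = dim E`.
  have heq := Submodule.eq_of_le_of_finrank_eq hle (by omega)
  have h5 : w ∈ LinearMap.ker L.toLinearMap ↔ w ∈ LinearMap.range D.toLinearMap := by rw [heq]
  exact h5

/-- The tangent vectors of a leaf are the values of the frame. -/
theorem mem_leafTangent_iff [T2Space X]
    (hι : letI := sliceChartedSpace Λ hex
      ContMDiff 𝓘(ℝ, EuclideanSpace ℝ (Fin m)) 𝓘(ℝ, E) ∞ (Subtype.val : h ⁻¹' {e} → X))
    (hF : IsStraightened (Z × ℂ) (realFrame A) (h ⁻¹' {e})) (x₀ p : h ⁻¹' {e})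
    (hp : (p : X) ∈ leaf (realFrame A 1) (realFrame A Complex.I) (x₀ : X)) :
    letI := sliceChartedSpace Λ hex
    ∀ v : TangentSpace 𝓘(ℝ, EuclideanSpace ℝ (Fin m)) p,
      v ∈ leafTangent (E := EuclideanSpace ℝ (Fin m))
        (Subtype.val ⁻¹' leaf (realFrame A 1) (realFrame A Complex.I) (x₀ : X)) p ↔
      ∃ ζ : ℂ, (mfderiv 𝓘(ℝ, EuclideanSpace ℝ (Fin m)) 𝓘(ℝ, E)
        (Subtype.val : h ⁻¹' {e} → X) p v : E) = A p ζ := by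
  let := sliceChartedSpace Λ hex
  have := isManifold_slice Λ hex
  have : IsManifold 𝓘(ℝ, EuclideanSpace ℝ (Fin m)) 1 (h ⁻¹' {e}) :=
    IsManifold.of_le (n := ∞) (by simp)
  intro v
  obtain ⟨χ, hχ, hpχ⟩ := hex p
  have hχs := hχ.isStraightening (by simp)
  have hinj := slice_mfderiv_injective hι p
  have hιp := ((hι p).mdifferentiableAt (by simp)).hasMFDerivAt
  set D : EuclideanSpace ℝ (Fin m) →L[ℝ] E :=
    mfderiv 𝓘(ℝ, EuclideanSpace ℝ (Fin m)) 𝓘(ℝ, E) (Subtype.val : h ⁻¹' {e} → X) p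
  have hpt := χ.map_source hpχ
  have hfr : ∀ ζ : ℂ, mfderiv 𝓘(ℝ, ℂ × Z × ℂ) 𝓘(ℝ, E) χ.symm (χ p) ((ζ, 0, 0) : ℂ × Z × ℂ) =
      A p ζ := fun ζ => by
    have := hχ.frame _ hpt ζ
    rw [χ.left_inv hpχ] at this
    exact this
  constructor
  · rintro ⟨γ, hγ, hγ0, hγℓ, hγd⟩
    have hγ1 := (contMDiffAt_iff_contMDiffAt_nhds (n := 1) (by simp)).1 (hγ.of_le (by simp))
    have hγs : ∀ᶠ t in 𝓝 0, (γ t : X) ∈ χ.source :=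
      (continuous_subtype_val.continuousAt.comp hγ.continuousAt).eventually
        (χ.open_source.mem_nhds (by simpa [hγ0] using hpχ))
    obtain ⟨ε, hε, hball⟩ := Metric.eventually_nhds_iff_ball.1 (hγ1.and (hγℓ.and hγs))
    have hzc : ContinuousOn (fun t => (χ (γ t : X)).2) (Metric.ball 0 ε) := by
      intro t ht
      obtain ⟨h1, h2, h3⟩ := hball t ht
      have := (χ.continuousAt h3).comp (f := fun t => (γ t : X))
        (continuous_subtype_val.continuousAt.comp h1.continuousAt)
      exact (continuous_snd.continuousAt.comp this).continuousWithinAt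
    have hpre := (convex_ball (0 : ℝ) ε).isPreconnected.image _ hzc
    have hcount : ((fun t => (χ (γ t : X)).2) '' Metric.ball 0 ε).Countable := by
      refine (hF.countable_leaf_image hχs x₀.2).mono ?_
      rintro _ ⟨t, ht, rfl⟩
      exact ⟨γ t, ⟨(hball t ht).2.1, (hball t ht).2.2⟩, rfl⟩
    -- A curve inside a leaf has a connected and countable set of transverse coordinates, so it
    -- stays in one slice and its velocity in the chart has the form `(ζ, 0, 0)`.
    have hconst : ∀ᶠ t in 𝓝 (0 : ℝ), (χ (γ t : X)).2 = (χ p).2 := by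
      filter_upwards [Metric.ball_mem_nhds 0 hε] with t ht
      have := hcount.isTotallyDisconnected _ Subset.rfl hpre ⟨t, ht, rfl⟩
        ⟨0, Metric.mem_ball_self hε, rfl⟩
      simpa only [hγ0] using this
    have hχp : HasMFDerivAt 𝓘(ℝ, E) 𝓘(ℝ, ℂ × Z × ℂ) χ (p : X) _ :=
      (hχ.mdifferentiable.mdifferentiableAt hpχ).hasMFDerivAt
    have hinv := hχ.mdifferentiable.symm_comp_deriv hpχ
    set D' : E →L[ℝ] ℂ × Z × ℂ := mfderiv 𝓘(ℝ, E) 𝓘(ℝ, ℂ × Z × ℂ) χ (p : X)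
    have hd : HasFDerivAt (fun t => χ (γ t : X))
        ((D'.comp D).comp ((1 : ℝ →L[ℝ] ℝ).smulRight (v : EuclideanSpace ℝ (Fin m)))) 0 := by
      have h1 := hχp.comp p hιp
      subst hγ0
      exact (h1.comp (0 : ℝ) hγd).hasFDerivAt
    have h0 : (D' (D v)).2 = 0 := by
      have h1 := hd.snd.unique ((hasFDerivAt_const (χ p).2 (0 : ℝ)).congr_of_eventuallyEq hconst)
      have h2 := congrArg (fun l : ℝ →L[ℝ] Z × ℂ => l 1) h1
      change (D' (D ((1 : ℝ) • (v : EuclideanSpace ℝ (Fin m))))).2 = 0 at h2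
      rwa [one_smul] at h2
    refine ⟨(D' (D v)).1, ?_⟩
    have h1 : D' (D v) = ((D' (D v)).1, 0, 0) := Prod.ext rfl h0
    rw [← hfr, ← h1]
    exact (congrArg (fun l : E →L[ℝ] E => l (D v)) hinv).symm
  · rintro ⟨ζ, hζ⟩
    -- Conversely, the straight line in the slice through `p` is a smooth curve in the leaf with
    -- velocity `A p ζ`; injectivity of the differential of the inclusion identifies its velocity
    -- with `v`.
    set w : ℝ → ℂ × Z × ℂ := fun t => χ p + t • ((ζ, 0, 0) : ℂ × Z × ℂ)
    have hw : ContDiff ℝ ∞ w := contDiff_const.add (contDiff_id.smul contDiff_const)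
    have hw0 : w 0 = χ p := by simp [w]
    have hpe : (χ p).2.2 = e := (hχ.eq_snd_snd _ hpχ).symm.trans p.2
    have hwe : ∀ t, sliceMap Λ e (sliceProj Λ (w t)) = w t := fun t =>
      sliceMap_sliceProj Λ (by simp [w, hpe])
    set φ := sliceChart Λ hχ p
    have hφ0 : φ.symm (sliceProj Λ (w 0)) = p := by
      rw [hw0]
      exact φ.left_inv (x := p) hpχ
    have hwt : ∀ᶠ t in 𝓝 0, w t ∈ χ.target :=
      hw.continuous.continuousAt.eventually (χ.open_target.mem_nhds (hw0 ▸ hpt))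
    have hcoe : ∀ᶠ t in 𝓝 0, (φ.symm (sliceProj Λ (w t)) : X) = χ.symm (w t) := by
      filter_upwards [hwt] with t ht
      rw [coe_sliceChart_symm (by rwa [hwe]), hwe]
    have hsm : ContMDiffAt 𝓘(ℝ, ℝ) 𝓘(ℝ, EuclideanSpace ℝ (Fin m)) ∞
        (fun t => φ.symm (sliceProj Λ (w t))) 0 := by
      refine ((contMDiffOn_sliceChart_symm (hex := hex) hχ p).contMDiffAt
        (φ.open_target.mem_nhds ?_)).comp (0 : ℝ)
        ((contDiff_sliceProj Λ).comp hw).contMDiff.contMDiffAt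
      change sliceMap Λ e (sliceProj Λ (w 0)) ∈ χ.target
      rw [hwe, hw0]
      exact hpt
    refine ⟨_, hsm, hφ0, ?_, ?_⟩
    · filter_upwards [hwt, hcoe] with t ht htc
      rw [mem_preimage, htc]
      refine mem_leaf_trans hp (hχs.mem_leaf hpχ (χ.map_target ht) ?_)
      rw [χ.right_inv ht]
      simp [w]
    · have h1 := (hsm.mdifferentiableAt (by simp)).hasMFDerivAt
      set L : ℝ →L[ℝ] EuclideanSpace ℝ (Fin m) :=
        mfderiv 𝓘(ℝ, ℝ) 𝓘(ℝ, EuclideanSpace ℝ (Fin m)) (fun t => φ.symm (sliceProj Λ (w t))) 0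
      have h2 : HasMFDerivAt 𝓘(ℝ, ℝ) 𝓘(ℝ, E) (fun t => (φ.symm (sliceProj Λ (w t)) : X)) 0
          (D.comp L) := by
        rw [← hφ0] at hιp
        exact hιp.comp (0 : ℝ) h1
      have a1 : MDifferentiableAt 𝓘(ℝ, ℂ × Z × ℂ) 𝓘(ℝ, E) χ.symm (w 0) :=
        hχ.mdifferentiable.symm.mdifferentiableAt (x := w 0) (hw0 ▸ hpt)
      have a2 : HasFDerivAt w ((1 : ℝ →L[ℝ] ℝ).smulRight ((ζ, 0, 0) : ℂ × Z × ℂ)) 0 :=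
        ((1 : ℝ →L[ℝ] ℝ).smulRight ((ζ, 0, 0) : ℂ × Z × ℂ)).hasFDerivAt.const_add (χ p)
      have h3 : HasMFDerivAt 𝓘(ℝ, ℝ) 𝓘(ℝ, E) (fun t => χ.symm (w t)) 0 _ :=
        a1.hasMFDerivAt.comp (0 : ℝ) a2.hasMFDerivAt
      have h4 := hasMFDerivAt_unique h2 (h3.congr_of_eventuallyEq hcoe)
      have h5 : D (L 1) = D v := by
        have h6 := congrArg (fun l : ℝ →L[ℝ] E => l 1) h4
        refine h6.trans ?_
        have h7 := hfr ζ
        rw [← hw0] at h7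
        set D'' : (ℂ × Z × ℂ) →L[ℝ] E := mfderiv 𝓘(ℝ, ℂ × Z × ℂ) 𝓘(ℝ, E) χ.symm (w 0)
        have h8 : D'' ((1 : ℝ) • ((ζ, 0, 0) : ℂ × Z × ℂ)) = A p ζ := by
          rw [one_smul]
          exact h7
        exact h8.trans hζ.symm
      have h6 : L = (1 : ℝ →L[ℝ] ℝ).smulRight (v : EuclideanSpace ℝ (Fin m)) := by
        ext1
        change L 1 = (1 : ℝ) • (v : EuclideanSpace ℝ (Fin m))
        rw [one_smul]
        exact hinj h5
      exact h1.congr_mfderiv h6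

end SliceTangent

/-! ### Trajectories lie in leaves -/

section Trajectories

variable {E : Type*} [NormedAddCommGroup E] [NormedSpace ℝ E]
  {X : Type*} [TopologicalSpace X] [ChartedSpace E X]
  {Y : Type*} [NormedAddCommGroup Y] [NormedSpace ℝ Y]

/-- A curve along which a straight line in `ℂ` is mapped to an integral curve. -/
theorem flowsTo_of_hasMFDerivAt {F : VField ℝ E X} {γ : ℂ → X} {z ζ : ℂ} {r t : ℝ} (ht : |t| < r)
    (hγ : ∀ s : ℝ, |s| < r → ∃ D : ℂ →L[ℝ] E, HasMFDerivAt 𝓘(ℝ, ℂ) 𝓘(ℝ, E) γ (z + s * ζ) D ∧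
      D ζ = F (γ (z + s * ζ))) : FlowsTo F t (γ z) (γ (z + t * ζ)) := by
  have hr : 0 < r := (abs_nonneg t).trans_lt ht
  refine ⟨-r, r, fun s => γ (z + s * ζ), ⟨by linarith, hr⟩, abs_lt.1 ht, by simp, rfl, ?_⟩
  intro s hs
  obtain ⟨D, hD, hDζ⟩ := hγ s (abs_lt.2 hs)
  have h1 : HasFDerivAt (fun s : ℝ => z + s * ζ) ((1 : ℝ →L[ℝ] ℝ).smulRight ζ) s := by
    have := (((1 : ℝ →L[ℝ] ℝ).smulRight ζ).hasFDerivAt (x := s)).const_add z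
    refine this.congr_of_eventuallyEq (Filter.Eventually.of_forall fun t => ?_)
    simp
  have h2 : HasMFDerivAt 𝓘(ℝ, ℝ) 𝓘(ℝ, E) (fun s : ℝ => γ (z + s * ζ)) s
      (D.comp ((1 : ℝ →L[ℝ] ℝ).smulRight ζ)) := hD.comp s h1.hasMFDerivAt
  refine (h2.congr_mfderiv ?_).hasMFDerivWithinAt
  ext
  change D ((1 : ℝ) • ζ) = (1 : ℝ) • (F (γ (z + s * ζ)) : E)
  rw [one_smul, one_smul]
  exact hDζ

/-- Nearby points of `U` are joined by a vertical and then a horizontal segment, whose images are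
integral curves of `F I` and `F 1`: exactly one generating step of `leaf`. Membership in a leaf is
thus locally constant on the connected set `U`. -/
theorem IsStraightened.image_subset_leaf {F : ℂ → VField ℝ E X} {S : Set X}
    (hF : IsStraightened Y F S) {U : Set ℂ} (hU : IsOpen U) (hUc : IsConnected U) {γ : ℂ → X}
    (hγS : ∀ z ∈ U, γ z ∈ S)
    (hγ : ∀ z ∈ U, ∃ D : ℂ →L[ℝ] E, HasMFDerivAt 𝓘(ℝ, ℂ) 𝓘(ℝ, E) γ z D ∧
      D 1 = F 1 (γ z) ∧ D Complex.I = F Complex.I (γ z)) :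
    ∃ x₀ ∈ S, γ '' U ⊆ leaf (F 1) (F Complex.I) x₀ := by
  obtain ⟨z₀, hz₀⟩ := hUc.nonempty
  refine ⟨γ z₀, hγS z₀ hz₀, ?_⟩
  rintro _ ⟨z, hz, rfl⟩
  refine hUc.isPreconnected.iff_of_eventually_iff hU
    (P := fun z => γ z ∈ leaf (F 1) (F Complex.I) (γ z₀)) (fun z hz => ?_) hz₀ hz
    Relation.ReflTransGen.refl
  obtain ⟨ε, hε, hball⟩ := Metric.isOpen_iff.1 hU z hz
  -- Halving `ε` keeps the corner and both segments inside the ball, since the norm is at most `|s|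
  -- + |t|`.
  have hsub : ∀ s t : ℝ, |s| < ε / 2 → |t| < ε / 2 → z + s * Complex.I + t * 1 ∈ U := by
    intro s t hs ht
    refine hball ?_
    rw [Metric.mem_ball, dist_eq_norm]
    have h1 : z + s * Complex.I + t * 1 - z = t + s * Complex.I := by ring
    rw [h1]
    refine (norm_add_le _ _).trans_lt ?_
    rw [norm_mul, Complex.norm_I, mul_one, Complex.norm_real, Complex.norm_real, Real.norm_eq_abs,
      Real.norm_eq_abs]
    linarith
  filter_upwards [Metric.ball_mem_nhds z (half_pos hε)] with w hw
  have hwn : ‖w - z‖ < ε / 2 := by rwa [← dist_eq_norm]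
  have hs : |(w - z).im| < ε / 2 := (Complex.abs_im_le_norm _).trans_lt hwn
  have ht : |(w - z).re| < ε / 2 := (Complex.abs_re_le_norm _).trans_lt hwn
  have hwz : z + ((w - z).im : ℂ) * Complex.I + ((w - z).re : ℂ) * 1 = w := by
    apply Complex.ext <;> simp
  have f1 : FlowsTo (F Complex.I) (w - z).im (γ z) (γ (z + ((w - z).im : ℂ) * Complex.I)) := by
    refine flowsTo_of_hasMFDerivAt hs fun s hs' => ?_
    have := hsub s 0 hs' (by simpa using half_pos hε)
    simp only [Complex.ofReal_zero, zero_mul, add_zero] at this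
    obtain ⟨D, hD, -, hD2⟩ := hγ _ this
    exact ⟨D, hD, hD2⟩
  have f2 : FlowsTo (F 1) (w - z).re (γ (z + ((w - z).im : ℂ) * Complex.I)) (γ w) := by
    have := flowsTo_of_hasMFDerivAt (F := F 1) (γ := γ) (ζ := 1)
      (z := z + ((w - z).im : ℂ) * Complex.I) ht fun s hs' => by
        obtain ⟨D, hD, hD1, -⟩ := hγ _ (hsub _ s hs hs')
        exact ⟨D, hD, hD1⟩
    rwa [hwz] at this
  have hzw : γ w ∈ leaf (F 1) (F Complex.I) (γ z) := Relation.ReflTransGen.single ⟨_, _, _, f1, f2⟩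
  exact ⟨fun h => mem_leaf_trans h (hF.mem_leaf_symm (hγS z hz) hzw), fun h => mem_leaf_trans h hzw⟩

/-- The real part map on the complexified tangent space sends `(v - i w) / 2` to `v / 2`. -/
theorem halfSub_injective_left {x : X} {v w v' w' : TangentSpace 𝓘(ℝ, E) x}
    (h : halfSub v w = halfSub v' w') : v = v' := by
  set T : ℂ ⊗[ℝ] TangentSpace 𝓘(ℝ, E) x →ₗ[ℝ] TangentSpace 𝓘(ℝ, E) x :=
    TensorProduct.lift (LinearMap.lsmul ℝ (TangentSpace 𝓘(ℝ, E) x) ∘ₗ Complex.reLm)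
  have key : ∀ v w : TangentSpace 𝓘(ℝ, E) x, T (halfSub v w) = (1 / 2 : ℝ) • v := by
    intro v w
    have h1 : (1 / 2 : ℂ).re = 1 / 2 := by norm_num
    have h2 : ((1 / 2 : ℂ) * Complex.I).re = 0 := by simp
    simp only [halfSub, smul_sub, TensorProduct.smul_tmul', map_sub, T, TensorProduct.lift.tmul,
      LinearMap.comp_apply, smul_eq_mul, mul_one]
    change (1 / 2 : ℂ).re • v - ((1 / 2 : ℂ) * Complex.I).re • w = _
    rw [h1, h2, zero_smul, sub_zero]
  have h1 := key v w
  rw [h, key] at h1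
  exact (smul_right_injective _ (by norm_num : (1 / 2 : ℝ) ≠ 0) h1).symm

end Trajectories

/-! ### The dimension inequality -/

section SliceData

universe u

variable {𝕜 : Type*} [RCLike 𝕜] [NormedSpace 𝕜 ℂ] {E : Type u}
  [NormedAddCommGroup E] [NormedSpace 𝕜 E] [FiniteDimensional 𝕜 E]
  {X : Type*} [TopologicalSpace X] [ChartedSpace E X]
  {n : ℕ∞ω} {A : X → ℂ →L[𝕜] E} {h : X → ℂ} {S : Set X}

/-- The image of `A x` lies in the kernel of `dh`. The inequality ensures that the natural number
subtractions in the dimensions of the level set and of the transversal are not truncated. -/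
theorem IsIntegrable.finrank_le (hA : IsIntegrable 𝕜 n A h S) (hS : S.Nonempty) :
    2 * Module.finrank 𝕜 ℂ ≤ Module.finrank 𝕜 E := by
  obtain ⟨x, hx⟩ := hS
  set L : E →L[𝕜] ℂ := mfderiv 𝓘(𝕜, E) 𝓘(𝕜, ℂ) h x
  have hL : Function.Surjective L.toLinearMap := hA.surjective x hx
  have hle : LinearMap.range (A x).toLinearMap ≤ LinearMap.ker L.toLinearMap := by
    rintro _ ⟨p, rfl⟩
    exact hA.mfderiv_apply x p
  have d1 := L.toLinearMap.finrank_range_add_finrank_ker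
  rw [LinearMap.range_eq_top.2 hL, finrank_top] at d1
  have d2 := LinearMap.finrank_range_of_inj (f := (A x).toLinearMap) (hA.injective x hx)
  have d3 := Submodule.finrank_mono hle
  omega

end SliceData

/-! ### The empty level set -/

section Empty

variable {𝕜 : Type*} [RCLike 𝕜] {E : Type*} [NormedAddCommGroup E] [NormedSpace 𝕜 E]
  {X : Type*} [TopologicalSpace X] [ChartedSpace E X] {S : Set X} {m d : ℕ} {n : ℕ∞ω}

theorem isSmoothEmbedding_of_isEmpty [IsEmpty S] [ChartedSpace (EuclideanSpace 𝕜 (Fin m)) S] :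
    IsSmoothEmbedding 𝓘(𝕜, EuclideanSpace 𝕜 (Fin m)) 𝓘(𝕜, E) n (Subtype.val : S → X) :=
  ⟨IsImmersionOfComplement.isImmersion (F := 𝕜) fun p => isEmptyElim p, IsEmbedding.subtypeVal⟩

theorem isFoliation_of_isEmpty {M : Type*} [TopologicalSpace M] [IsEmpty M]
    [ChartedSpace (EuclideanSpace 𝕜 (Fin m)) M] : IsFoliation 𝕜 m n d (∅ : Set (Set M)) :=
  ⟨⟨notMem_empty _, fun a => isEmptyElim a⟩, fun _ h => h.elim, fun p => isEmptyElim p⟩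

theorem leaves_eq_empty {E : Type*} [NormedAddCommGroup E] [NormedSpace ℝ E]
    {X : Type*} [TopologicalSpace X] [ChartedSpace E X] {S : Set X} [IsEmpty S]
    (V W : VField ℝ E X) : leaves V W S = ∅ := range_eq_empty _

end Empty

/-! ### Conclusion for holomorphic systems -/

section Holomorphic

variable {E : Type*} [NormedAddCommGroup E] [NormedSpace ℂ E]
  {X : Type*} [TopologicalSpace X] [ChartedSpace E X]

theorem realFrame_holFrame_one (Ω : TwoForm ℂ E X) (H : X → ℂ) :
    realFrame (holFrame Ω H) 1 = realField (hamVF Ω H) :=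
  funext fun x => one_smul ℂ (hamVF Ω H x : E)

theorem realFrame_holFrame_I (Ω : TwoForm ℂ E X) (H : X → ℂ) :
    realFrame (holFrame Ω H) Complex.I = realFieldJ (hamVF Ω H) := rfl

variable [FiniteDimensional ℂ E] [IsManifold 𝓘(ℂ, E) ω X] {Ω : TwoForm ℂ E X} {H : X → ℂ} {e : ℂ}

theorem IsHHS.isStraightened (h : IsHHS Ω H) (he : IsRegularValue ℂ E H e)
    (hS : (H ⁻¹' {e}).Nonempty) :
    IsStraightened (Transverse ℂ (Module.finrank ℂ E - 1) 1 × ℂ) (realFrame (holFrame Ω H))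
      (H ⁻¹' {e}) := by
  have hA := h.isIntegrable he
  have h2 := hA.finrank_le hS
  refine hA.isStraightened (Or.inr rfl) ?_
  rw [Module.finrank_self] at h2 ⊢
  rw [finrank_transverse ℂ (by omega)]
  omega

theorem IsHHS.exists_foliation [T2Space X] (h : IsHHS Ω H) (he : IsRegularValue ℂ E H e) :
    ∃ (_ : ChartedSpace (EuclideanSpace ℂ (Fin (Module.finrank ℂ E - 1))) (H ⁻¹' {e}))
      (_ : IsManifold 𝓘(ℂ, EuclideanSpace ℂ (Fin (Module.finrank ℂ E - 1))) ω (H ⁻¹' {e})),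
      IsSmoothEmbedding 𝓘(ℂ, EuclideanSpace ℂ (Fin (Module.finrank ℂ E - 1))) 𝓘(ℂ, E) ω
        (Subtype.val : H ⁻¹' {e} → X) ∧
      IsFoliation ℂ (Module.finrank ℂ E - 1) ω 1
        (leaves (realField (hamVF Ω H)) (realFieldJ (hamVF Ω H)) (H ⁻¹' {e})) := by
  -- The dimension inequality needs a point of the level set, so the empty case is treated apart.
  rcases (H ⁻¹' {e}).eq_empty_or_nonempty with hS | hS
  · have : IsEmpty (H ⁻¹' {e}) := isEmpty_coe_sort.2 hS
    let := ChartedSpace.empty (EuclideanSpace ℂ (Fin (Module.finrank ℂ E - 1))) (H ⁻¹' {e})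
    rw [leaves_eq_empty]
    exact ⟨this, IsManifold.empty _, isSmoothEmbedding_of_isEmpty, isFoliation_of_isEmpty⟩
  have hA := h.isIntegrable he
  have hF := h.isStraightened he hS
  have h2 := hA.finrank_le hS
  obtain ⟨Λ, hΛ⟩ := exists_linear_chart ℂ (m := Module.finrank ℂ E - 1)
    (Module.finrank_self ℂ) (by rw [Module.finrank_self] at h2; omega)
  rw [Module.finrank_self] at h2
  have hex : ∀ p : H ⁻¹' {e}, ∃ χ : OpenPartialHomeomorph X
      (ℂ × Transverse ℂ (Module.finrank ℂ E - 1) 1 × ℂ),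
      IsAdapted ℂ ω (holFrame Ω H) H χ ∧ (p : X) ∈ χ.source := fun p =>
    hA.exists_isAdapted (Or.inr rfl) (by
      rw [Module.finrank_self, finrank_transverse ℂ (by omega)]
      omega) p.2
  have G : (EuclideanSpace ℂ (Fin (Module.finrank ℂ E - 1)) × ℂ) ≃L[ℂ] E :=
    ContinuousLinearEquiv.ofFinrankEq (by
      rw [Module.finrank_prod, finrank_euclideanSpace_fin, Module.finrank_self]
      omega)
  have hfol := isFoliation_slice (by simp) (by omega) hΛ hF hex
  rw [realFrame_holFrame_one, realFrame_holFrame_I] at hfol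
  exact ⟨sliceChartedSpace Λ hex, isManifold_slice Λ hex, isSmoothEmbedding_slice Λ G hex, hfol⟩

theorem IsHHS.leaf_subset (h : IsHHS Ω H) (he : IsRegularValue ℂ E H e) {x₀ : X} (hx₀ : H x₀ = e) :
    leaf (realField (hamVF Ω H)) (realFieldJ (hamVF Ω H)) x₀ ⊆ H ⁻¹' {e} := by
  rw [← realFrame_holFrame_one, ← realFrame_holFrame_I]
  exact (h.isStraightened he ⟨x₀, hx₀⟩).leaf_subset hx₀

theorem IsHolTrajectory.exists_leaf (h : IsHHS Ω H) (he : IsRegularValue ℂ E H e) {U : Set ℂ}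
    {γ : ℂ → X} (hγ : IsHolTrajectory Ω H U γ) (hγe : ∀ z ∈ U, H (γ z) = e) :
    ∃ x₀, H x₀ = e ∧ γ '' U ⊆ leaf (realField (hamVF Ω H)) (realFieldJ (hamVF Ω H)) x₀ := by
  obtain ⟨z₀, hz₀⟩ := hγ.isConnected.nonempty
  have hF := h.isStraightened he ⟨γ z₀, hγe z₀ hz₀⟩
  rw [← realFrame_holFrame_one, ← realFrame_holFrame_I]
  refine hF.image_subset_leaf hγ.isOpen hγ.isConnected hγe fun z hz => ?_
  have h1 := ((hγ.holomorphic z hz).mdifferentiableAt (hγ.isOpen.mem_nhds hz)).hasMFDerivAt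
  have h2 := hγ.deriv_eq z hz
  set D : ℂ →L[ℂ] E := mfderiv 𝓘(ℂ, ℂ) 𝓘(ℂ, E) γ z
  refine ⟨D.restrictScalars ℝ, HasMFDerivAt.restrictScalars h1, ?_, ?_⟩
  · exact h2.trans (one_smul ℂ (hamVF Ω H (γ z) : E)).symm
  · have h3 : D Complex.I = Complex.I • D 1 := by rw [← map_smul, smul_eq_mul, mul_one]
    exact h3.trans (congrArg (fun v : E => Complex.I • v) h2)

end Holomorphic

/-! ### Conclusion for pseudo-holomorphic systems -/

section PseudoHolomorphic

variable {E : Type*} [NormedAddCommGroup E] [NormedSpace ℝ E]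
  {X : Type*} [TopologicalSpace X] [ChartedSpace E X]

theorem realFrame_frameOf_one (V W : VField ℝ E X) : realFrame (frameOf V W) 1 = V := by
  funext x
  have : frameOf V W x 1 = (V x : E) := by simp [frameOf_apply]; rfl
  exact this

theorem realFrame_frameOf_I (V W : VField ℝ E X) : realFrame (frameOf V W) Complex.I = W := by
  funext x
  have : frameOf V W x Complex.I = (W x : E) := by simp [frameOf_apply]; rfl
  exact this

variable [FiniteDimensional ℝ E] [IsManifold 𝓘(ℝ, E) ∞ X] {J : EndField E X}
  {ΩR : TwoForm ℝ E X} {HR HI : X → ℝ} {e : ℂ}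

theorem IsPHHS.isStraightened (h : IsPHHS J ΩR HR HI)
    (he : IsRegularValue ℝ E (complexHam HR HI) e) (hS : (complexHam HR HI ⁻¹' {e}).Nonempty) :
    IsStraightened (Transverse ℝ (Module.finrank ℝ E - 2) 2 × ℂ)
      (realFrame (pseudoFrame J ΩR HR)) (complexHam HR HI ⁻¹' {e}) := by
  have hA := h.isIntegrable he
  have h2 := hA.finrank_le hS
  refine hA.isStraightened (Or.inl rfl) ?_
  rw [Complex.finrank_real_complex] at h2 ⊢
  rw [finrank_transverse ℝ (by omega)]
  omega

theorem IsPHHS.exists_foliation [T2Space X] (h : IsPHHS J ΩR HR HI)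
    (he : IsRegularValue ℝ E (complexHam HR HI) e) :
    ∃ (_ : ChartedSpace (EuclideanSpace ℝ (Fin (Module.finrank ℝ E - 2)))
          (complexHam HR HI ⁻¹' {e}))
        (_ : IsManifold 𝓘(ℝ, EuclideanSpace ℝ (Fin (Module.finrank ℝ E - 2))) ∞
          (complexHam HR HI ⁻¹' {e}))
        (J' : EndField (EuclideanSpace ℝ (Fin (Module.finrank ℝ E - 2)))
          (complexHam HR HI ⁻¹' {e})),
      IsSmoothEmbedding 𝓘(ℝ, EuclideanSpace ℝ (Fin (Module.finrank ℝ E - 2))) 𝓘(ℝ, E) ∞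
        (Subtype.val : complexHam HR HI ⁻¹' {e} → X) ∧
      (∀ p v, mfderiv 𝓘(ℝ, EuclideanSpace ℝ (Fin (Module.finrank ℝ E - 2))) 𝓘(ℝ, E)
          (Subtype.val : complexHam HR HI ⁻¹' {e} → X) p (J' p v) =
        J p (mfderiv 𝓘(ℝ, EuclideanSpace ℝ (Fin (Module.finrank ℝ E - 2))) 𝓘(ℝ, E)
          (Subtype.val : complexHam HR HI ⁻¹' {e} → X) p v)) ∧
      IsPseudoHolFoliation J' 2
        (leaves (hamVF ΩR HR) (applyJ J (hamVF ΩR HR)) (complexHam HR HI ⁻¹' {e})) := by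
  rcases (complexHam HR HI ⁻¹' {e}).eq_empty_or_nonempty with hS | hS
  · have : IsEmpty (complexHam HR HI ⁻¹' {e}) := isEmpty_coe_sort.2 hS
    let := ChartedSpace.empty (EuclideanSpace ℝ (Fin (Module.finrank ℝ E - 2)))
      (complexHam HR HI ⁻¹' {e})
    rw [leaves_eq_empty]
    exact ⟨this, IsManifold.empty _, fun p => 0, isSmoothEmbedding_of_isEmpty,
      fun p => isEmptyElim p, ⟨⟨fun p => isEmptyElim p, fun p => isEmptyElim p⟩,
        isFoliation_of_isEmpty, fun _ h => h.elim⟩⟩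
  have hA := h.isIntegrable he
  have hF := h.isStraightened he hS
  have h2 := hA.finrank_le hS
  obtain ⟨Λ, hΛ⟩ := exists_linear_chart ℝ (m := Module.finrank ℝ E - 2)
    Complex.finrank_real_complex (by rw [Complex.finrank_real_complex] at h2; omega)
  rw [Complex.finrank_real_complex] at h2
  have hex : ∀ p : complexHam HR HI ⁻¹' {e}, ∃ χ : OpenPartialHomeomorph X
      (ℂ × Transverse ℝ (Module.finrank ℝ E - 2) 2 × ℂ),
      IsAdapted ℝ ∞ (pseudoFrame J ΩR HR) (complexHam HR HI) χ ∧ (p : X) ∈ χ.source := fun p =>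
    hA.exists_isAdapted (Or.inl rfl) (by
      rw [Complex.finrank_real_complex, finrank_transverse ℝ (by omega)]
      omega) p.2
  have G : (EuclideanSpace ℝ (Fin (Module.finrank ℝ E - 2)) × ℂ) ≃L[ℝ] E :=
    ContinuousLinearEquiv.ofFinrankEq (by
      rw [Module.finrank_prod, finrank_euclideanSpace_fin, Complex.finrank_real_complex]
      omega)
  let := sliceChartedSpace Λ hex
  have := isManifold_slice Λ hex
  have hemb := isSmoothEmbedding_slice Λ G hex
  have hfol := isFoliation_slice (by simp) (by omega) hΛ hF hex
  have hι := hemb.isImmersion.contMDiff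
  have hker := fun p : complexHam HR HI ⁻¹' {e} => exists_slice_mfderiv_eq hι
    h.contMDiff_complexHam (by omega) p (hA.surjective p p.2)
  -- The tangent spaces are the kernels of `dH`, which `J` preserves because `dH ∘ J = i dH`.
  obtain ⟨J', hJ', hJ'J⟩ := exists_restrict_almostComplex h.almostComplex hι
    (exists_slice_retraction (Λ := Λ) (hex := hex)) fun p v => by
      refine (hker p _).1 ?_
      rw [h.mfderiv_complexHam_J]
      exact (congrArg (fun c : ℂ => Complex.I * c) ((hker p _).2 ⟨v, rfl⟩)).trans (mul_zero _)
  have htan : ∀ ℓ ∈ leaves (realFrame (pseudoFrame J ΩR HR) 1)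
      (realFrame (pseudoFrame J ΩR HR) Complex.I) (complexHam HR HI ⁻¹' {e}),
      ∀ p ∈ ℓ, ∀ v ∈ leafTangent ℓ p, J' p v ∈ leafTangent ℓ p := by
    rintro _ ⟨x₀, rfl⟩ p hp v hv
    have hiff := mem_leafTangent_iff hι hF x₀ p hp
    obtain ⟨ζ, hζ⟩ := (hiff v).1 hv
    -- `J` acts on the values of the frame as multiplication of the parameter by `i`.
    refine (hiff _).2 ⟨Complex.I * ζ, ?_⟩
    rw [← h.J_pseudoFrame]
    exact (hJ'J p v).trans (congrArg (J p) hζ)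
  rw [realFrame_frameOf_one, realFrame_frameOf_I] at hfol htan
  exact ⟨_, this, J', hemb, hJ'J, hJ', hfol, htan⟩

theorem IsPHHS.leaf_subset (h : IsPHHS J ΩR HR HI) (he : IsRegularValue ℝ E (complexHam HR HI) e)
    {x₀ : X} (hx₀ : complexHam HR HI x₀ = e) :
    leaf (hamVF ΩR HR) (applyJ J (hamVF ΩR HR)) x₀ ⊆ complexHam HR HI ⁻¹' {e} := by
  have := (h.isStraightened he ⟨x₀, hx₀⟩).leaf_subset hx₀
  rwa [realFrame_frameOf_one, realFrame_frameOf_I] at this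

theorem IsPseudoHolTrajectory.exists_leaf (h : IsPHHS J ΩR HR HI)
    (he : IsRegularValue ℝ E (complexHam HR HI) e) {U : Set ℂ} {γ : ℂ → X}
    (hγ : IsPseudoHolTrajectory J ΩR HR U γ) (hγe : ∀ z ∈ U, complexHam HR HI (γ z) = e) :
    ∃ x₀, complexHam HR HI x₀ = e ∧
      γ '' U ⊆ leaf (hamVF ΩR HR) (applyJ J (hamVF ΩR HR)) x₀ := by
  obtain ⟨z₀, hz₀⟩ := hγ.isConnected.nonempty
  have hF := h.isStraightened he ⟨γ z₀, hγe z₀ hz₀⟩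
  have key := hF.image_subset_leaf hγ.isOpen hγ.isConnected hγe fun z hz => by
    have h1 := ((hγ.smooth z hz).contMDiffAt (hγ.isOpen.mem_nhds hz)).mdifferentiableAt (by simp)
    have h2 := halfSub_injective_left (hγ.deriv_eq z hz)
    have h3 := hγ.pseudoHolomorphic z hz 1
    rw [mul_one] at h3
    refine ⟨_, h1.hasMFDerivAt, ?_, ?_⟩
    · rw [realFrame_frameOf_one]
      exact h2
    · rw [realFrame_frameOf_I]
      exact h3.trans (congrArg (J (γ z)) h2)
  rwa [realFrame_frameOf_one, realFrame_frameOf_I] at key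

end PseudoHolomorphic

end HamFol

/-! ### The main theorem -/

theorem mainTheorem8 :
    -- holomorphic Hamiltonian systems
    (∀ {E : Type*} [NormedAddCommGroup E] [NormedSpace ℂ E] [FiniteDimensional ℂ E]
      {X : Type*} [TopologicalSpace X] [T2Space X] [ChartedSpace E X] [IsManifold 𝓘(ℂ, E) ω X]
      (Ω : TwoForm ℂ E X) (H : X → ℂ) (e : ℂ), IsHHS Ω H → IsRegularValue ℂ E H e →
      -- the leaf of a point of the energy hypersurface lies in the hypersurface
      (∀ x₀, H x₀ = e →
        leaf (realField (hamVF Ω H)) (realFieldJ (hamVF Ω H)) x₀ ⊆ H ⁻¹' {e}) ∧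
      -- the hypersurface is a complex submanifold, and the leaves are a holomorphic foliation of it
      (∃ (_ : ChartedSpace (EuclideanSpace ℂ (Fin (Module.finrank ℂ E - 1))) (H ⁻¹' {e}))
          (_ : IsManifold 𝓘(ℂ, EuclideanSpace ℂ (Fin (Module.finrank ℂ E - 1))) ω (H ⁻¹' {e})),
        IsSmoothEmbedding 𝓘(ℂ, EuclideanSpace ℂ (Fin (Module.finrank ℂ E - 1))) 𝓘(ℂ, E) ω
          (Subtype.val : H ⁻¹' {e} → X) ∧
        IsFoliation ℂ (Module.finrank ℂ E - 1) ω 1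
          (leaves (realField (hamVF Ω H)) (realFieldJ (hamVF Ω H)) (H ⁻¹' {e}))) ∧
      -- every holomorphic trajectory of energy `e` lies in one leaf
      (∀ (U : Set ℂ) (γ : ℂ → X), IsHolTrajectory Ω H U γ → (∀ z ∈ U, H (γ z) = e) →
        ∃ x₀, H x₀ = e ∧
          γ '' U ⊆ leaf (realField (hamVF Ω H)) (realFieldJ (hamVF Ω H)) x₀)) ∧
    -- pseudo-holomorphic Hamiltonian systems
    (∀ {E : Type*} [NormedAddCommGroup E] [NormedSpace ℝ E] [FiniteDimensional ℝ E]
      {X : Type*} [TopologicalSpace X] [T2Space X] [ChartedSpace E X] [IsManifold 𝓘(ℝ, E) ∞ X]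
      (J : EndField E X) (ΩR : TwoForm ℝ E X) (HR HI : X → ℝ) (e : ℂ), IsPHHS J ΩR HR HI →
      IsRegularValue ℝ E (complexHam HR HI) e →
      (∀ x₀, complexHam HR HI x₀ = e →
        leaf (hamVF ΩR HR) (applyJ J (hamVF ΩR HR)) x₀ ⊆ complexHam HR HI ⁻¹' {e}) ∧
      -- the hypersurface is an almost complex submanifold, with almost complex structure `J'`
      (∃ (_ : ChartedSpace (EuclideanSpace ℝ (Fin (Module.finrank ℝ E - 2)))
            (complexHam HR HI ⁻¹' {e}))
          (_ : IsManifold 𝓘(ℝ, EuclideanSpace ℝ (Fin (Module.finrank ℝ E - 2))) ∞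
            (complexHam HR HI ⁻¹' {e}))
          (J' : EndField (EuclideanSpace ℝ (Fin (Module.finrank ℝ E - 2)))
            (complexHam HR HI ⁻¹' {e})),
        IsSmoothEmbedding 𝓘(ℝ, EuclideanSpace ℝ (Fin (Module.finrank ℝ E - 2))) 𝓘(ℝ, E) ∞
          (Subtype.val : complexHam HR HI ⁻¹' {e} → X) ∧
        (∀ p v, mfderiv 𝓘(ℝ, EuclideanSpace ℝ (Fin (Module.finrank ℝ E - 2))) 𝓘(ℝ, E)
            (Subtype.val : complexHam HR HI ⁻¹' {e} → X) p (J' p v) =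
          J p (mfderiv 𝓘(ℝ, EuclideanSpace ℝ (Fin (Module.finrank ℝ E - 2))) 𝓘(ℝ, E)
            (Subtype.val : complexHam HR HI ⁻¹' {e} → X) p v)) ∧
        IsPseudoHolFoliation J' 2
          (leaves (hamVF ΩR HR) (applyJ J (hamVF ΩR HR)) (complexHam HR HI ⁻¹' {e}))) ∧
      (∀ (U : Set ℂ) (γ : ℂ → X), IsPseudoHolTrajectory J ΩR HR U γ →
        (∀ z ∈ U, complexHam HR HI (γ z) = e) →
        ∃ x₀, complexHam HR HI x₀ = e ∧
          γ '' U ⊆ leaf (hamVF ΩR HR) (applyJ J (hamVF ΩR HR)) x₀)) := by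
  refine ⟨?_, ?_⟩
  · intro E _ _ _ X _ _ _ _ Ω H e h he
    exact ⟨fun x₀ hx₀ => h.leaf_subset he hx₀, h.exists_foliation he,
      fun U γ hγ hγe => hγ.exists_leaf h he hγe⟩
  · intro E _ _ _ X _ _ _ _ J ΩR HR HI e h he
    exact ⟨fun x₀ hx₀ => h.leaf_subset he hx₀, h.exists_foliation he,
      fun U γ hγ hγe => hγ.exists_leaf h he hγe⟩
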